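/- **Setting.** Let $d\ge1$ and let $\mathfrak F$ be the bosonic or the fermionic Fock space over $L^2(\mathbb R^d)$, i.e. the Hilbert sum over $n\ge0$ of the spaces of symmetric, respectively antisymmetric, functions in $L^2((\mathbb R^d)^n)$. A *state* is a nonnegative trace class operator on $\mathfrak F$ of trace one. Let $v,w,v_c:\mathbb R^d\to\mathbb R$ satisfy: $v_+\in L^1_{\rm loc}$; $v_-,w\in L^p+L^\infty$ with $p=1$ if $d=1$, $p>1$ if $d=2$, $p=d/2$ if $d\ge3$; $w$ is even and, for some $C_0>0$ and all $n\ge2$, $\sum_{1\le i<j\le n}w(x_i-x_j)\ge -C_0n$ a.e. on $(\mathbb R^d)^n$; $v_c\ge0$, $v_c\in L^1_{\rm loc}$, $v_c(x)\to+\infty$ as $|x|\to\infty$, and $\int e^{-tv_c}<\infty$ for all $t>0$. Put $V=v+v_c$ and, for $r_0\in\mathbb R$, $$H_n=\sum_{j=1}^n\big(-\Delta_{x_j}+V(x_j)+r_0\big)+W_n,\qquad W_n=\sum_{1\le i<j\le n}w(x_i-x_j),\qquad \mathbb H=0\oplus\bigoplus_{n\ge1}H_n ,$$ where $H_n$ is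 defined in the sense of quadratic forms on the $\psi\in H^1((\mathbb R^d)^n)$ with $\int (v_++v_c)(x_j)|\psi|^2<\infty$ for all $j$. The parameter $r_0$ is taken sufficiently large, depending only on $d,v,w,v_c$; then $\mathbb H\ge0$ and $W_n+nr_0\ge0$ for all $n$. The *global energy* of a state $\varrho$ is $\mathrm{Tr}(\mathbb H^{1/2}\varrho\,\mathbb H^{1/2})\in[0,\infty]$, and $\mathcal E$ is the set of states with finite global energy. **Local constraints.** Write $\varrho=\sum_j|\psi_j\rangle\langle\psi_j|$ with $\psi_j=(\psi_j^{(n)})_{n\ge 0}\in\mathfrak F$. For $\varrho\in\mathcal E$ the local particle density, current, kinetic energy, interaction energy and total energy are $$n[\varrho](x)=\sum_j\sum_{n\ge1}\sum_{i=1}^n\int|\psi_j^{(n)}|^2\Big|_{x_i=x}\prod_{l\ne i}dx_l,\qquad u[\varrho](x)=\sum_j\sum_{n\ge1}\sum_{i=1}^n\int\Im\big(\overline{\psi_j^{(n)}}\,\nabla_{x_i}\psi_j^{(n)}\big)\Big|_{x_i=x}\prod_{l\ne i}dx_l,$$ $$k[\varrho](x)=\sum_j\sum_{n\ge1}\sum_{i=1}^n\int|\nabla_{x_i}\psi_j^{(n)}|^2\Big|_{x_i=x}\prod_{l\ne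 i}dx_l,\qquad e_I[\varrho](x)=\sum_j\sum_{n\ge1}\frac1n\sum_{i=1}^n\int (W_n+nr_0)|\psi_j^{(n)}|^2\Big|_{x_i=x}\prod_{l\ne i}dx_l,$$ $$e[\varrho]=k[\varrho]+V\,n[\varrho]+e_I[\varrho].$$ Let $n_0\ge0$, $u_0$, $e_0\ge0$ be integrable functions on $\mathbb R^d$, with values in $\mathbb R$, $\mathbb R^d$, $\mathbb R$, such that $$\mathcal A(n_0,u_0,e_0)=\{\varrho\in\mathcal E:\ n[\varrho]=n_0,\ u[\varrho]=u_0,\ e[\varrho]=e_0\ \text{a.e.}\}$$ is not empty. The entropy of a state is $S(\varrho)=\mathrm{Tr}(\varrho\log\varrho)\in[-\infty,0]$. **Proposition 4.4.** Let $(\varrho_m)_{m\in\mathbb N}$ be a sequence in $\mathcal A(n_0,u_0,e_0)$ with $S(\varrho_m)\to\inf_{\mathcal A(n_0,u_0,e_0)}S$, and suppose that it converges weak-$*$ in the trace class to a state $\varrho^\star$, i.e. $\mathrm{Tr}(K\varrho_m)\to\mathrm{Tr}(K\varrho^\star)$ for every compact operator $K$ on $\mathfrak F$. Assume that $\|n[\varrho^\star]\|_{L^1}=\|n_0\|_{L^1}$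 and that the global energy satisfies $\mathrm{Tr}(\mathbb H^{1/2}\varrho^\star\,\mathbb H^{1/2})=\|e_0\|_{L^1}$. Then $\varrho^\star\in\mathcal A(n_0,u_0,e_0)$. -/

import Mathlib

open MeasureTheory Filter Topology
open scoped ENNReal ContDiff InnerProductSpace

namespace ManyBody

noncomputable section

/-! ### Traces on a complex Hilbert space -/

section Trace

variable (E : Type*) [NormedAddCommGroup E] [InnerProductSpace ℂ E] [CompleteSpace E]

/-- Index set of a fixed orthonormal (Hilbert) basis of `E`. -/
def BasisIndex : Set E := (exists_hilbertBasis ℂ E).choose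

/-- A fixed orthonormal (Hilbert) basis of `E`. None of the traces below depends on it. -/
def basis : HilbertBasis (BasisIndex E) ℂ E := (exists_hilbertBasis ℂ E).choose_spec.choose

variable {E}

/-- The trace `Tr T = ∑ ⟨b_j, T b_j⟩` of a trace class operator. -/
def trace (T : E →L[ℂ] E) : ℂ := ∑' j, ⟪basis E j, T (basis E j)⟫_ℂ

/-- The trace, in `[0, ∞]`, of a nonnegative bounded operator. -/
def posTrace (T : E →L[ℂ] E) : ℝ≥0∞ :=
  ∑' j, ENNReal.ofReal (RCLike.re ⟪basis E j, T (basis E j)⟫_ℂ)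

/-- A state: a nonnegative trace class operator with trace one. -/
def IsState (ρ : E →L[ℂ] E) : Prop := ρ.IsPositive ∧ posTrace ρ = 1

/-- The vectors `ψ_j = ρ^{1/2} b_j`, for which `ρ = ∑_j |ψ_j⟩⟨ψ_j|`. -/
def column (ρ : E →L[ℂ] E) (j : BasisIndex E) : E := CFC.sqrt ρ (basis E j)

/-- For a nonnegative self-adjoint operator `A` whose closed quadratic form is
`q ψ = ‖A^{1/2} ψ‖²` (with value `∞` off `D(A^{1/2})`), this is
`Tr (A^{1/2} ρ A^{1/2}) = ‖A^{1/2} ρ^{1/2}‖²_{HS} = ∑_j ‖A^{1/2} ρ^{1/2} b_j‖²`. -/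
def formTrace (q : E → ℝ≥0∞) (ρ : E →L[ℂ] E) : ℝ≥0∞ := ∑' j, q (column ρ j)

/-- The entropy `S(ρ) = Tr (ρ log ρ) ∈ [-∞, 0]` of a state. -/
def entropy (ρ : E →L[ℂ] E) : EReal := -((posTrace (cfc Real.negMulLog ρ) : ℝ≥0∞) : EReal)

/-- Weak-* convergence in the trace class, seen as the dual of the compact operators:
`Tr (K ρ_m) → Tr (K ρ)` for each compact `K`. -/
def WeakStarTendsto (ρ : ℕ → E →L[ℂ] E) (ρs : E →L[ℂ] E) : Prop :=
  ∀ K : E →L[ℂ] E, IsCompactOperator K →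
    Tendsto (fun m => trace (K ∘L ρ m)) atTop (𝓝 (trace (K ∘L ρs)))

end Trace

/-! ### The bosonic and fermionic Fock spaces over `L²(ℝ^d)` -/

/-- The one-particle configuration space `ℝ^d`. -/
abbrev Pos (d : ℕ) : Type := EuclideanSpace ℝ (Fin d)

/-- The `n`-particle configuration space `(ℝ^d)^n`, with Lebesgue measure. -/
abbrev Conf (d n : ℕ) : Type := Fin n → Pos d

/-- `L²((ℝ^d)^n)`, complex valued; for `n = 0` this is `ℂ`. -/
abbrev L2 (d n : ℕ) : Type := Lp ℂ 2 (volume : Measure (Conf d n))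

/-- The two kinds of statistics. -/
inductive Statistics
  | boson
  | fermion

/-- The character by which permutations act: trivial for bosons, the signature for fermions. -/
def Statistics.character : Statistics → {n : ℕ} → Equiv.Perm (Fin n) → ℂ
  | .boson, _, _ => 1
  | .fermion, _, σ => ((Equiv.Perm.sign σ : ℤ) : ℂ)

theorem measurePreserving_permute {d n : ℕ} (σ : Equiv.Perm (Fin n)) :
    MeasurePreserving (fun x : Conf d n => fun i => x (σ i)) volume volume := by
  have h := volume_measurePreserving_piCongrLeft (fun _ : Fin n => Pos d) σ.symm
  convert h using 1
  funext x i
  have := MeasurableEquiv.piCongrLeft_apply_apply (β := fun _ : Fin n => Pos d) σ.symm x (σ i)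
  simpa using this.symm

/-- The permuted function `(x_1, …, x_n) ↦ ψ (x_{σ 1}, …, x_{σ n})`. -/
def permute {d n : ℕ} (σ : Equiv.Perm (Fin n)) : L2 d n →ₗᵢ[ℂ] L2 d n :=
  Lp.compMeasurePreservingₗᵢ ℂ (fun x : Conf d n => fun i => x (σ i)) (measurePreserving_permute σ)

/-- The `n`-particle sector: the symmetric, respectively antisymmetric, functions in
`L²((ℝ^d)^n)`. -/
def sector (s : Statistics) (d n : ℕ) : Submodule ℂ (L2 d n) :=
  ⨅ σ : Equiv.Perm (Fin n),
    LinearMap.ker ((permute (d := d) σ).toContinuousLinearMap -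
      s.character σ • ContinuousLinearMap.id ℂ (L2 d n)).toLinearMap

theorem mem_sector {s : Statistics} {d n : ℕ} {ψ : L2 d n} :
    ψ ∈ sector s d n ↔ ∀ σ : Equiv.Perm (Fin n), permute σ ψ = s.character σ • ψ := by
  simp [sector, Submodule.mem_iInf, sub_eq_zero]

instance (s : Statistics) (d n : ℕ) : CompleteSpace (sector s d n) := by
  have h : IsClosed (sector s d n : Set (L2 d n)) := by
    rw [sector, Submodule.coe_iInf]
    exact isClosed_iInter fun σ => ContinuousLinearMap.isClosed_ker
      ((permute (d := d) σ).toContinuousLinearMap -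
        s.character σ • ContinuousLinearMap.id ℂ (L2 d n))
  exact h.completeSpace_coe

/-- The bosonic or fermionic Fock space, the Hilbert sum of all sectors. -/
abbrev Fock (s : Statistics) (d : ℕ) : Type := lp (fun n => sector s d n) 2

/-- The bounded operators on the Fock space. -/
abbrev FockOp (s : Statistics) (d : ℕ) : Type := Fock s d →L[ℂ] Fock s d

/-- The component `ψ^{(n)}` of `ψ` in the `n`-particle sector. -/
def component {s : Statistics} {d : ℕ} (ψ : Fock s d) (n : ℕ) : L2 d n :=
  ((ψ n : sector s d n) : L2 d n)

/-! ### Weak gradients and `H¹((ℝ^d)^n)` -/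

/-- The unit vector along the `k`-th coordinate of the `i`-th particle. -/
def unitVector {d n : ℕ} (i : Fin n) (k : Fin d) : Conf d n :=
  Pi.single i (EuclideanSpace.single k (1 : ℝ))

/-- `G i k ∈ L²` is the weak derivative of `ψ` along the `k`-th coordinate of the `i`-th
particle, for all `i` and `k`. -/
def IsWeakGradient {d n : ℕ} (ψ : L2 d n) (G : Fin n → Fin d → L2 d n) : Prop :=
  ∀ (i : Fin n) (k : Fin d) (φ : Conf d n → ℝ), ContDiff ℝ ∞ φ → HasCompactSupport φ →
    ∫ x, (fderiv ℝ φ x (unitVector i k) : ℂ) * ψ x = -∫ x, (φ x : ℂ) * G i k x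

/-- `ψ ∈ H¹((ℝ^d)^n)`. -/
def MemH1 {d n : ℕ} (ψ : L2 d n) : Prop := ∃ G, IsWeakGradient ψ G

open Classical in
/-- The (unique) weak gradient of a function in `H¹((ℝ^d)^n)`. -/
def weakGradient {d n : ℕ} (ψ : L2 d n) : Fin n → Fin d → L2 d n :=
  if h : MemH1 ψ then h.choose else 0

/-! ### The potentials and the Hamiltonian -/

/-- One-body potential `v`, pair potential `w`, confining potential `vc`. -/
structure Potentials (d : ℕ) where
  v : Pos d → ℝ
  w : Pos d → ℝ
  vc : Pos d → ℝ

/-- `f ∈ L^p(ℝ^d) + L^∞(ℝ^d)` with `p = 1` if `d = 1`, `p > 1` if `d = 2`, and `p = d/2` if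
`d ≥ 3`. -/
def MemLpAddLinfty {d : ℕ} (f : Pos d → ℝ) : Prop :=
  ∃ p : ℝ≥0∞, (d = 1 → p = 1) ∧ (d = 2 → 1 < p) ∧ (3 ≤ d → p = (d : ℝ≥0∞) / 2) ∧
    ∃ g h : Pos d → ℝ, MemLp g p volume ∧ MemLp h ⊤ volume ∧ f =ᵐ[volume] g + h

namespace Potentials

variable {d : ℕ} (P : Potentials d)

/-- The total pair interaction `∑_{i < j} w(x_i - x_j)`. -/
def interaction {n : ℕ} (x : Conf d n) : ℝ :=
  ∑ i : Fin n, ∑ j ∈ Finset.Ioi i, P.w (x i - x j)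

/-- The assumptions on the potentials. -/
structure Admissible : Prop where
  /-- `v_+ ∈ L¹_loc`. -/
  v_pos : LocallyIntegrable (fun x => max (P.v x) 0) volume
  /-- `v_- ∈ L^p + L^∞`. -/
  v_neg : MemLpAddLinfty (fun x => max (-P.v x) 0)
  w_mem : MemLpAddLinfty P.w
  w_even : ∀ x, P.w (-x) = P.w x
  /-- `w` is classically stable of the second kind. -/
  w_stable : ∃ C₀ : ℝ, 0 < C₀ ∧ ∀ n : ℕ, 2 ≤ n →
    ∀ᵐ x : Conf d n, -C₀ * n ≤ P.interaction x
  vc_nonneg : ∀ x, 0 ≤ P.vc x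
  vc_loc : LocallyIntegrable P.vc volume
  vc_tendsto : Tendsto P.vc (cocompact (Pos d)) atTop
  vc_exp : ∀ t : ℝ, 0 < t → Integrable (fun x => Real.exp (-t * P.vc x)) volume

/-- `V = v + v_c`. -/
def V (x : Pos d) : ℝ := P.v x + P.vc x

/-- The potential `∑_j (V(x_j) + r₀) + ∑_{i<j} w(x_i - x_j)` of the `n`-body operator `H_n`. -/
def total (r₀ : ℝ) {n : ℕ} (x : Conf d n) : ℝ :=
  ∑ j : Fin n, (P.V (x j) + r₀) + P.interaction x

/-- The form domain of `H_n`: the `ψ ∈ H¹` for which the potential energies are finite.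
(Since `v_-` and `w` are form bounded by `-Δ`, the conditions on `v_-` and `w` hold on all of
`H¹`; so this is the set of `ψ ∈ H¹` with `∫ (v_+ + v_c)(x_j) |ψ|² < ∞`.) -/
def InFormDomain {n : ℕ} (ψ : L2 d n) : Prop :=
  MemH1 ψ ∧
  (∀ j : Fin n, Integrable (fun x : Conf d n => P.v (x j) * ‖ψ x‖ ^ 2) volume) ∧
  (∀ j : Fin n, Integrable (fun x : Conf d n => P.vc (x j) * ‖ψ x‖ ^ 2) volume) ∧
  (∀ i j : Fin n, i < j →
    Integrable (fun x : Conf d n => P.w (x i - x j) * ‖ψ x‖ ^ 2) volume)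

open Classical in
/-- The quadratic form `⟨ψ, H_n ψ⟩ = ∫ |∇ψ|² + ∫ (∑_j (V(x_j) + r₀) + ∑_{i<j} w(x_i - x_j)) |ψ|²`
of `H_n` (nonnegative for large `r₀`), with value `∞` off the form domain. It vanishes on the
sector `n = 0`. -/
def sectorForm (r₀ : ℝ) {n : ℕ} (ψ : L2 d n) : ℝ≥0∞ :=
  if P.InFormDomain ψ then
    ENNReal.ofReal ((∑ i : Fin n, ∑ k : Fin d, ∫ x, ‖weakGradient ψ i k x‖ ^ 2) +
      ∫ x, P.total r₀ x * ‖ψ x‖ ^ 2)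
  else ⊤

/-- The quadratic form `‖ℍ^{1/2} ψ‖²` of the second quantized Hamiltonian
`ℍ = 0 ⊕ H_1 ⊕ H_2 ⊕ …`. -/
def fockForm (r₀ : ℝ) {s : Statistics} (ψ : Fock s d) : ℝ≥0∞ :=
  ∑' n, P.sectorForm r₀ (component ψ n)

/-- The global energy `Tr (ℍ^{1/2} ρ ℍ^{1/2})`. -/
def globalEnergy (r₀ : ℝ) {s : Statistics} (ρ : FockOp s d) : ℝ≥0∞ :=
  formTrace (P.fockForm r₀) ρ

/-- The energy space: the states with finite global energy. -/
def energySpace (r₀ : ℝ) (s : Statistics) : Set (FockOp s d) :=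
  {ρ | IsState ρ ∧ P.globalEnergy r₀ ρ < ⊤}

end Potentials

/-! ### Local density, current and energy

For `ρ = ∑_j |ψ_j⟩⟨ψ_j|`, the value at `x` of a local quantity is obtained by putting one of the
particles at `x` and integrating over the other ones, then summing over the choice of this
particle, over the sectors, and over `j`. This gives `n = Tr (a_x^* a_x ρ)`,
`u = Im Tr (a_x^* ∇a_x ρ)`, `k = Tr (∇a_x^* · ∇a_x ρ)`; equivalently `∫ n φ = Tr (dΓ(φ) ρ)`, and
likewise for `u` and `k`. -/

/-- `x ↦ ∑_{n ≥ 1} ∑_{i = 1}^n ∫ F_{n,i}(x_1, …, x_n)|_{x_i = x} ∏_{l ≠ i} dx_l`. -/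
def marginal {d : ℕ} (F : (n : ℕ) → Fin n → Conf d n → ℝ≥0∞) (x : Pos d) : ℝ≥0∞ :=
  ∑' n : ℕ, ∑ i : Fin (n + 1), ∫⁻ y : Conf d n, F (n + 1) i (i.insertNth x y)

/-- The local particle density `n[ρ]`. -/
def density {s : Statistics} {d : ℕ} (ρ : FockOp s d) (x : Pos d) : ℝ :=
  (∑' j, marginal (fun n _ z => ‖component (column ρ j) n z‖ₑ ^ 2) x).toReal

/-- The local current `u[ρ]`. -/
def current {s : Statistics} {d : ℕ} (ρ : FockOp s d) (x : Pos d) : Pos d :=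
  WithLp.toLp 2 fun k => ∑' j, ∑' n : ℕ, ∑ i : Fin (n + 1), ∫ y : Conf d n,
    (starRingEnd ℂ (component (column ρ j) (n + 1) (i.insertNth x y)) *
      weakGradient (component (column ρ j) (n + 1)) i k (i.insertNth x y)).im

/-- The local kinetic energy `k[ρ]`. -/
def kinetic {s : Statistics} {d : ℕ} (ρ : FockOp s d) (x : Pos d) : ℝ :=
  (∑' j, marginal
    (fun n i z => ∑ k : Fin d, ‖weakGradient (component (column ρ j) n) i k z‖ₑ ^ 2) x).toReal

namespace Potentials

variable {d : ℕ} (P : Potentials d)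

/-- The local interaction energy `e_I[ρ]`: the particle density of `𝔹 ρ 𝔹`, where `𝔹` is
multiplication by `((∑_{i<j} w(x_i - x_j) + n r₀) / n)^{1/2}` on the sector `n ≥ 1`. Its integral
is `Tr ((𝕎 + r₀ 𝒩)^{1/2} ρ (𝕎 + r₀ 𝒩)^{1/2})`. -/
def interactionDensity (r₀ : ℝ) {s : Statistics} (ρ : FockOp s d) (x : Pos d) : ℝ :=
  (∑' j, marginal (fun n _ z => ENNReal.ofReal ((P.interaction z + n * r₀) / n) *
    ‖component (column ρ j) n z‖ₑ ^ 2) x).toReal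

/-- The local total energy `e[ρ] = k[ρ] + V n[ρ] + e_I[ρ]`. -/
def energyDensity (r₀ : ℝ) {s : Statistics} (ρ : FockOp s d) (x : Pos d) : ℝ :=
  kinetic ρ x + P.V x * density ρ x + P.interactionDensity r₀ ρ x

/-- The feasible set `𝒜(n₀, u₀, e₀)`: the states of finite energy with the given local particle
density, current and total energy. -/
def feasible (r₀ : ℝ) (s : Statistics) (n₀ : Pos d → ℝ) (u₀ : Pos d → Pos d) (e₀ : Pos d → ℝ) :
    Set (FockOp s d) :=
  {ρ | ρ ∈ P.energySpace r₀ s ∧ density ρ =ᵐ[volume] n₀ ∧ current ρ =ᵐ[volume] u₀ ∧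
    P.energyDensity r₀ ρ =ᵐ[volume] e₀}

/-- The set `ℳ` of admissible local constraints. -/
def IsMoment (r₀ : ℝ) (s : Statistics) (n₀ : Pos d → ℝ) (u₀ : Pos d → Pos d)
    (e₀ : Pos d → ℝ) : Prop :=
  Integrable n₀ volume ∧ (∀ᵐ x, 0 ≤ n₀ x) ∧ Integrable u₀ volume ∧
    Integrable e₀ volume ∧ (∀ᵐ x, 0 ≤ e₀ x) ∧ (P.feasible r₀ s n₀ u₀ e₀).Nonempty

end Potentials

end

end ManyBody

/-! The limit is itself a state, so no trace is lost, and weak-* convergence improves to norm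
convergence. Matrix elements converge and are dominated by products of diagonal ones, whose sums
stay equal to one; this gives Hilbert-Schmidt convergence (`WeakStarTendsto.tendsto`). The square
root is norm continuous on nonnegative operators, so each vector `column (ρ m) j` converges strongly
in Fock space (`WeakStarTendsto.column`). All local quantities are countable sums of quadratic
expressions in these vectors.

For `r₀` large the energy is coercive (`Admissible.exists_coercive`). The negative part of `V` is
form bounded by the kinetic energy with small relative bound, by Sobolev inequalities on the space
of one particle with the others frozen. Stability of `w` together with `r₀` controls the interaction
and the particle number. Hence particle number, kinetic energy and interaction energy are separately
finite on the energy space.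

Density, kinetic energy and shifted interaction energy are nonnegative. By Fatou and weak lower
semicontinuity of weighted `L²` norms, their integrals over any measurable set can only drop in the
limit. Thus the density of the limit is at most `n₀`, and equality of the total masses forces
equality almost everywhere. The energy density has no sign because of `V`, but `k + e_I = e₀ - V n₀`
is nonnegative and the same for all `m`. In the limit it can only drop; since the density is already
identified, the assumption on the global energy says that its integral has not dropped, so again
equality holds almost everywhere.

The current has no sign either. Each of its terms pairs a strongly convergent wave function with a
weakly convergent gradient, so it converges. The tails are uniformly small because `‖ψ‖ ‖∇ψ‖ ≤ ‖ψ‖²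
/ (4δ) + δ ‖∇ψ‖²`: the kinetic sum is bounded, and the sum of the `‖ψ‖²` is the conserved particle
number, whose terms converge as well. So the set integrals of the current converge
(`tendsto_setIntegral_current`), and the limit has current `u₀`. -/

namespace ManyBody

open scoped NNReal

noncomputable section

section

/-! ### Limits of sums -/

/-- A dominated convergence theorem for series, in which the dominating terms vary: up to a part
`δ y` with bounded sum, they converge together with their sums. -/
theorem tendsto_tsum_of_abs_le_mul_add {ι : Type*} {a c y : ℕ → ι → ℝ} {a' c' y' : ι → ℝ}
    {K : ℝ → ℝ} {C : ℝ} (ha : ∀ i, Tendsto (fun m => a m i) atTop (𝓝 (a' i)))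
    (hc : ∀ i, Tendsto (fun m => c m i) atTop (𝓝 (c' i)))
    (hs : ∀ m, Summable (c m)) (hs' : Summable c')
    (hsum : Tendsto (fun m => ∑' i, c m i) atTop (𝓝 (∑' i, c' i)))
    (hy : ∀ m, Summable (y m)) (hy' : Summable y')
    (hy0 : ∀ m i, 0 ≤ y m i) (hy0' : ∀ i, 0 ≤ y' i)
    (hyC : ∀ m, ∑' i, y m i ≤ C) (hyC' : ∑' i, y' i ≤ C)
    (hb : ∀ δ > 0, ∀ m i, |a m i| ≤ K δ * c m i + δ * y m i)
    (hb' : ∀ δ > 0, ∀ i, |a' i| ≤ K δ * c' i + δ * y' i) :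
    Tendsto (fun m => ∑' i, a m i) atTop (𝓝 (∑' i, a' i)) := by
  have hC : 0 ≤ C := (tsum_nonneg hy0').trans hyC'
  -- The tail outside `F` is controlled by the tail of `c` and by the whole sum of `y`. It is stated
  -- for arbitrary terms so as to serve both each `m` and the limit.
  have key : ∀ (a c y : ι → ℝ), Summable c → Summable y → (∀ i, 0 ≤ y i) → ∑' i, y i ≤ C →
      (∀ δ > 0, ∀ i, |a i| ≤ K δ * c i + δ * y i) → ∀ δ > 0, ∀ F : Finset ι,
      |∑' i, a i - ∑ i ∈ F, a i| ≤ K δ * (∑' i, c i - ∑ i ∈ F, c i) + δ * C := by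
    intro a c y hc hy hy0 hyC hb δ hδ F
    have hd : Summable fun i => K δ * c i + δ * y i := (hc.mul_left _).add (hy.mul_left _)
    have hasum : Summable a := Summable.of_norm_bounded hd (hb δ hδ)
    have h1 := hasum.sum_add_tsum_subtype_compl F
    have h2 := hc.sum_add_tsum_subtype_compl F
    have h3 : ∑' i : {x // x ∉ F}, y i ≤ C :=
      (hy.tsum_subtype_le y _ hy0).trans hyC
    rw [← h1, ← h2, add_sub_cancel_left, add_sub_cancel_left]
    have hc2 : Summable fun i : {x // x ∉ F} => c i := hc.subtype _
    have hy2 : Summable fun i : {x // x ∉ F} => y i := hy.subtype _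
    calc |∑' i : {x // x ∉ F}, a i| ≤ ∑' i : {x // x ∉ F}, (K δ * c i + δ * y i) :=
          tsum_of_norm_bounded (f := fun i : {x // x ∉ F} => a i)
            (hd.subtype {x | x ∉ F}).hasSum fun i => hb δ hδ i
      _ = K δ * ∑' i : {x // x ∉ F}, c i + δ * ∑' i : {x // x ∉ F}, y i := by
          rw [(hc2.mul_left _).tsum_add (hy2.mul_left _), tsum_mul_left, tsum_mul_left]
      _ ≤ _ := by gcongr
  rw [Metric.tendsto_atTop']
  intro ε hε
  -- The error consists of two tails, each below `2 * (ε / 6)`, and one finite sum, below `ε / 6`.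
  -- The `C + 1` in the witness allows `C = 0`.
  obtain ⟨δ, hδ, hδC⟩ : ∃ δ > 0, δ * C < ε / 6 := by
    refine ⟨ε / (6 * (C + 1)), by positivity, ?_⟩
    rw [div_mul_eq_mul_div, div_lt_div_iff₀ (by positivity) (by positivity)]
    nlinarith
  have h1 : Tendsto (fun F : Finset ι => K δ * (∑' i, c' i - ∑ i ∈ F, c' i)) atTop (𝓝 0) := by
    simpa using (hs'.hasSum.const_sub (∑' i, c' i)).const_mul (K δ)
  obtain ⟨F, hF⟩ := (h1.eventually (gt_mem_nhds (show 0 < ε / 6 by positivity))).exists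
  have h2 : Tendsto (fun m => K δ * (∑' i, c m i - ∑ i ∈ F, c m i)) atTop
      (𝓝 (K δ * (∑' i, c' i - ∑ i ∈ F, c' i))) :=
    (hsum.sub (tendsto_finsetSum _ fun i _ => hc i)).const_mul _
  have h3 : Tendsto (fun m => ∑ i ∈ F, a m i) atTop (𝓝 (∑ i ∈ F, a' i)) :=
    tendsto_finsetSum _ fun i _ => ha i
  have h4 := (h2.eventually (gt_mem_nhds hF)).and
    (Metric.tendsto_nhds.1 h3 (ε / 6) (by positivity))
  obtain ⟨N, hN⟩ := h4.exists_forall_of_atTop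
  refine ⟨N, fun m hm => ?_⟩
  obtain ⟨h5, h6⟩ := hN m hm.le
  have k1 := abs_le.1 (key (a m) (c m) (y m) (hs m) (hy m) (hy0 m) (hyC m)
    (fun δ hδ => hb δ hδ m) δ hδ F)
  have k2 := abs_le.1 (key a' c' y' hs' hy' hy0' hyC' hb' δ hδ F)
  rw [Real.dist_eq] at h6 ⊢
  have k3 := abs_lt.1 h6
  rw [abs_lt]
  constructor <;> linarith [k1.1, k1.2, k2.1, k2.2, k3.1, k3.2]

/-- Varying nonnegative terms that tend to zero and are dominated by terms which converge together
with their sums have sums that tend to zero. -/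
theorem tendsto_tsum_zero_of_le {ι : Type*} {a c : ℕ → ι → ℝ} {c' : ι → ℝ}
    (ha : ∀ i, Tendsto (fun m => a m i) atTop (𝓝 0))
    (hc : ∀ i, Tendsto (fun m => c m i) atTop (𝓝 (c' i)))
    (hs : ∀ m, Summable (c m)) (hs' : Summable c')
    (hsum : Tendsto (fun m => ∑' i, c m i) atTop (𝓝 (∑' i, c' i)))
    (h0 : ∀ m i, 0 ≤ a m i) (hb : ∀ m i, a m i ≤ c m i) :
    Tendsto (fun m => ∑' i, a m i) atTop (𝓝 0) := by
  have hc0 : ∀ i, 0 ≤ c' i := fun i =>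
    ge_of_tendsto' (hc i) fun m => (h0 m i).trans (hb m i)
  have := tendsto_tsum_of_abs_le_mul_add (a' := fun _ => 0) (y := fun _ _ => 0) (y' := fun _ => 0)
    (K := fun _ => 1) (C := 0) ha hc hs hs' hsum (fun _ => summable_zero) summable_zero
    (by simp) (by simp) (by simp) (by simp)
    (fun δ _ m i => by simpa [abs_of_nonneg (h0 m i)] using hb m i)
    (fun δ _ i => by simpa using hc0 i)
  simpa using this

/-! ### Weak-* convergence of states -/

theorem isCompactOperator_rankOne {E : Type*} [NormedAddCommGroup E] [InnerProductSpace ℂ E]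
    (f g : E) :
    IsCompactOperator (InnerProductSpace.rankOne ℂ f g : E →L[ℂ] E) := by
  rw [InnerProductSpace.rankOne_def']
  have h : IsCompactOperator (ContinuousLinearMap.toSpanSingleton ℂ f) :=
    isCompactOperator_of_locallyCompactSpace_rng
      (ContinuousLinearMap.toSpanSingleton ℂ f : ℂ →L[ℂ] E)
  exact h.comp_clm (innerSL ℂ g)

section Trace

variable {E : Type*} [NormedAddCommGroup E] [InnerProductSpace ℂ E] [CompleteSpace E]

/-- Orthonormal vectors are at distance `√2`, so balls of radius `1 / 2` around them are disjoint
open sets. -/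
theorem countable_basisIndex [TopologicalSpace.SeparableSpace E] : Countable (BasisIndex E) := by
  have ho := (basis E).orthonormal
  have hd : Pairwise (Function.onFun Disjoint fun j : BasisIndex E =>
      Metric.ball (basis E j) (1 / 2)) := by
    intro i j hij
    refine Metric.ball_disjoint_ball ?_
    have h : ‖basis E i - basis E j‖ ^ 2 = 2 := by
      rw [@norm_sub_sq ℂ, ho.1 i, ho.1 j, ho.2 hij]; norm_num
    rw [dist_eq_norm]
    nlinarith [norm_nonneg (basis E i - basis E j)]
  exact hd.countable_of_isOpen_disjoint
    (fun _ => Metric.isOpen_ball) (fun j => ⟨_, Metric.mem_ball_self (by norm_num)⟩)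

theorem trace_rankOne_comp (f g : E) (T : E →L[ℂ] E) :
    trace (InnerProductSpace.rankOne ℂ f g ∘L T) = ⟪g, T f⟫_ℂ := by
  have h : ∀ j, ⟪basis E j, (InnerProductSpace.rankOne ℂ f g ∘L T) (basis E j)⟫_ℂ =
      ⟪T.adjoint g, basis E j⟫_ℂ * ⟪basis E j, f⟫_ℂ := fun j => by
    simp [ContinuousLinearMap.adjoint_inner_left]
  rw [trace, tsum_congr h, (basis E).tsum_inner_mul_inner, ContinuousLinearMap.adjoint_inner_left]

/-- Rank-one operators are compact, so they can be used as test operators. -/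
theorem WeakStarTendsto.inner {ρ : ℕ → E →L[ℂ] E} {ρs : E →L[ℂ] E} (h : WeakStarTendsto ρ ρs)
    (f g : E) : Tendsto (fun m => ⟪g, ρ m f⟫_ℂ) atTop (𝓝 ⟪g, ρs f⟫_ℂ) := by
  simpa only [trace_rankOne_comp] using h _ (isCompactOperator_rankOne f g)

/-- The operator norm is bounded by the Hilbert-Schmidt norm. -/
theorem opNorm_sq_le_tsum {T : E →L[ℂ] E} (h : Summable fun j => ‖T (basis E j)‖ ^ 2) :
    ‖T‖ ^ 2 ≤ ∑' j, ‖T (basis E j)‖ ^ 2 := by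
  set M := ∑' j, ‖T (basis E j)‖ ^ 2
  have hM : 0 ≤ M := tsum_nonneg fun _ => by positivity
  suffices hT : ‖T‖ ≤ √M by
    calc ‖T‖ ^ 2 ≤ √M ^ 2 := by gcongr
      _ = M := Real.sq_sqrt hM
  refine T.opNorm_le_bound (by positivity) fun x => ?_
  have hx : HasSum (fun j => (basis E).repr x j • T (basis E j)) (T x) := by
    simpa using ((basis E).hasSum_repr x).mapL T
  refine le_of_tendsto hx.norm (Eventually.of_forall fun S => ?_)
  have h1 : ∑ j ∈ S, ‖(basis E).repr x j‖ ^ 2 ≤ ‖x‖ ^ 2 := by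
    simpa [HilbertBasis.repr_apply_apply] using (basis E).orthonormal.sum_inner_products_le x (s := S)
  have h2 : ∑ j ∈ S, ‖T (basis E j)‖ ^ 2 ≤ M := h.sum_le_tsum S fun _ _ => by positivity
  calc ‖∑ j ∈ S, (basis E).repr x j • T (basis E j)‖
      ≤ ∑ j ∈ S, ‖(basis E).repr x j‖ * ‖T (basis E j)‖ := by
        refine (norm_sum_le _ _).trans (Finset.sum_le_sum fun j _ => (norm_smul_le _ _))
    _ ≤ √(∑ j ∈ S, ‖(basis E).repr x j‖ ^ 2) * √(∑ j ∈ S, ‖T (basis E j)‖ ^ 2) :=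
        Real.sum_mul_le_sqrt_mul_sqrt _ _ _
    _ ≤ √(‖x‖ ^ 2) * √M := by gcongr
    _ = √M * ‖x‖ := by rw [Real.sqrt_sq (norm_nonneg x), mul_comm]

theorem hasSum_norm_inner_basis_sq (x : E) :
    HasSum (fun k => ‖⟪basis E k, x⟫_ℂ‖ ^ 2) (‖x‖ ^ 2) := by
  have h := (basis E).hasSum_inner_mul_inner x x
  have h1 : ∀ k, ⟪x, basis E k⟫_ℂ * ⟪basis E k, x⟫_ℂ =
      ((‖⟪basis E k, x⟫_ℂ‖ ^ 2 : ℝ) : ℂ) := fun k => by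
    rw [← inner_conj_symm x, RCLike.conj_mul]
    norm_cast
  simp only [h1] at h
  rw [inner_self_eq_norm_sq_to_K] at h
  rw [← Complex.hasSum_ofReal]
  simpa using h

theorem inner_sqrt_sqrt {ρ : E →L[ℂ] E} (hρ : ρ.IsPositive) (x y : E) :
    ⟪CFC.sqrt ρ x, CFC.sqrt ρ y⟫_ℂ = ⟪x, ρ y⟫_ℂ := by
  have h0 : 0 ≤ ρ := (ContinuousLinearMap.nonneg_iff_isPositive ρ).2 hρ
  have hs : IsSelfAdjoint (CFC.sqrt ρ) := (CFC.sqrt_nonneg ρ).isSelfAdjoint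
  have h1 := hs.isSymmetric x (CFC.sqrt ρ y)
  have h2 : CFC.sqrt ρ (CFC.sqrt ρ y) = ρ y := by
    rw [← mul_apply_eq_comp, CFC.sqrt_mul_sqrt_self ρ h0]
  rw [← h2]; exact h1

/-- This makes the norms of the columns accessible to weak-* convergence before the columns
themselves are known to converge. -/
theorem re_inner_eq_norm_column_sq {ρ : E →L[ℂ] E} (hρ : ρ.IsPositive) (j : BasisIndex E) :
    RCLike.re ⟪basis E j, ρ (basis E j)⟫_ℂ = ‖column ρ j‖ ^ 2 := by
  rw [← inner_sqrt_sqrt hρ, inner_self_eq_norm_sq]; rfl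

theorem IsState.hasSum {ρ : E →L[ℂ] E} (hρ : IsState ρ) :
    HasSum (fun j => ‖column ρ j‖ ^ 2) 1 := by
  have h := hρ.2
  simp only [posTrace, re_inner_eq_norm_column_sq hρ.1] at h
  have hs : Summable fun j => ‖column ρ j‖ ^ 2 := by
    refine summable_of_sum_le (c := 1) (fun _ => by positivity) fun S => ?_
    rw [← ENNReal.ofReal_le_ofReal_iff zero_le_one,
      ENNReal.ofReal_sum_of_nonneg fun _ _ => by positivity, ENNReal.ofReal_one, ← h]
    exact ENNReal.sum_le_tsum S
  rw [← ENNReal.ofReal_tsum_of_nonneg (fun _ => by positivity) hs] at h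
  have : ∑' j, ‖column ρ j‖ ^ 2 = 1 := by simpa using h
  exact this ▸ hs.hasSum

theorem norm_inner_basis_sq_le {ρ : E →L[ℂ] E} (hρ : ρ.IsPositive) (k j : BasisIndex E) :
    ‖⟪basis E k, ρ (basis E j)⟫_ℂ‖ ^ 2 ≤ ‖column ρ k‖ ^ 2 * ‖column ρ j‖ ^ 2 := by
  rw [← inner_sqrt_sqrt hρ, ← mul_pow]
  gcongr
  exact norm_inner_le_norm _ _

theorem IsState.norm_apply_basis_sq_le {ρ : E →L[ℂ] E} (hρ : IsState ρ) (j : BasisIndex E) :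
    ‖ρ (basis E j)‖ ^ 2 ≤ ‖column ρ j‖ ^ 2 := by
  have h1 : HasSum (fun k => ‖⟪basis E k, ρ (basis E j)⟫_ℂ‖ ^ 2) (‖ρ (basis E j)‖ ^ 2)  :=
    hasSum_norm_inner_basis_sq _
  simpa using hasSum_le (fun k => norm_inner_basis_sq_le hρ.1 k j) h1
    (hρ.hasSum.mul_right (‖column ρ j‖ ^ 2))

theorem add_sq_le_two_mul (a b : ℝ) : (a + b) ^ 2 ≤ 2 * a ^ 2 + 2 * b ^ 2 := by
  nlinarith [sq_nonneg (a - b)]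

theorem norm_sub_sq_le {F : Type*} [SeminormedAddCommGroup F] (x y : F) :
    ‖x - y‖ ^ 2 ≤ 2 * ‖x‖ ^ 2 + 2 * ‖y‖ ^ 2 :=
  (pow_le_pow_left₀ (norm_nonneg _) (norm_sub_le x y) 2).trans (add_sq_le_two_mul _ _)

/-- Weak-* convergence of states to a state implies convergence in norm. -/
theorem WeakStarTendsto.tendsto {ρ : ℕ → E →L[ℂ] E} {ρs : E →L[ℂ] E} (h : WeakStarTendsto ρ ρs)
    (hρ : ∀ m, IsState (ρ m)) (hs : IsState ρs) : Tendsto ρ atTop (𝓝 ρs) := by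
  have hp : ∀ j, Tendsto (fun m => ‖column (ρ m) j‖ ^ 2) atTop (𝓝 (‖column ρs j‖ ^ 2)) := by
    intro j
    simp only [← re_inner_eq_norm_column_sq hs.1, ← re_inner_eq_norm_column_sq (hρ _).1]
    exact (RCLike.continuous_re.tendsto _).comp (h.inner (basis E j) (basis E j))
  have hsum : ∀ m, ∑' j, ‖column (ρ m) j‖ ^ 2 = 1 := fun m => (hρ m).hasSum.tsum_eq
  have hsum' : ∑' j, ‖column ρs j‖ ^ 2 = 1 := hs.hasSum.tsum_eq
  -- For fixed `j`, the entries in row `k` are dominated by products of diagonal entries, and these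
  -- sum over `k` to the `j`-th diagonal entry because the traces are one.
  have hb : ∀ j, Tendsto (fun m => ‖(ρ m - ρs) (basis E j)‖ ^ 2) atTop (𝓝 0) := by
    intro j
    have h1 : ∀ m, ‖(ρ m - ρs) (basis E j)‖ ^ 2 =
        ∑' k, ‖⟪basis E k, ρ m (basis E j)⟫_ℂ - ⟪basis E k, ρs (basis E j)⟫_ℂ‖ ^ 2 := fun m => by
      rw [← (hasSum_norm_inner_basis_sq ((ρ m - ρs) (basis E j))).tsum_eq]
      simp
    simp only [h1]
    refine tendsto_tsum_zero_of_le
      (c := fun m k => 2 * (‖column (ρ m) k‖ ^ 2 * ‖column (ρ m) j‖ ^ 2) +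
        2 * (‖column ρs k‖ ^ 2 * ‖column ρs j‖ ^ 2))
      (fun k => ?_)
      (fun k => (((hp k).mul (hp j)).const_mul 2).add_const _) (fun m => ?_) ?_ ?_
      (fun _ _ => by positivity) (fun m k => ?_)
    · have := ((h.inner (basis E j) (basis E k)).sub_const
        ⟪basis E k, ρs (basis E j)⟫_ℂ).norm.pow 2
      simpa using this
    · exact (((hρ m).hasSum.summable.mul_right _).mul_left _).add
        ((hs.hasSum.summable.mul_right _).mul_left _)
    · exact ((hs.hasSum.summable.mul_right _).mul_left _).add
        ((hs.hasSum.summable.mul_right _).mul_left _)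
    · have h2 : ∀ m, ∑' k, (2 * (‖column (ρ m) k‖ ^ 2 * ‖column (ρ m) j‖ ^ 2) +
        2 * (‖column ρs k‖ ^ 2 * ‖column ρs j‖ ^ 2)) =
          2 * (1 * ‖column (ρ m) j‖ ^ 2) + 2 * (1 * ‖column ρs j‖ ^ 2) := fun m =>
        ((((hρ m).hasSum.mul_right _).mul_left _).add ((hs.hasSum.mul_right _).mul_left _)).tsum_eq
      have h3 : ∑' k, (2 * (‖column ρs k‖ ^ 2 * ‖column ρs j‖ ^ 2) +
        2 * (‖column ρs k‖ ^ 2 * ‖column ρs j‖ ^ 2)) =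
          2 * (1 * ‖column ρs j‖ ^ 2) + 2 * (1 * ‖column ρs j‖ ^ 2) :=
        (((hs.hasSum.mul_right _).mul_left _).add ((hs.hasSum.mul_right _).mul_left _)).tsum_eq
      simp only [h2, h3]
      exact (((hp j).const_mul 1).const_mul 2).add_const _
    · refine (norm_sub_sq_le _ _).trans ?_
      exact add_le_add
        (mul_le_mul_of_nonneg_left (norm_inner_basis_sq_le (hρ m).1 k j) zero_le_two)
        (mul_le_mul_of_nonneg_left (norm_inner_basis_sq_le hs.1 k j) zero_le_two)
  have hle : ∀ m j, ‖(ρ m - ρs) (basis E j)‖ ^ 2 ≤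
      2 * ‖column (ρ m) j‖ ^ 2 + 2 * ‖column ρs j‖ ^ 2 := fun m j => by
    exact (norm_sub_sq_le _ _).trans (add_le_add
      (mul_le_mul_of_nonneg_left ((hρ m).norm_apply_basis_sq_le j) zero_le_two)
      (mul_le_mul_of_nonneg_left (hs.norm_apply_basis_sq_le j) zero_le_two))
  have hsm : ∀ m, HasSum (fun j => 2 * ‖column (ρ m) j‖ ^ 2 + 2 * ‖column ρs j‖ ^ 2)
      (2 * 1 + 2 * 1) := fun m => ((hρ m).hasSum.mul_left 2).add (hs.hasSum.mul_left 2)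
  have hsm' : HasSum (fun j => 2 * ‖column ρs j‖ ^ 2 + 2 * ‖column ρs j‖ ^ 2)
      (2 * 1 + 2 * 1) := (hs.hasSum.mul_left 2).add (hs.hasSum.mul_left 2)
  -- Second dominated convergence, now over `j`: the dominating sums all equal `2 * 1 + 2 * 1`. That
  -- the limit has trace one too is essential here.
  have hlim : Tendsto (fun m => ∑' j, ‖(ρ m - ρs) (basis E j)‖ ^ 2) atTop (𝓝 0) :=
    tendsto_tsum_zero_of_le hb (fun j => ((hp j).const_mul 2).add_const _)
      (fun m => (hsm m).summable) hsm'.summable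
      (by simp only [(hsm _).tsum_eq, hsm'.tsum_eq]; exact tendsto_const_nhds)
      (fun _ _ => by positivity) hle
  have hsq : Tendsto (fun m => ‖ρ m - ρs‖ ^ 2) atTop (𝓝 0) :=
    squeeze_zero (fun _ => by positivity) (fun m => opNorm_sq_le_tsum
      ((hsm m).summable.of_nonneg_of_le (fun _ => by positivity) (hle m))) hlim
  rw [tendsto_iff_norm_sub_tendsto_zero]
  simpa using hsq.sqrt

/-- The square root is not weakly continuous; the passage through norm convergence is what makes its
columns converge. -/
theorem WeakStarTendsto.column {ρ : ℕ → E →L[ℂ] E} {ρs : E →L[ℂ] E} (h : WeakStarTendsto ρ ρs)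
    (hρ : ∀ m, IsState (ρ m)) (hs : IsState ρs) (j : BasisIndex E) :
    Tendsto (fun m => column (ρ m) j) atTop (𝓝 (column ρs j)) := by
  have h0 : ∀ {σ : E →L[ℂ] E}, IsState σ → 0 ≤ σ := fun hσ =>
    (ContinuousLinearMap.nonneg_iff_isPositive _).2 hσ.1
  have h1 : Tendsto (fun m => CFC.sqrt (ρ m)) atTop (𝓝 (CFC.sqrt ρs)) :=
    (CFC.continuousOn_sqrt ρs (h0 hs)).tendsto.comp
      (tendsto_nhdsWithin_iff.2 ⟨h.tendsto hρ hs, Eventually.of_forall fun m => h0 (hρ m)⟩)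
  exact ((ContinuousLinearMap.apply ℂ E (basis E j)).continuous.tendsto _).comp h1

end Trace

end

section

/-! ### Components in the Fock space -/

instance separableSpace_sector (s : Statistics) (d n : ℕ) :
    TopologicalSpace.SeparableSpace (sector s d n) := by
  have : Fact ((2 : ℝ≥0∞) ≠ ⊤) := ⟨by norm_num⟩
  infer_instance

/-- Finite sums of vectors from the separable sectors are dense. Separability makes the basis
countable, as needed to exchange the sum over `j` with integrals. -/
instance separableSpace_fock (s : Statistics) (d : ℕ) :
    TopologicalSpace.SeparableSpace (Fock s d) := by
  rw [← TopologicalSpace.isSeparable_univ_iff]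
  have h1 : ∀ n, TopologicalSpace.IsSeparable
      (Set.range fun x : sector s d n => (lp.single 2 n x : Fock s d)) := fun n =>
    TopologicalSpace.isSeparable_range (lp.isometry_single (p := 2) (E := fun n => sector s d n) n).continuous
  have h2 := (TopologicalSpace.IsSeparable.iUnion h1).span (R := ℂ)
  refine h2.closure.mono fun ψ _ => ?_
  refine mem_closure_of_tendsto (lp.hasSum_single (by norm_num) ψ)
    (Eventually.of_forall fun S => ?_)
  exact Submodule.sum_mem _ fun n _ => Submodule.subset_span (Set.mem_iUnion.2 ⟨n, ψ n, rfl⟩)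

instance countable_basisIndex_fock (s : Statistics) (d : ℕ) :
    Countable (BasisIndex (Fock s d)) := countable_basisIndex

theorem tendsto_component {s : Statistics} {d : ℕ} {ψ : ℕ → Fock s d} {φ : Fock s d}
    (h : Tendsto ψ atTop (𝓝 φ)) (n : ℕ) :
    Tendsto (fun m => component (ψ m) n) atTop (𝓝 (component φ n)) := by
  rw [tendsto_iff_norm_sub_tendsto_zero] at h ⊢
  refine squeeze_zero (fun _ => norm_nonneg _) (fun m => ?_) h
  exact lp.norm_apply_le_norm (by norm_num) (ψ m - φ) n

/-! ### Integrals of marginals -/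

theorem lintegral_insertNth {d n : ℕ} (i : Fin (n + 1)) {f : Conf d (n + 1) → ℝ≥0∞}
    (hf : AEMeasurable f) :
    ∫⁻ x : Pos d, ∫⁻ y : Conf d n, f (i.insertNth x y) = ∫⁻ z, f z := by
  have h := (volume_preserving_piFinSuccAbove (fun _ : Fin (n + 1) => Pos d) i).symm
  rw [← h.lintegral_comp_emb (MeasurableEquiv.measurableEmbedding _), Measure.volume_eq_prod,
    lintegral_prod (fun p => f ((MeasurableEquiv.piFinSuccAbove (fun _ => Pos d) i).symm p))
      (hf.comp_quasiMeasurePreserving h.quasiMeasurePreserving)]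
  rfl

theorem aemeasurable_lintegral_insertNth {d n : ℕ} (i : Fin (n + 1)) {f : Conf d (n + 1) → ℝ≥0∞}
    (hf : AEMeasurable f) :
    AEMeasurable fun x : Pos d => ∫⁻ y : Conf d n, f (i.insertNth x y) := by
  have h := (volume_preserving_piFinSuccAbove (fun _ : Fin (n + 1) => Pos d) i).symm
  exact (hf.comp_quasiMeasurePreserving h.quasiMeasurePreserving).lintegral_prod_right'

theorem aemeasurable_marginal {d : ℕ} {F : (n : ℕ) → Fin n → Conf d n → ℝ≥0∞}
    (hF : ∀ n i, AEMeasurable (F n i)) : AEMeasurable (marginal F) := by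
  unfold marginal
  exact AEMeasurable.tsum fun n => Finset.aemeasurable_fun_sum _ fun i _ =>
    aemeasurable_lintegral_insertNth i (hF _ i)

theorem aemeasurable_comp_eval {d n : ℕ} (i : Fin n) {g : Pos d → ℝ≥0∞} (hg : AEMeasurable g) :
    AEMeasurable fun z : Conf d n => g (z i) :=
  hg.comp_quasiMeasurePreserving (Measure.quasiMeasurePreserving_eval _ i)

/-- Tonelli undoes the fibre integration; a weight at the marked point becomes a one-body
multiplier. All integrated local quantities reduce to sector integrals in this way. -/
theorem lintegral_mul_marginal {d : ℕ} {F : (n : ℕ) → Fin n → Conf d n → ℝ≥0∞}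
    (hF : ∀ n i, AEMeasurable (F n i)) {g : Pos d → ℝ≥0∞} (hg : AEMeasurable g) :
    ∫⁻ x, g x * marginal F x = ∑' n : ℕ, ∑ i : Fin n, ∫⁻ z, g (z i) * F n i z := by
  have h1 : ∀ x, g x * marginal F x = ∑' n : ℕ, ∑ i : Fin (n + 1),
      g x * ∫⁻ y : Conf d n, F (n + 1) i (i.insertNth x y) := fun x => by
    simp only [marginal, ← ENNReal.tsum_mul_left, Finset.mul_sum]
  have hm : ∀ (n : ℕ) (i : Fin (n + 1)), AEMeasurable fun x : Pos d =>
      g x * ∫⁻ y : Conf d n, F (n + 1) i (i.insertNth x y) := fun n i =>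
    hg.mul (aemeasurable_lintegral_insertNth i (hF _ i))
  simp only [h1]
  rw [lintegral_tsum fun n => Finset.aemeasurable_fun_sum _ fun i _ => hm n i]
  -- The sector `n = 0` contributes an empty sum, which absorbs the shift to `n + 1` in `marginal`.
  rw [tsum_eq_zero_add' (f := fun n : ℕ => ∑ i : Fin n, ∫⁻ z, g (z i) * F n i z) ENNReal.summable]
  simp only [Finset.univ_eq_empty, Finset.sum_empty, zero_add]
  refine tsum_congr fun n => ?_
  rw [lintegral_finsetSum' _ fun i _ => hm n i]
  refine Finset.sum_congr rfl fun i _ => ?_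
  rw [← lintegral_insertNth (f := fun z => g (z i) * F (n + 1) i z) i
    ((aemeasurable_comp_eval i hg).mul (hF _ i))]
  -- The constant `g x` may be infinite, so it can be moved through the fibre integral only where
  -- the slice is measurable, that is, for almost every `x`.
  have hmi : AEMeasurable (fun p : Pos d × Conf d n => F (n + 1) i (i.insertNth p.1 p.2))
      (volume.prod volume) :=
    (hF _ i).comp_quasiMeasurePreserving
      (volume_preserving_piFinSuccAbove (fun _ : Fin (n + 1) => Pos d) i).symm.quasiMeasurePreserving
  refine lintegral_congr_ae ?_
  filter_upwards [hmi.aestronglyMeasurable.prodMk_left] with x hx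
  simp only [Fin.insertNth_apply_same]
  rw [lintegral_const_mul'' _ hx.aemeasurable]

end

section

/-! ### The Sobolev inequality on the one-particle space -/


/-- The square of the `H¹` norm of a differentiable function. -/
def sobolevEnergy {d : ℕ} (u : Pos d → ℂ) : ℝ≥0∞ :=
  (∫⁻ x, ‖u x‖ₑ ^ 2) + ∫⁻ x, ‖fderiv ℝ u x‖ₑ ^ 2

theorem lintegral_fderiv_le_sobolevEnergy {d : ℕ} (u : Pos d → ℂ) :
    ∫⁻ x, ‖fderiv ℝ u x‖ₑ ^ 2 ≤ sobolevEnergy u := le_add_self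

/-- Multiplication by a potential in `L^q(ℝ^d)` is bounded as a quadratic form on `H¹(ℝ^d)`. -/
def SobolevExponent (d : ℕ) (q : ℝ) : Prop :=
  ∃ K : ℝ≥0, ∀ u : Pos d → ℂ, ContDiff ℝ 1 u → HasCompactSupport u →
    ∀ f : Pos d → ℝ≥0∞, AEMeasurable f →
      ∫⁻ x, f x * ‖u x‖ₑ ^ 2 ≤ K * (∫⁻ x, f x ^ q) ^ (1 / q) * sobolevEnergy u

theorem aemeasurable_enorm_sq {α F : Type*} [MeasurableSpace α] [TopologicalSpace α]
    [OpensMeasurableSpace α] [NormedAddCommGroup F] {u : α → F} (hu : Continuous u)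
    {μ : Measure α} : AEMeasurable (fun x => ‖u x‖ₑ ^ 2) μ :=
  (continuous_enorm.comp hu).measurable.aemeasurable.pow_const 2

/-- By Hölder, it suffices to embed `H¹` into `L^{2q'}` with `q'` conjugate to `q`. -/
theorem sobolevExponent_of_holderConjugate {d : ℕ} {q q' : ℝ} (hq : q.HolderConjugate q') {K : ℝ≥0}
    (h : ∀ u : Pos d → ℂ, ContDiff ℝ 1 u → HasCompactSupport u →
      (∫⁻ x, (‖u x‖ₑ ^ 2) ^ q') ^ (1 / q') ≤ K * sobolevEnergy u) : SobolevExponent d q := by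
  refine ⟨K, fun u hu hc f hf => ?_⟩
  calc ∫⁻ x, f x * ‖u x‖ₑ ^ 2
      ≤ (∫⁻ x, f x ^ q) ^ (1 / q) * (∫⁻ x, (‖u x‖ₑ ^ 2) ^ q') ^ (1 / q') :=
        ENNReal.lintegral_mul_le_Lp_mul_Lq volume hq hf (aemeasurable_enorm_sq hu.continuous)
    _ ≤ (∫⁻ x, f x ^ q) ^ (1 / q) * (K * sobolevEnergy u) := by gcongr; exact h u hu hc
    _ = _ := by ring

/-- The conjugate of `d / 2` is `d / (d - 2)`, and twice this is the critical Sobolev exponent `2d /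
(d - 2)`. -/
theorem sobolevExponent_of_three_le {d : ℕ} (hd : 3 ≤ d) : SobolevExponent d (d / 2) := by
  have hd' : (3 : ℝ) ≤ d := by exact_mod_cast hd
  have hd2 : (0 : ℝ) < d - 2 := by linarith
  have hq : ((d : ℝ) / 2).HolderConjugate (d / (d - 2)) := by
    rw [Real.holderConjugate_iff]
    refine ⟨by rw [lt_div_iff₀] <;> linarith, ?_⟩
    field_simp
    ring
  set C := eLpNormLESNormFDerivOfEqInnerConst (volume : Measure (Pos d)) 2
  refine sobolevExponent_of_holderConjugate hq (K := C ^ 2) fun u hu hc => ?_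
  let p' : ℝ≥0 := ⟨2 * d / (d - 2), by positivity⟩
  have hp' : (p' : ℝ) = 2 * d / (d - 2) := rfl
  have hp0 : p' ≠ 0 := by
    rw [← NNReal.coe_ne_zero, hp']
    positivity
  have h := eLpNorm_le_eLpNorm_fderiv_of_eq_inner volume hu hc (p := 2) (p' := p') one_le_two
    (by simp; omega) (by
      rw [hp']
      simp only [finrank_euclideanSpace, Fintype.card_fin, NNReal.coe_ofNat, NNReal.coe_inv]
      field_simp)
  rw [eLpNorm_nnreal_eq_lintegral hp0, eLpNorm_nnreal_eq_lintegral two_ne_zero] at h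
  have h2 : (∫⁻ x, (‖u x‖ₑ ^ 2) ^ ((d : ℝ) / (d - 2))) ^ (1 / ((d : ℝ) / (d - 2))) =
      ((∫⁻ x, ‖u x‖ₑ ^ (p' : ℝ)) ^ (1 / (p' : ℝ))) ^ 2 := by
    have h3 : ∀ x, (‖u x‖ₑ ^ 2) ^ ((d : ℝ) / (d - 2)) = ‖u x‖ₑ ^ (p' : ℝ) := fun x => by
      rw [← ENNReal.rpow_natCast, ← ENNReal.rpow_mul, hp']
      congr 1
      push_cast
      ring
    simp only [h3]
    rw [← ENNReal.rpow_natCast, ← ENNReal.rpow_mul, hp']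
    congr 1
    push_cast
    field_simp
  rw [h2]
  calc _ ≤ ((C : ℝ≥0∞) * (∫⁻ x, ‖fderiv ℝ u x‖ₑ ^ ((2 : ℝ≥0) : ℝ)) ^ (1 / ((2 : ℝ≥0) : ℝ))) ^ 2 :=
        pow_le_pow_left' h 2
    _ = C ^ 2 * ∫⁻ x, ‖fderiv ℝ u x‖ₑ ^ 2 := by
        rw [mul_pow]
        congr 1
        rw [← ENNReal.rpow_natCast, ← ENNReal.rpow_mul]
        simp
    _ ≤ _ := by
        rw [ENNReal.coe_pow]
        exact mul_le_mul_right (lintegral_fderiv_le_sobolevEnergy u) _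

theorem lintegral_mul_sq_le {α : Type*} [MeasurableSpace α] {μ : Measure α} {f g : α → ℝ≥0∞}
    (hf : AEMeasurable f μ) (hg : AEMeasurable g μ) :
    (∫⁻ x, f x * g x ∂μ) ^ 2 ≤ (∫⁻ x, f x ^ 2 ∂μ) * ∫⁻ x, g x ^ 2 ∂μ := by
  have h := pow_le_pow_left'
    (ENNReal.lintegral_mul_le_Lp_mul_Lq μ Real.HolderConjugate.two_two hf hg) 2
  have h2 : ∀ a : ℝ≥0∞, (a ^ (1 / 2 : ℝ)) ^ 2 = a := fun a => by
    rw [← ENNReal.rpow_natCast, ← ENNReal.rpow_mul]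
    simp
  rw [mul_pow, h2, h2] at h
  simpa using h

theorem two_mul_mul_le_sq_add_sq (a b : ℝ≥0∞) : 2 * a * b ≤ a ^ 2 + b ^ 2 := by
  induction a with
  | top => simp
  | coe a =>
    induction b with
    | top => simp
    | coe b => exact_mod_cast two_mul_le_add_sq a b

/-- The two-dimensional Gagliardo-Nirenberg inequality with even exponents. -/
theorem lintegral_pow_le_sobolevEnergy_pow (k : ℕ) :
    ∃ K : ℝ≥0, ∀ u : Pos 2 → ℂ, ContDiff ℝ 1 u → HasCompactSupport u →
      ∫⁻ x, ‖u x‖ₑ ^ (2 * (k + 1)) ≤ K * sobolevEnergy u ^ (k + 1) := by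
  induction k with
  | zero => exact ⟨1, fun u _ _ => by simp [sobolevEnergy]⟩
  | succ k ih =>
    obtain ⟨K, hK⟩ := ih
    set C := lintegralPowLePowLIntegralFDerivConst (volume : Measure (Pos 2)) 2
    refine ⟨C * (k + 2) ^ 2 * K, fun u hu hc => ?_⟩
    -- The embedding of `W^{1,1}(ℝ²)` into `L²` is applied to `|u|^{k+2}`. Its gradient is at most
    -- `(k+2) |u|^{k+1} |∇u|`, and Cauchy-Schwarz leaves the power `2(k+1)` of the induction
    -- hypothesis.
    let γ : ℝ≥0 := k + 2
    have hγ : 1 < γ := by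
      have : (0 : ℝ≥0) ≤ k := zero_le
      calc (1 : ℝ≥0) < 2 := one_lt_two
        _ ≤ k + 2 := le_add_self
    have hγ' : (γ : ℝ) = (k + 2 : ℕ) := by simp [γ]
    have hγ1 : (γ : ℝ) - 1 = (k + 1 : ℕ) := by rw [hγ']; push_cast; ring
    have h := lintegral_pow_le_pow_lintegral_fderiv volume
      (hu.norm_rpow (p := γ) (by exact_mod_cast hγ))
      (hc.norm.rpow_const (r := γ) (by positivity)) (p := 2)
      (by simpa using Real.HolderConjugate.two_two)
    have h1 : ∀ x, ‖‖u x‖ ^ (γ : ℝ)‖ₑ ^ (2 : ℝ) = ‖u x‖ₑ ^ (2 * (k + 1 + 1)) := fun x => by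
      rw [hγ', Real.rpow_natCast, enorm_pow, enorm_norm, ENNReal.rpow_two, ← pow_mul]
      congr 1
      ring
    simp only [h1] at h
    refine h.trans ?_
    have h2 : ∫⁻ x, ‖fderiv ℝ (fun x => ‖u x‖ ^ (γ : ℝ)) x‖ₑ ≤
        γ * ∫⁻ x, ‖u x‖ₑ ^ (k + 1) * ‖fderiv ℝ u x‖ₑ := by
      rw [← lintegral_const_mul' _ _ ENNReal.coe_ne_top]
      refine lintegral_mono fun x => ?_
      have := enorm_fderiv_norm_rpow_le (hu.differentiable one_ne_zero) (x := x) hγ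
      rw [hγ1, ENNReal.rpow_natCast, mul_assoc] at this
      exact this
    have h3 : (∫⁻ x, ‖u x‖ₑ ^ (k + 1) * ‖fderiv ℝ u x‖ₑ) ^ 2 ≤
        K * sobolevEnergy u ^ (k + 1) * sobolevEnergy u := by
      refine (lintegral_mul_sq_le (f := fun x => ‖u x‖ₑ ^ (k + 1)) (g := fun x => ‖fderiv ℝ u x‖ₑ)
        ((continuous_enorm.comp hu.continuous).measurable.pow_const _).aemeasurable
        (continuous_enorm.comp (hu.continuous_fderiv one_ne_zero)).measurable.aemeasurable).trans ?_
      refine mul_le_mul' ?_ (lintegral_fderiv_le_sobolevEnergy u)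
      refine le_trans (le_of_eq (lintegral_congr fun x => ?_)) (hK u hu hc)
      rw [← pow_mul, mul_comm]
    calc C * (∫⁻ x, ‖fderiv ℝ (fun x => ‖u x‖ ^ (γ : ℝ)) x‖ₑ) ^ (2 : ℝ)
        ≤ C * (γ * ∫⁻ x, ‖u x‖ₑ ^ (k + 1) * ‖fderiv ℝ u x‖ₑ) ^ 2 := by
          rw [ENNReal.rpow_two]
          gcongr
      _ ≤ C * (γ ^ 2 * (K * sobolevEnergy u ^ (k + 1) * sobolevEnergy u)) := by
          rw [mul_pow]
          gcongr
      _ = _ := by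
          simp only [γ]
          push_cast
          ring

/-- The exponent `(k + 1) / k` is conjugate to `k + 1` and decreases to one; it is at most `p` once
`k > 1 / (p - 1)`. -/
theorem sobolevExponent_two {p : ℝ} (hp : 1 < p) :
    ∃ q, 1 ≤ q ∧ q ≤ p ∧ SobolevExponent 2 q := by
  obtain ⟨k, hk⟩ := exists_nat_gt (1 / (p - 1))
  have hp1 : 0 < p - 1 := by linarith
  have hk0 : (0 : ℝ) < k := lt_trans (by positivity) hk
  have hq : (((k : ℝ) + 1) / k).HolderConjugate (k + 1 : ℕ) := by
    rw [Real.holderConjugate_iff]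
    refine ⟨by rw [lt_div_iff₀ hk0]; linarith, ?_⟩
    push_cast
    field_simp
  refine ⟨(k + 1) / k, hq.lt.le, ?_, ?_⟩
  · rw [div_lt_iff₀ hp1] at hk
    rw [div_le_iff₀ hk0]
    linarith
  · obtain ⟨K, hK⟩ := lintegral_pow_le_sobolevEnergy_pow k
    refine sobolevExponent_of_holderConjugate hq (K := K ^ (1 / ((k + 1 : ℕ) : ℝ))) fun u hu hc => ?_
    have h1 : ∀ x, (‖u x‖ₑ ^ 2) ^ ((k + 1 : ℕ) : ℝ) = ‖u x‖ₑ ^ (2 * (k + 1)) := fun x => by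
      rw [ENNReal.rpow_natCast, ← pow_mul]
    simp only [h1]
    refine (ENNReal.rpow_le_rpow (hK u hu hc) (by positivity)).trans (le_of_eq ?_)
    rw [ENNReal.mul_rpow_of_nonneg _ _ (by positivity), ← ENNReal.rpow_natCast, ← ENNReal.rpow_mul,
      ← ENNReal.coe_rpow_of_nonneg _ (by positivity)]
    congr 1
    rw [mul_one_div_cancel (by positivity), ENNReal.rpow_one]

/-- In one dimension `|u|²` is bounded by the integral of its derivative, hence by that of `2 |u|
|u'| ≤ |u|² + |u'|²`. -/
theorem sobolevExponent_one : SobolevExponent 1 1 := by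
  refine ⟨1, fun u hu hc f hf => ?_⟩
  let e : ℝ → Pos 1 := fun t => WithLp.toLp 2 fun _ => t
  have he : MeasurePreserving e := (PiLp.volume_preserving_toLp (Fin 1)).comp
    (volume_preserving_funUnique (Fin 1) ℝ).symm
  let L : ℝ →L[ℝ] Pos 1 :=
    LinearMap.toContinuousLinearMap ⟨⟨e, fun _ _ => rfl⟩, fun _ _ => rfl⟩
  have hL : ∀ t, e t = L t := fun _ => rfl
  have hLn : ‖L‖ ≤ 1 := L.opNorm_le_bound zero_le_one fun t => by
    simp [← hL, e, EuclideanSpace.norm_eq, Real.sqrt_sq_eq_abs]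
  let v : Pos 1 → ℝ := fun x => ‖u x‖ ^ ((2 : ℝ≥0) : ℝ)
  have hv : ContDiff ℝ 1 v := hu.norm_rpow (by norm_num)
  have hvc : HasCompactSupport v := hc.norm.rpow_const (by norm_num)
  have hemb : Topology.IsClosedEmbedding e := by
    refine (LinearMap.isClosedEmbedding_of_injective (f := (L : ℝ →ₗ[ℝ] Pos 1)) ?_)
    refine LinearMap.ker_eq_bot.2 fun s t hst => ?_
    have := congrArg (fun x : Pos 1 => x 0) hst
    simpa [← hL, e] using this
  have hsup : ∀ x, ‖u x‖ₑ ^ 2 ≤ sobolevEnergy u := by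
    intro x
    have hx : x = e (x 0) := by ext i; fin_cases i; rfl
    have h1 := HasCompactSupport.enorm_le_lintegral_Ici_deriv (f := v ∘ e)
      (hv.comp L.contDiff) (hvc.comp_isClosedEmbedding hemb) (x 0)
    have h2 : ‖(v ∘ e) (x 0)‖ₑ = ‖u x‖ₑ ^ 2 := by
      rw [Function.comp_apply, ← hx]
      simp [v, enorm_pow]
    rw [h2] at h1
    refine h1.trans ((setLIntegral_le_lintegral _ _).trans ?_)
    have h3 : ∀ t, ‖deriv (v ∘ e) t‖ₑ ≤ ‖fderiv ℝ v (e t)‖ₑ := fun t => by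
      rw [← fderiv_apply_one_eq_deriv, show v ∘ e = v ∘ L from rfl, fderiv_comp _
        (hv.differentiable one_ne_zero _) L.differentiableAt, L.fderiv]
      rw [enorm_le_iff_norm_le]
      calc _ ≤ ‖fderiv ℝ v (L t)‖ * ‖L 1‖ := by
            simpa using (fderiv ℝ v (L t)).le_opNorm (L 1)
        _ ≤ ‖fderiv ℝ v (L t)‖ * 1 := by
            gcongr
            simpa using L.le_of_opNorm_le hLn 1
        _ = _ := by rw [mul_one]; rfl
    have h4 : ∀ x, ‖fderiv ℝ v x‖ₑ ≤ ‖u x‖ₑ ^ 2 + ‖fderiv ℝ u x‖ₑ ^ 2 := fun x => by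
      have := enorm_fderiv_norm_rpow_le (hu.differentiable one_ne_zero) (x := x) (p := 2)
        one_lt_two
      refine this.trans ?_
      have h5 : ((2 : ℝ≥0) : ℝ) - 1 = 1 := by norm_num
      rw [h5, ENNReal.rpow_one]
      exact two_mul_mul_le_sq_add_sq _ _
    calc ∫⁻ t, ‖deriv (v ∘ e) t‖ₑ ≤ ∫⁻ t, ‖fderiv ℝ v (e t)‖ₑ := lintegral_mono h3
      _ = ∫⁻ x, ‖fderiv ℝ v x‖ₑ := he.lintegral_comp
          (continuous_enorm.comp (hv.continuous_fderiv one_ne_zero)).measurable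
      _ ≤ ∫⁻ x, (‖u x‖ₑ ^ 2 + ‖fderiv ℝ u x‖ₑ ^ 2) := lintegral_mono h4
      _ = sobolevEnergy u := lintegral_add_left' (aemeasurable_enorm_sq hu.continuous) _
  calc ∫⁻ x, f x * ‖u x‖ₑ ^ 2 ≤ ∫⁻ x, f x * sobolevEnergy u := by
        gcongr with x
        exact hsup x
    _ = (∫⁻ x, f x) * sobolevEnergy u := lintegral_mul_const'' _ hf
    _ = _ := by simp

end

section

/-! ### Infinitesimal form bounds -/


/-- Having `q ≤ p` is enough, because the large values of an `L^p` function are in `L^q`; in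
dimension two only a discrete set of `q` is available. -/
theorem exists_sobolevExponent {d : ℕ} (hd : 1 ≤ d) {p : ℝ≥0∞} (h1 : d = 1 → p = 1)
    (h2 : d = 2 → 1 < p) (h3 : 3 ≤ d → p = (d : ℝ≥0∞) / 2) (hp : p ≠ ⊤) :
    ∃ q, 1 ≤ q ∧ q ≤ p.toReal ∧ SobolevExponent d q := by
  obtain rfl | rfl | hd3 : d = 1 ∨ d = 2 ∨ 3 ≤ d := by omega
  · exact ⟨1, le_rfl, by simp [h1 rfl], sobolevExponent_one⟩
  · refine sobolevExponent_two ?_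
    rw [← ENNReal.toReal_one]
    exact (ENNReal.toReal_lt_toReal ENNReal.one_ne_top hp).2 (h2 rfl)
  · refine ⟨d / 2, ?_, ?_, sobolevExponent_of_three_le hd3⟩
    · have : (3 : ℝ) ≤ d := by exact_mod_cast hd3
      linarith
    · simp [h3 hd3]

/-- The part of the values exceeding `N`. -/
def excess (N : ℕ) (t : ℝ≥0∞) : ℝ≥0∞ := if (N : ℝ≥0∞) + 1 < t then t else 0

theorem measurable_excess (N : ℕ) : Measurable (excess N) :=
  Measurable.ite measurableSet_Ioi measurable_id measurable_const

theorem le_add_excess (N : ℕ) (t : ℝ≥0∞) : t ≤ N + 1 + excess N t := by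
  unfold excess
  split_ifs with h
  · exact le_add_self
  · simpa using h

/-- Dominated convergence with majorant `|g|^p`: at each point the excess is eventually zero. This
smallness is the source of the arbitrarily small relative form bound. -/
theorem exists_lintegral_excess_le {α : Type*} [MeasurableSpace α] {μ : Measure α} {g : α → ℝ}
    {p : ℝ≥0∞} (hp : p ≠ ⊤) (hg : MemLp g p μ) {q : ℝ} (hq1 : 1 ≤ q) (hqp : q ≤ p.toReal)
    {δ : ℝ≥0∞} (hδ : δ ≠ 0) : ∃ N, ∫⁻ x, excess N ‖g x‖ₑ ^ q ∂μ < δ := by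
  have hq0 : 0 < q := by linarith
  have hp0 : p ≠ 0 := by
    rintro rfl
    simp at hqp
    linarith
  have h : Tendsto (fun N => ∫⁻ x, excess N ‖g x‖ₑ ^ q ∂μ) atTop (𝓝 (∫⁻ _, 0 ∂μ)) := by
    refine tendsto_lintegral_of_dominated_convergence' (fun x => ‖g x‖ₑ ^ p.toReal)
      (fun N => ((measurable_excess N).comp_aemeasurable hg.1.enorm).pow_const _)
      (fun N => Eventually.of_forall fun x => ?_)
      ((lintegral_rpow_enorm_lt_top_of_eLpNorm_lt_top hp0 hp hg.2).ne)
      (Eventually.of_forall fun x => ?_)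
    · simp only [excess]
      split_ifs with hx
      -- The values that are kept exceed `N + 1 ≥ 1`, so raising the exponent from `q` to `p`
      -- increases them.
      · refine ENNReal.rpow_le_rpow_of_exponent_le (le_trans ?_ hx.le) hqp
        exact le_add_self
      · simp [ENNReal.zero_rpow_of_pos hq0]
    · obtain ⟨N, hN⟩ := ENNReal.exists_nat_gt (enorm_ne_top (x := g x))
      refine tendsto_const_nhds.congr' ?_
      filter_upwards [eventually_ge_atTop N] with M hM
      have h2 : ¬ ((M : ℝ≥0∞) + 1 < ‖g x‖ₑ) := by
        refine not_lt.2 (hN.le.trans ?_)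
        calc (N : ℝ≥0∞) ≤ M := by exact_mod_cast hM
          _ ≤ M + 1 := le_self_add
      simp [excess, h2, ENNReal.zero_rpow_of_pos hq0]
  rw [lintegral_zero] at h
  exact (h.eventually (gt_mem_nhds (pos_iff_ne_zero.2 hδ))).exists

/-- Form boundedness for compactly supported functions. -/
theorem exists_form_bound_of_hasCompactSupport {d : ℕ} (hd : 1 ≤ d) {f : Pos d → ℝ}
    (hf : MemLpAddLinfty f) {ε : ℝ≥0} (hε : ε ≠ 0) :
    ∃ C : ℝ≥0, ∀ u : Pos d → ℂ, ContDiff ℝ 1 u → HasCompactSupport u →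
      ∫⁻ x, ‖f x‖ₑ * ‖u x‖ₑ ^ 2 ≤ ε * (∫⁻ x, ‖fderiv ℝ u x‖ₑ ^ 2) + C * ∫⁻ x, ‖u x‖ₑ ^ 2 := by
  obtain ⟨p, h1, h2, h3, g, h, hg, hh, hfgh⟩ := hf
  have hbdd : ∀ h : Pos d → ℝ, MemLp h ⊤ volume → ∀ u : Pos d → ℂ,
      ∫⁻ x, ‖h x‖ₑ * ‖u x‖ₑ ^ 2 ≤ ((eLpNorm h ⊤ volume).toNNReal : ℝ≥0∞) * ∫⁻ x, ‖u x‖ₑ ^ 2 := by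
    intro h hh u
    rw [ENNReal.coe_toNNReal hh.2.ne, ← lintegral_const_mul' _ _ hh.2.ne]
    refine lintegral_mono_ae ?_
    filter_upwards [ae_le_eLpNormEssSup (f := h) (μ := volume)] with x hx
    gcongr
    simpa using hx
  have hle : ∀ u : Pos d → ℂ, Continuous u → ∫⁻ x, ‖f x‖ₑ * ‖u x‖ₑ ^ 2 ≤
      (∫⁻ x, ‖g x‖ₑ * ‖u x‖ₑ ^ 2) + ∫⁻ x, ‖h x‖ₑ * ‖u x‖ₑ ^ 2 := fun u hu => by
    have hm : AEMeasurable (fun x => ‖g x‖ₑ * ‖u x‖ₑ ^ 2) :=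
      hg.1.enorm.mul (aemeasurable_enorm_sq hu)
    rw [← lintegral_add_left' hm]
    refine lintegral_mono_ae ?_
    filter_upwards [hfgh] with x hx
    rw [hx, ← add_mul]
    gcongr
    exact enorm_add_le _ _
  -- This can happen only for `d = 2`, where `p` is merely required to exceed one.
  by_cases hp : p = ⊤
  · subst hp
    refine ⟨(eLpNorm g ⊤ volume).toNNReal + (eLpNorm h ⊤ volume).toNNReal, fun u hu _ => ?_⟩
    refine (hle u hu.continuous).trans ((add_le_add (hbdd g hg u) (hbdd h hh u)).trans ?_)
    rw [← add_mul, ENNReal.coe_add]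
    exact le_add_self
  obtain ⟨q, hq1, hqp, K, hK⟩ := exists_sobolevExponent hd h1 h2 h3 hp
  have hq0 : 0 < q := by linarith
  let δ : ℝ≥0 := ε / (K + 1)
  have hδ : δ ≠ 0 := by positivity
  have hKδ : (K : ℝ≥0∞) * δ ≤ ε := by
    rw [← ENNReal.coe_mul, ENNReal.coe_le_coe]
    calc K * δ ≤ (K + 1) * δ := by gcongr; exact le_self_add
      _ = ε := mul_div_cancel₀ _ (by positivity)
  obtain ⟨N, hN⟩ := exists_lintegral_excess_le hp hg hq1 hqp
    (δ := ((δ ^ q : ℝ≥0) : ℝ≥0∞)) (by simp [hδ])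
  have hN' : (∫⁻ x, excess N ‖g x‖ₑ ^ q) ^ (1 / q) ≤ δ := by
    refine (ENNReal.rpow_le_rpow hN.le (by positivity)).trans (le_of_eq ?_)
    rw [ENNReal.coe_rpow_of_nonneg _ hq0.le, ← ENNReal.rpow_mul, mul_one_div_cancel hq0.ne',
      ENNReal.rpow_one]
  -- The three terms come from the `L²` part of the Sobolev energy, the truncated part of `g`, and
  -- the bounded part `h`.
  refine ⟨ε + (N + 1) + (eLpNorm h ⊤ volume).toNNReal, fun u hu hc => ?_⟩
  have hexc : AEMeasurable fun x => excess N ‖g x‖ₑ :=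
    (measurable_excess N).comp_aemeasurable hg.1.enorm
  have hgu : ∫⁻ x, ‖g x‖ₑ * ‖u x‖ₑ ^ 2 ≤
      (N + 1) * (∫⁻ x, ‖u x‖ₑ ^ 2) + ε * sobolevEnergy u := by
    calc ∫⁻ x, ‖g x‖ₑ * ‖u x‖ₑ ^ 2
        ≤ ∫⁻ x, ((N + 1) * ‖u x‖ₑ ^ 2 + excess N ‖g x‖ₑ * ‖u x‖ₑ ^ 2) := by
          refine lintegral_mono fun x => ?_
          rw [← add_mul]
          gcongr
          exact le_add_excess _ _
      _ = (N + 1) * (∫⁻ x, ‖u x‖ₑ ^ 2) + ∫⁻ x, excess N ‖g x‖ₑ * ‖u x‖ₑ ^ 2 := by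
          rw [lintegral_add_left' ((aemeasurable_enorm_sq hu.continuous).const_mul _),
            lintegral_const_mul' _ _ (by finiteness)]
      _ ≤ _ := by
          gcongr
          refine (hK u hu hc _ hexc).trans ?_
          gcongr
          exact (mul_le_mul_right hN' _).trans hKδ
  refine (hle u hu.continuous).trans ((add_le_add hgu (hbdd h hh u)).trans (le_of_eq ?_))
  rw [sobolevEnergy]
  push_cast
  ring

theorem add_enorm_sq_le_two_mul (a b : ℝ≥0∞) : (a + b) ^ 2 ≤ 2 * a ^ 2 + 2 * b ^ 2 := by
  calc (a + b) ^ 2 = a ^ 2 + b ^ 2 + 2 * a * b := by ring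
    _ ≤ a ^ 2 + b ^ 2 + (a ^ 2 + b ^ 2) := by gcongr; exact two_mul_mul_le_sq_add_sq a b
    _ = _ := by ring

theorem aemeasurable_of_memLpAddLinfty {d : ℕ} {f : Pos d → ℝ} (hf : MemLpAddLinfty f) :
    AEMeasurable f := by
  obtain ⟨p, -, -, -, g, h, hg, hh, hfgh⟩ := hf
  exact (hg.1.add hh.1).aemeasurable.congr hfgh.symm

/-- Form boundedness on the one-particle space. -/
theorem exists_form_bound {d : ℕ} (hd : 1 ≤ d) {f : Pos d → ℝ}
    (hf : MemLpAddLinfty f) {ε : ℝ≥0} (hε : ε ≠ 0) :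
    ∃ C : ℝ≥0, ∀ u : Pos d → ℂ, ContDiff ℝ 1 u →
      ∫⁻ x, ‖f x‖ₑ * ‖u x‖ₑ ^ 2 ≤ ε * (∫⁻ x, ‖fderiv ℝ u x‖ₑ ^ 2) + C * ∫⁻ x, ‖u x‖ₑ ^ 2 := by
  -- The product rule for `χ u` and `(a + b)² ≤ 2a² + 2b²` double the gradient term, hence `ε / 2`.
  obtain ⟨C, hC⟩ := exists_form_bound_of_hasCompactSupport hd hf (ε := ε / 2) (by positivity)
  let χ : ContDiffBump (0 : Pos d) := ⟨1, 2, one_pos, one_lt_two⟩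
  have hχ : ContDiff ℝ 1 χ := χ.contDiff
  obtain ⟨c, hc⟩ := (χ.hasCompactSupport.fderiv ℝ).exists_bound_of_continuous
    (hχ.continuous_fderiv one_ne_zero)
  have hc0 : 0 ≤ c := (norm_nonneg _).trans (hc 0)
  refine ⟨ε * c.toNNReal ^ 2 + C, fun u hu => ?_⟩
  -- The dilated cutoffs `χ(a_N x)` tend to one pointwise; since `a_N ≤ 1`, their gradients share
  -- the bound `c`. Fatou then removes the cutoff.
  let a : ℕ → ℝ := fun N => 1 / ((N : ℝ) + 1)
  have ha0 : ∀ N, 0 < a N := fun N => Nat.one_div_pos_of_nat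
  have ha1 : ∀ N, a N ≤ 1 := fun N => by
    simp only [a]
    rw [div_le_one (by positivity)]
    linarith [(Nat.cast_nonneg N : (0 : ℝ) ≤ N)]
  let χN : ℕ → Pos d → ℝ := fun N x => χ (a N • x)
  have hχN : ∀ N, ContDiff ℝ 1 (χN N) := fun N => hχ.comp (contDiff_const_smul _)
  have hχN1 : ∀ N x, ‖χN N x‖ₑ ≤ 1 := fun N x => by
    rw [← ofReal_norm, ENNReal.ofReal_le_one, Real.norm_of_nonneg χ.nonneg]
    exact χ.le_one
  have hχNd : ∀ N x, ‖fderiv ℝ (χN N) x‖ₑ ≤ c.toNNReal := fun N x => by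
    have h1 : fderiv ℝ (χN N) x = a N • fderiv ℝ χ (a N • x) := fderiv_comp_smul (f := χ) _
    rw [h1, ← ofReal_norm]
    refine ENNReal.ofReal_le_ofReal ?_
    rw [norm_smul, Real.norm_of_nonneg (ha0 N).le]
    calc a N * ‖fderiv ℝ χ (a N • x)‖ ≤ 1 * c := by
          gcongr
          exacts [ha1 N, hc _]
      _ = c := one_mul c
  have hcs : ∀ N, HasCompactSupport (χN N • u) := fun N => by
    refine HasCompactSupport.smul_right ?_
    exact χ.hasCompactSupport.comp_homeomorph (Homeomorph.smulOfNeZero (a N) (ha0 N).ne')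
  have hbound : ∀ N, ∫⁻ x, ‖f x‖ₑ * ‖χN N x • u x‖ₑ ^ 2 ≤
      ε * (∫⁻ x, ‖fderiv ℝ u x‖ₑ ^ 2) +
        (ε * c.toNNReal ^ 2 + C : ℝ≥0) * ∫⁻ x, ‖u x‖ₑ ^ 2 := by
    intro N
    have h1 : ∫⁻ x, ‖fderiv ℝ (χN N • u) x‖ₑ ^ 2 ≤ 2 * (∫⁻ x, ‖fderiv ℝ u x‖ₑ ^ 2) +
        2 * c.toNNReal ^ 2 * ∫⁻ x, ‖u x‖ₑ ^ 2 := by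
      rw [← lintegral_const_mul' _ _ (by finiteness), ← lintegral_const_mul' _ _ (by finiteness),
        ← lintegral_add_left' ((aemeasurable_enorm_sq
          (hu.continuous_fderiv one_ne_zero)).const_mul _)]
      refine lintegral_mono fun x => ?_
      rw [fderiv_smul ((hχN N).differentiable one_ne_zero _) (hu.differentiable one_ne_zero _)]
      have h3 : ‖χN N x • fderiv ℝ u x + (fderiv ℝ (χN N) x).smulRight (u x)‖ₑ ≤
          ‖χN N x • fderiv ℝ u x‖ₑ + ‖(fderiv ℝ (χN N) x).smulRight (u x)‖ₑ := by
        simp only [← ofReal_norm]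
        rw [← ENNReal.ofReal_add (norm_nonneg _) (norm_nonneg _)]
        exact ENNReal.ofReal_le_ofReal (norm_add_le _ _)
      refine (pow_le_pow_left' h3 2).trans ((add_enorm_sq_le_two_mul _ _).trans ?_)
      rw [mul_assoc, ← mul_pow]
      gcongr
      · rw [enorm_smul]
        exact (mul_le_mul_left (hχN1 N x) _).trans (one_mul _).le
      · refine le_trans (le_of_eq ?_) (mul_le_mul_left (hχNd N x) _)
        simp [← ofReal_norm, ENNReal.ofReal_mul]
    have h2 : ∫⁻ x, ‖(χN N • u) x‖ₑ ^ 2 ≤ ∫⁻ x, ‖u x‖ₑ ^ 2 := by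
      gcongr with x
      rw [Pi.smul_apply', enorm_smul]
      exact (mul_le_mul_left (hχN1 N x) _).trans (one_mul _).le
    refine (hC _ ((hχN N).smul hu) (hcs N)).trans ((add_le_add (mul_le_mul_right h1 _)
      (mul_le_mul_right h2 _)).trans (le_of_eq ?_))
    have h3 : ((ε / 2 : ℝ≥0) : ℝ≥0∞) * 2 = ε := by
      rw [← ENNReal.coe_ofNat, ← ENNReal.coe_mul, div_mul_cancel₀ _ two_ne_zero]
    rw [mul_add, ← mul_assoc, h3, ← mul_assoc, ← mul_assoc, h3]
    push_cast
    ring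
  have hlim : ∀ x, Tendsto (fun N => ‖f x‖ₑ * ‖χN N x • u x‖ₑ ^ 2) atTop
      (𝓝 (‖f x‖ₑ * ‖u x‖ₑ ^ 2)) := fun x => by
    refine tendsto_const_nhds.congr' ?_
    have h1 : Tendsto (fun N => a N • x) atTop (𝓝 0) := by
      have := (tendsto_one_div_add_atTop_nhds_zero_nat (𝕜 := ℝ)).smul_const x
      rwa [zero_smul] at this
    filter_upwards [h1.eventually (Metric.closedBall_mem_nhds 0 one_pos)] with N hN
    simp [χN, χ.one_of_mem_closedBall hN]
  calc ∫⁻ x, ‖f x‖ₑ * ‖u x‖ₑ ^ 2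
      = ∫⁻ x, liminf (fun N => ‖f x‖ₑ * ‖χN N x • u x‖ₑ ^ 2) atTop := by
        simp only [(hlim _).liminf_eq]
    _ ≤ liminf (fun N => ∫⁻ x, ‖f x‖ₑ * ‖χN N x • u x‖ₑ ^ 2) atTop :=
        lintegral_liminf_le' fun N => (aemeasurable_of_memLpAddLinfty hf).enorm.mul
          (aemeasurable_enorm_sq ((hχN N).smul hu).continuous)
    _ ≤ _ := liminf_le_of_le (by isBoundedDefault) fun b hb => by
        obtain ⟨N, hN⟩ := hb.exists
        exact hN.trans (hbound N)

end

/-! ### Form bounds on the configuration space, particle by particle -/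

section

theorem enorm_sq_le_mul_sum {d : ℕ} (T : Pos d →L[ℝ] ℂ) :
    ‖T‖ₑ ^ 2 ≤ d * ∑ k, ‖T (EuclideanSpace.single k 1)‖ₑ ^ 2 := by
  have h1 : ‖T‖ ≤ ∑ k, ‖T (EuclideanSpace.single k 1)‖ := by
    refine T.opNorm_le_bound (Finset.sum_nonneg fun _ _ => norm_nonneg _) fun v => ?_
    have hv : v = ∑ k, v k • EuclideanSpace.single k (1 : ℝ) := by
      simpa using ((EuclideanSpace.basisFun (Fin d) ℝ).sum_repr v).symm
    calc ‖T v‖ = ‖∑ k, v k • T (EuclideanSpace.single k 1)‖ := by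
          conv_lhs => rw [hv]
          simp only [map_sum, map_smul]
      _ ≤ ∑ k, ‖v‖ * ‖T (EuclideanSpace.single k 1)‖ := by
          refine norm_sum_le_of_le _ fun k _ => ?_
          rw [norm_smul]
          gcongr
          exact PiLp.norm_apply_le v k
      _ = _ := by rw [← Finset.mul_sum, mul_comm]
  have h2 : ‖T‖ ^ 2 ≤ d * ∑ k, ‖T (EuclideanSpace.single k 1)‖ ^ 2 := by
    refine (pow_le_pow_left₀ (norm_nonneg _) h1 2).trans ?_
    simpa using sq_sum_le_card_mul_sum_sq (s := Finset.univ)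
      (f := fun k : Fin d => ‖T (EuclideanSpace.single k 1)‖)
  simp only [← ofReal_norm, ← ENNReal.ofReal_pow (norm_nonneg _)]
  rw [← ENNReal.ofReal_natCast, ← ENNReal.ofReal_sum_of_nonneg fun _ _ => by positivity,
    ← ENNReal.ofReal_mul (by positivity)]
  exact ENNReal.ofReal_le_ofReal h2

theorem lintegral_insertNth_swap {d n : ℕ} (i : Fin (n + 1)) {f : Conf d (n + 1) → ℝ≥0∞}
    (hf : AEMeasurable f) :
    ∫⁻ y : Conf d n, ∫⁻ x : Pos d, f (i.insertNth x y) = ∫⁻ z, f z := by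
  rw [← lintegral_insertNth i hf]
  have h := (volume_preserving_piFinSuccAbove (fun _ : Fin (n + 1) => Pos d) i).symm
  exact (lintegral_lintegral_swap (f := fun (x : Pos d) (y : Conf d n) => f (i.insertNth x y))
    (hf.comp_quasiMeasurePreserving h.quasiMeasurePreserving)).symm

theorem insertNth_eq_add_single {d n : ℕ} (i : Fin (n + 1)) (x : Pos d) (y : Conf d n) :
    (i.insertNth x y : Conf d (n + 1)) = i.insertNth 0 y + Pi.single i x := by
  ext j
  refine Fin.succAboveCases i ?_ (fun j => ?_) j
  · simp
  · simp

/-- Form boundedness on the configuration space, for differentiable functions. -/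
theorem exists_form_bound_of_contDiff {d : ℕ} (hd : 1 ≤ d) {f : Pos d → ℝ}
    (hf : MemLpAddLinfty f) {ε : ℝ≥0} (hε : ε ≠ 0) :
    ∃ C : ℝ≥0, ∀ (n : ℕ) (i : Fin n) (φ : Conf d n → ℂ), ContDiff ℝ 1 φ →
      ∫⁻ z, ‖f (z i)‖ₑ * ‖φ z‖ₑ ^ 2 ≤
        ε * (∑ k, ∫⁻ z, ‖fderiv ℝ φ z (unitVector i k)‖ₑ ^ 2) + C * ∫⁻ z, ‖φ z‖ₑ ^ 2 := by
  have hd0 : (d : ℝ≥0) ≠ 0 := by exact_mod_cast (by omega : d ≠ 0)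
  -- Replacing the operator norm of the derivative by its coordinates costs a factor `d`.
  obtain ⟨C, hC⟩ := exists_form_bound hd hf (ε := ε / d) (div_ne_zero hε hd0)
  refine ⟨C, fun n i φ hφ => ?_⟩
  obtain _ | n := n
  · exact i.elim0
  have hεd : ((ε / d : ℝ≥0) : ℝ≥0∞) * d = ε := by
    rw [← ENNReal.coe_natCast, ← ENNReal.coe_mul, div_mul_cancel₀ _ hd0]
  have hm0 : AEMeasurable (fun z => ‖φ z‖ₑ ^ 2) (volume : Measure (Conf d (n + 1))) :=
    aemeasurable_enorm_sq hφ.continuous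
  have hm1 : AEMeasurable (fun z : Conf d (n + 1) => ‖f (z i)‖ₑ * ‖φ z‖ₑ ^ 2) :=
    (aemeasurable_comp_eval i (aemeasurable_of_memLpAddLinfty hf).enorm).mul hm0
  have hm2 : ∀ k, Measurable fun z : Conf d (n + 1) => ‖fderiv ℝ φ z (unitVector i k)‖ₑ ^ 2 :=
    fun k => (continuous_enorm.comp
      ((hφ.continuous_fderiv one_ne_zero).clm_apply continuous_const)).measurable.pow_const 2
  let L : Pos d →L[ℝ] Conf d (n + 1) := ContinuousLinearMap.single ℝ (fun _ => Pos d) i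
  have hpt : ∀ (x : Pos d) (y : Conf d n), (i.insertNth x y : Conf d (n + 1)) =
      i.insertNth 0 y + L x := insertNth_eq_add_single i
  have hslice : ∀ y : Conf d n, (fun x : Pos d => φ (i.insertNth x y)) =
      fun x => φ (i.insertNth 0 y + L x) := fun y => by
    funext x
    rw [hpt]
  have hLd : ∀ y : Conf d n, ContDiff ℝ 1 fun x => (i.insertNth 0 y : Conf d (n + 1)) + L x :=
    fun y => contDiff_const.add L.contDiff
  have hder : ∀ (y : Conf d n) (x : Pos d) (k : Fin d),
      fderiv ℝ (fun x : Pos d => φ (i.insertNth x y)) x (EuclideanSpace.single k 1) =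
        fderiv ℝ φ (i.insertNth x y) (unitVector i k) := fun y x k => by
    have h1 : HasFDerivAt (fun x => (i.insertNth 0 y : Conf d (n + 1)) + L x) L x :=
      L.hasFDerivAt.const_add _
    have h2 : HasFDerivAt φ (fderiv ℝ φ (i.insertNth 0 y + L x)) (i.insertNth 0 y + L x) :=
      (hφ.differentiable one_ne_zero _).hasFDerivAt
    rw [hslice, hpt x y]
    exact congrArg (fun T : Pos d →L[ℝ] ℂ => T (EuclideanSpace.single k 1)) (h2.comp x h1).fderiv
  -- The one-particle bound is applied with the other particles frozen and then integrated over
  -- them, so `C` depends neither on `n` nor on `i`.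
  calc ∫⁻ z, ‖f (z i)‖ₑ * ‖φ z‖ₑ ^ 2
      = ∫⁻ y : Conf d n, ∫⁻ x : Pos d, ‖f x‖ₑ * ‖φ (i.insertNth x y)‖ₑ ^ 2 := by
        rw [← lintegral_insertNth_swap i hm1]
        simp
    _ ≤ ∫⁻ y : Conf d n, ((ε * ∑ k, ∫⁻ x : Pos d,
          ‖fderiv ℝ φ (i.insertNth x y) (unitVector i k)‖ₑ ^ 2) +
          C * ∫⁻ x : Pos d, ‖φ (i.insertNth x y)‖ₑ ^ 2) := by
        refine lintegral_mono fun y => ?_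
        have hs : ContDiff ℝ 1 fun x : Pos d => φ (i.insertNth x y) := by
          rw [hslice]
          exact hφ.comp (hLd y)
        refine (hC _ hs).trans (add_le_add_left ?_ _)
        rw [← hεd, mul_assoc]
        refine mul_le_mul_right ?_ _
        have hm3 : ∀ k, Measurable fun x : Pos d =>
            ‖fderiv ℝ φ (i.insertNth x y) (unitVector i k)‖ₑ ^ 2 := fun k => by
          have h1 : Measurable fun x : Pos d => (i.insertNth x y : Conf d (n + 1)) := by
            rw [funext fun x => hpt x y]
            exact (hLd y).continuous.measurable
          exact (hm2 k).comp h1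
        rw [← lintegral_finsetSum _ fun k _ => hm3 k,
          ← lintegral_const_mul _ (Finset.measurable_fun_sum _ fun k _ => hm3 k)]
        refine lintegral_mono fun x => ?_
        refine (enorm_sq_le_mul_sum _).trans (le_of_eq ?_)
        simp only [hder]
    _ = _ := by
        have hm4 : ∀ {g : Conf d (n + 1) → ℝ≥0∞}, Measurable g →
            Measurable fun y : Conf d n => ∫⁻ x : Pos d, g (i.insertNth x y) := fun {g} hg =>
          (hg.comp (MeasurableEquiv.piFinSuccAbove
            (fun _ : Fin (n + 1) => Pos d) i).symm.measurable).lintegral_prod_left'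
        rw [lintegral_add_left ((Finset.measurable_fun_sum _ fun k _ => hm4 (hm2 k)).const_mul _),
          lintegral_const_mul' _ _ ENNReal.coe_ne_top, lintegral_const_mul' _ _ ENNReal.coe_ne_top,
          lintegral_finsetSum _ fun k _ => hm4 (hm2 k), lintegral_insertNth_swap i hm0]
        simp only [lintegral_insertNth_swap i (hm2 _).aemeasurable]

/-! ### Mollification -/

/-- A sequence of standard mollifiers. -/
def mollifier (d n N : ℕ) : ContDiffBump (0 : Conf d n) :=
  ⟨1 / (N + 1), 2 / (N + 1), by positivity, by gcongr; norm_num⟩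

instance isNegInvariant_volume_conf (d n : ℕ) : (volume : Measure (Conf d n)).IsNegInvariant := by
  have : (volume : Measure (Pos d)).IsNegInvariant := inferInstance
  infer_instance

/-- Regularization of `ψ` by convolution. -/
def mollify {d n : ℕ} (N : ℕ) (ψ : L2 d n) : Conf d n → ℂ :=
  convolution ((mollifier d n N).normed volume) ψ (ContinuousLinearMap.lsmul ℝ ℝ) volume

theorem locallyIntegrable_L2 {d n : ℕ} (ψ : L2 d n) : LocallyIntegrable ψ volume :=
  (Lp.memLp ψ).locallyIntegrable one_le_two

theorem ae_tendsto_mollify {d n : ℕ} (ψ : L2 d n) :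
    ∀ᵐ x, Tendsto (fun N => mollify N ψ x) atTop (𝓝 (ψ x)) := by
  -- Lebesgue differentiation needs a bounded ratio of outer to inner radius, which is exactly two
  -- for these mollifiers.
  refine ContDiffBump.ae_convolution_tendsto_right_of_locallyIntegrable (K := 2) ?_
    (Eventually.of_forall fun N => le_of_eq ?_) (locallyIntegrable_L2 ψ)
  · have := (tendsto_one_div_add_atTop_nhds_zero_nat (𝕜 := ℝ)).const_mul 2
    simpa [mollifier, div_eq_mul_inv] using this
  · simp [mollifier, div_eq_mul_inv]

theorem contDiff_mollify {d n : ℕ} (N : ℕ) (ψ : L2 d n) : ContDiff ℝ 1 (mollify N ψ) :=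
  (mollifier d n N).hasCompactSupport_normed.contDiff_convolution_left _
    (mollifier d n N).contDiff_normed (locallyIntegrable_L2 ψ)

theorem mollify_apply {d n : ℕ} (N : ℕ) (ψ : L2 d n) (x : Conf d n) :
    mollify N ψ x = ∫ y, (((mollifier d n N).normed volume (x - y) : ℝ) : ℂ) * ψ y := by
  simp [mollify, convolution_eq_swap]

/-- The derivative falls on the mollifier, and `y ↦ η (x - y)` is an admissible test function. The
sign from the reflection cancels the one in the definition of the weak derivative. -/
theorem fderiv_mollify {d n : ℕ} (N : ℕ) {ψ : L2 d n} {G : Fin n → Fin d → L2 d n}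
    (hG : IsWeakGradient ψ G) (i : Fin n) (k : Fin d) (x : Conf d n) :
    fderiv ℝ (mollify N ψ) x (unitVector i k) = mollify N (G i k) x := by
  set η := (mollifier d n N).normed volume with hη
  have hηc : HasCompactSupport η := (mollifier d n N).hasCompactSupport_normed
  have hηd : ContDiff ℝ ∞ η := (mollifier d n N).contDiff_normed
  have hη1 : ContDiff ℝ 1 η := hηd.of_le (by simp)
  have h1 := (hηc.hasFDerivAt_convolution_left (ContinuousLinearMap.lsmul ℝ ℝ) hη1
    (locallyIntegrable_L2 ψ) x).fderiv
  have hexists : ConvolutionExistsAt (fderiv ℝ η) ψ x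
      ((ContinuousLinearMap.lsmul ℝ ℝ : ℝ →L[ℝ] ℂ →L[ℝ] ℂ).precompL (Conf d n)) volume :=
    (hηc.fderiv ℝ).convolutionExists_left _ (hη1.continuous_fderiv one_ne_zero)
      (locallyIntegrable_L2 ψ) x
  have h2 := hG i k (fun y => η (x - y)) (hηd.comp (contDiff_const.sub contDiff_id))
    (hηc.comp_homeomorph (Homeomorph.subLeft x))
  have h3 : ∀ y, fderiv ℝ (fun y => η (x - y)) y (unitVector i k) =
      -fderiv ℝ η (x - y) (unitVector i k) := fun y => by
    have h4 : HasFDerivAt (fun y => x - y) (-ContinuousLinearMap.id ℝ (Conf d n)) y :=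
      (hasFDerivAt_id y).const_sub x
    have h5 : HasFDerivAt η (fderiv ℝ η (x - y)) (x - y) :=
      (hη1.differentiable one_ne_zero _).hasFDerivAt
    rw [show (fun y => η (x - y)) = η ∘ fun y => x - y from rfl, (h5.comp y h4).fderiv]
    simp
  rw [mollify_apply, ← neg_inj, ← h2, mollify, h1, convolution_eq_swap,
    ContinuousLinearMap.integral_apply, ← integral_neg]
  · refine integral_congr_ae (Eventually.of_forall fun y => ?_)
    simp only [h3, ContinuousLinearMap.precompL_apply, ContinuousLinearMap.lsmul_apply]
    simp
  · exact hexists.integrable_swap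

theorem lintegral_mollify_le {d n : ℕ} (N : ℕ) (ψ : L2 d n) :
    ∫⁻ x, ‖mollify N ψ x‖ₑ ^ 2 ≤ ∫⁻ x, ‖ψ x‖ₑ ^ 2 := by
  set η := (mollifier d n N).normed volume with hη
  have hη0 : ∀ x, 0 ≤ η x := fun x => (mollifier d n N).nonneg_normed x
  have hηm : Measurable fun x => ENNReal.ofReal (η x) :=
    ENNReal.measurable_ofReal.comp ((mollifier d n N).continuous_normed).measurable
  have hψm : Measurable fun y => ‖ψ y‖ₑ ^ 2 := (Lp.stronglyMeasurable ψ).enorm.pow_const 2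
  have hη1 : ∫⁻ x, ENNReal.ofReal (η x) = 1 := by
    rw [← ofReal_integral_eq_lintegral_ofReal (mollifier d n N).integrable_normed
      (Eventually.of_forall hη0), (mollifier d n N).integral_normed, ENNReal.ofReal_one]
  have h1 : ∀ x, ‖mollify N ψ x‖ₑ ^ 2 ≤ ∫⁻ y, ENNReal.ofReal (η (x - y)) * ‖ψ y‖ₑ ^ 2 := by
    intro x
    have hηx : Measurable fun y => ENNReal.ofReal (η (x - y)) :=
      hηm.comp (measurable_const.sub measurable_id)
    -- Splitting `η` into two square roots lets Cauchy-Schwarz use that `η` has integral one.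
    have h2 : ‖mollify N ψ x‖ₑ ≤ ∫⁻ y, ENNReal.ofReal (η (x - y)) ^ (1 / 2 : ℝ) *
        (ENNReal.ofReal (η (x - y)) ^ (1 / 2 : ℝ) * ‖ψ y‖ₑ) := by
      rw [mollify_apply]
      refine (enorm_integral_le_lintegral_enorm _).trans (lintegral_mono fun y => ?_)
      rw [← mul_assoc, ← ENNReal.rpow_add_of_nonneg _ _ (by norm_num) (by norm_num)]
      norm_num
      rw [← ofReal_norm, Complex.norm_real, Real.norm_of_nonneg (hη0 _)]
    refine (pow_le_pow_left' h2 2).trans ((lintegral_mul_sq_le (hηx.pow_const _).aemeasurable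
      ((hηx.pow_const _).mul (Lp.stronglyMeasurable ψ).enorm).aemeasurable).trans (le_of_eq ?_))
    simp only [Pi.mul_apply]
    have h3 : ∀ a : ℝ≥0∞, (a ^ (1 / 2 : ℝ)) ^ 2 = a := fun a => by
      rw [← ENNReal.rpow_natCast, ← ENNReal.rpow_mul]
      simp
    simp only [mul_pow, h3]
    rw [lintegral_sub_left_eq_self (fun y => ENNReal.ofReal (η y)) x, hη1, one_mul]
  calc ∫⁻ x, ‖mollify N ψ x‖ₑ ^ 2
      ≤ ∫⁻ x, ∫⁻ y, ENNReal.ofReal (η (x - y)) * ‖ψ y‖ₑ ^ 2 := lintegral_mono h1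
    _ = ∫⁻ y, ∫⁻ x, ENNReal.ofReal (η (x - y)) * ‖ψ y‖ₑ ^ 2 := by
        refine lintegral_lintegral_swap (Measurable.aemeasurable ?_)
        exact (hηm.comp (measurable_fst.sub measurable_snd)).mul (hψm.comp measurable_snd)
    _ = ∫⁻ y, ‖ψ y‖ₑ ^ 2 := by
        refine lintegral_congr fun y => ?_
        rw [lintegral_mul_const _ (show Measurable fun x => ENNReal.ofReal (η (x - y)) from
          hηm.comp (measurable_id.sub measurable_const)),
          lintegral_sub_right_eq_self (fun x => ENNReal.ofReal (η x)) y, hη1, one_mul]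

/-- Form boundedness on the configuration space. -/
theorem exists_form_bound_of_isWeakGradient {d : ℕ} (hd : 1 ≤ d) {f : Pos d → ℝ}
    (hf : MemLpAddLinfty f) {ε : ℝ≥0} (hε : ε ≠ 0) :
    ∃ C : ℝ≥0, ∀ (n : ℕ) (i : Fin n) (ψ : L2 d n) (G : Fin n → Fin d → L2 d n),
      IsWeakGradient ψ G → ∫⁻ z, ‖f (z i)‖ₑ * ‖ψ z‖ₑ ^ 2 ≤
        ε * (∑ k, ∫⁻ z, ‖G i k z‖ₑ ^ 2) + C * ∫⁻ z, ‖ψ z‖ₑ ^ 2 := by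
  obtain ⟨C, hC⟩ := exists_form_bound_of_contDiff hd hf hε
  refine ⟨C, fun n i ψ G hG => ?_⟩
  have hbound : ∀ N, ∫⁻ z, ‖f (z i)‖ₑ * ‖mollify N ψ z‖ₑ ^ 2 ≤
      ε * (∑ k, ∫⁻ z, ‖G i k z‖ₑ ^ 2) + C * ∫⁻ z, ‖ψ z‖ₑ ^ 2 := fun N => by
    refine (hC n i _ (contDiff_mollify N ψ)).trans ?_
    simp only [fderiv_mollify N hG]
    exact add_le_add (mul_le_mul_right (Finset.sum_le_sum fun k _ => lintegral_mollify_le N _) _)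
      (mul_le_mul_right (lintegral_mollify_le N ψ) _)
  calc ∫⁻ z, ‖f (z i)‖ₑ * ‖ψ z‖ₑ ^ 2
      = ∫⁻ z, liminf (fun N => ‖f (z i)‖ₑ * ‖mollify N ψ z‖ₑ ^ 2) atTop := by
        refine lintegral_congr_ae ?_
        filter_upwards [ae_tendsto_mollify ψ] with z hz
        refine (Tendsto.liminf_eq ?_).symm
        exact ENNReal.Tendsto.const_mul (ENNReal.Tendsto.pow hz.enorm) (Or.inr enorm_ne_top)
    _ ≤ liminf (fun N => ∫⁻ z, ‖f (z i)‖ₑ * ‖mollify N ψ z‖ₑ ^ 2) atTop :=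
        lintegral_liminf_le' fun N => (aemeasurable_comp_eval i
          (aemeasurable_of_memLpAddLinfty hf).enorm).mul
            (aemeasurable_enorm_sq (contDiff_mollify N ψ).continuous)
    _ ≤ _ := liminf_le_of_le (by isBoundedDefault) fun b hb => by
        obtain ⟨N, hN⟩ := hb.exists
        exact hN.trans (hbound N)

end

section

/-! ### Weak convergence and lower semicontinuity -/

/-- Fatou's lemma for the counting measure. -/
theorem tsum_liminf_le {ι : Type*} (a : ℕ → ι → ℝ≥0∞) :
    ∑' i, liminf (fun m => a m i) atTop ≤ liminf (fun m => ∑' i, a m i) atTop := by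
  let _ : MeasurableSpace ι := ⊤
  have h := lintegral_liminf_le (μ := Measure.count) (f := a) (u := atTop)
    fun _ => measurable_from_top
  simpa [lintegral_count] using h

theorem sum_liminf_le {ι : Type*} [Fintype ι] (a : ℕ → ι → ℝ≥0∞) :
    ∑ i, liminf (fun m => a m i) atTop ≤ liminf (fun m => ∑ i, a m i) atTop := by
  simpa only [tsum_fintype] using tsum_liminf_le a

theorem liminf_add_liminf_le (a b : ℕ → ℝ≥0∞) :
    liminf a atTop + liminf b atTop ≤ liminf (fun m => a m + b m) atTop := by
  simpa using sum_liminf_le fun m (i : Fin 2) => ![a m, b m] i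

/-- For a bounded sequence, weak convergence need only be tested on vectors with dense span. -/
theorem tendsto_inner_of_bounded {H : Type*} [NormedAddCommGroup H] [InnerProductSpace ℂ H]
    [CompleteSpace H] {x : ℕ → H} {y : H} {C : ℝ} (hx : ∀ m, ‖x m‖ ≤ C) {T : Set H}
    (hT : (Submodule.span ℂ T)ᗮ = ⊥)
    (h : ∀ t ∈ T, Tendsto (fun m => ⟪t, x m⟫_ℂ) atTop (𝓝 ⟪t, y⟫_ℂ)) (t : H) :
    Tendsto (fun m => ⟪t, x m⟫_ℂ) atTop (𝓝 ⟪t, y⟫_ℂ) := by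
  have h1 : ∀ t ∈ Submodule.span ℂ T, Tendsto (fun m => ⟪t, x m⟫_ℂ) atTop (𝓝 ⟪t, y⟫_ℂ) := by
    intro t ht
    induction ht using Submodule.span_induction with
    | mem t ht => exact h t ht
    | zero => simp
    | add s t _ _ hs ht => simpa only [inner_add_left] using hs.add ht
    | smul c t _ ht => simpa only [inner_smul_left] using ht.const_mul _
  have hC : 0 ≤ C := (norm_nonneg _).trans (hx 0)
  have hd : t ∈ closure (Submodule.span ℂ T : Set H) := by
    have h2 := Submodule.topologicalClosure_eq_top_iff.2 hT
    rw [← Submodule.topologicalClosure_coe, h2]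
    trivial
  rw [Metric.tendsto_atTop]
  intro ε hε
  obtain ⟨s, hs, hst⟩ := Metric.mem_closure_iff.1 hd (ε / (2 * (C + ‖y‖ + 1))) (by positivity)
  obtain ⟨N, hN⟩ := Metric.tendsto_atTop.1 (h1 s hs) (ε / 2) (by positivity)
  refine ⟨N, fun m hm => ?_⟩
  have h2 := hN m hm
  rw [dist_eq_norm] at h2 hst ⊢
  have h3 : ⟪t, x m⟫_ℂ - ⟪t, y⟫_ℂ = ⟪t - s, x m⟫_ℂ - ⟪t - s, y⟫_ℂ + (⟪s, x m⟫_ℂ - ⟪s, y⟫_ℂ) := by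
    simp only [inner_sub_left]
    ring
  rw [lt_div_iff₀ (by positivity)] at hst
  calc ‖⟪t, x m⟫_ℂ - ⟪t, y⟫_ℂ‖
      ≤ ‖⟪t - s, x m⟫_ℂ‖ + ‖⟪t - s, y⟫_ℂ‖ + ‖⟪s, x m⟫_ℂ - ⟪s, y⟫_ℂ‖ := by
        rw [h3]
        exact (norm_add_le _ _).trans (add_le_add_left (norm_sub_le _ _) _)
    _ ≤ ‖t - s‖ * C + ‖t - s‖ * ‖y‖ + ‖⟪s, x m⟫_ℂ - ⟪s, y⟫_ℂ‖ := by
        gcongr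
        · exact (norm_inner_le_norm _ _).trans (by gcongr; exact hx m)
        · exact norm_inner_le_norm _ _
    _ < ε := by nlinarith [norm_nonneg (t - s)]

theorem memLp_testFunction {d n : ℕ} {φ : Conf d n → ℝ} (hφ : Continuous φ)
    (hc : HasCompactSupport φ) : MemLp (fun x => (φ x : ℂ)) 2 (volume : Measure (Conf d n)) :=
  (Complex.continuous_ofReal.comp hφ).memLp_of_hasCompactSupport
    (hc.comp_left Complex.ofReal_zero)

/-- A continuous function with compact support as an element of `L²`. -/
def testL2 {d n : ℕ} (φ : Conf d n → ℝ) (hφ : Continuous φ) (hc : HasCompactSupport φ) : L2 d n :=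
  (memLp_testFunction hφ hc).toLp

theorem inner_testL2 {d n : ℕ} (φ : Conf d n → ℝ) (hφ : Continuous φ) (hc : HasCompactSupport φ)
    (ψ : L2 d n) : ⟪testL2 φ hφ hc, ψ⟫_ℂ = ∫ x, (φ x : ℂ) * ψ x := by
  rw [L2.inner_def]
  refine integral_congr_ae ?_
  filter_upwards [(memLp_testFunction hφ hc).coeFn_toLp] with x hx
  rw [testL2, hx, RCLike.inner_apply, mul_comm]
  simp

theorem span_testL2_orthogonal (d n : ℕ) : (Submodule.span ℂ {t : L2 d n |
    ∃ (φ : Conf d n → ℝ) (hφ : ContDiff ℝ ∞ φ) (hc : HasCompactSupport φ),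
      t = testL2 φ hφ.continuous hc})ᗮ = ⊥ := by
  rw [Submodule.eq_bot_iff]
  intro g hg
  have h := ae_eq_zero_of_integral_contDiff_smul_eq_zero (locallyIntegrable_L2 g)
    fun φ hφ hc => by
      have := (Submodule.mem_orthogonal _ _).1 hg _ (Submodule.subset_span ⟨φ, hφ, hc, rfl⟩)
      rw [inner_testL2] at this
      simpa using this
  exact Lp.eq_zero_iff_ae_eq_zero.2 h

/-- If `ψ_m → ψ` in `L²` and the weak gradients are bounded, then they converge weakly. -/
theorem tendsto_inner_weakGradient {d n : ℕ} {ψ : ℕ → L2 d n} {ψs : L2 d n}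
    {G : ℕ → Fin n → Fin d → L2 d n} {Gs : Fin n → Fin d → L2 d n}
    (h : Tendsto ψ atTop (𝓝 ψs)) (hG : ∀ m, IsWeakGradient (ψ m) (G m))
    (hGs : IsWeakGradient ψs Gs) {C : ℝ} (i : Fin n) (k : Fin d) (hC : ∀ m, ‖G m i k‖ ≤ C)
    (t : L2 d n) : Tendsto (fun m => ⟪t, G m i k⟫_ℂ) atTop (𝓝 ⟪t, Gs i k⟫_ℂ) := by
  refine tendsto_inner_of_bounded hC (span_testL2_orthogonal d n) ?_ t
  rintro _ ⟨φ, hφ, hc, rfl⟩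
  have hφ1 : Continuous fun x => fderiv ℝ φ x (unitVector i k) :=
    (hφ.continuous_fderiv (by simp)).clm_apply continuous_const
  have hc1 : HasCompactSupport fun x => fderiv ℝ φ x (unitVector i k) := hc.fderiv_apply ℝ _
  -- Against a test function the derivative moves off the wave function, where strong convergence
  -- applies.
  have key : ∀ {χ : L2 d n} {F : Fin n → Fin d → L2 d n}, IsWeakGradient χ F →
      ⟪testL2 φ hφ.continuous hc, F i k⟫_ℂ = -⟪testL2 _ hφ1 hc1, χ⟫_ℂ := fun {χ F} hF => by
    rw [inner_testL2, inner_testL2, hF i k φ hφ hc, neg_neg]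
  simp only [key (hG _), key hGs]
  exact (tendsto_const_nhds.inner h).neg

theorem integrable_weight_mul_sq {α : Type*} [MeasurableSpace α] {μ : Measure α} {γ : α → ℝ} {M : ℝ}
    (hγ : AEStronglyMeasurable γ μ) (hM : ∀ x, ‖γ x‖ ≤ M) (f : Lp ℂ 2 μ) :
    Integrable (fun x => γ x * ‖f x‖ ^ 2) μ :=
  (((memLp_two_iff_integrable_sq_norm (Lp.aestronglyMeasurable f)).1 (Lp.memLp f))).bdd_mul
    hγ (Eventually.of_forall hM)

/-- Expanding `0 ≤ ∫ γ |f_m - f|²` gives `∫ γ |f_m|² ≥ 2 Re ⟨γ f, f_m⟩ - ∫ γ |f|²`. The right side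
converges because `γ f` is in `L²`, and this is where boundedness of the weight is used. -/
theorem lintegral_le_liminf_of_bounded {α : Type*} [MeasurableSpace α] {μ : Measure α}
    {f : ℕ → Lp ℂ 2 μ} {fs : Lp ℂ 2 μ}
    (h : ∀ t, Tendsto (fun m => ⟪t, f m⟫_ℂ) atTop (𝓝 ⟪t, fs⟫_ℂ)) {γ : α → ℝ} {M : ℝ}
    (hγ : AEStronglyMeasurable γ μ) (hγ0 : ∀ x, 0 ≤ γ x) (hM : ∀ x, γ x ≤ M) :
    ∫⁻ x, ENNReal.ofReal (γ x) * ‖fs x‖ₑ ^ 2 ∂μ ≤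
      liminf (fun m => ∫⁻ x, ENNReal.ofReal (γ x) * ‖f m x‖ₑ ^ 2 ∂μ) atTop := by
  have hM' : ∀ x, ‖γ x‖ ≤ M := fun x => by rw [Real.norm_of_nonneg (hγ0 x)]; exact hM x
  have hof : ∀ u : Lp ℂ 2 μ, ∫⁻ x, ENNReal.ofReal (γ x) * ‖u x‖ₑ ^ 2 ∂μ =
      ENNReal.ofReal (∫ x, γ x * ‖u x‖ ^ 2 ∂μ) := fun u => by
    rw [ofReal_integral_eq_lintegral_ofReal (integrable_weight_mul_sq hγ hM' u)
      (Eventually.of_forall fun x => mul_nonneg (hγ0 x) (by positivity))]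
    refine lintegral_congr fun x => ?_
    rw [ENNReal.ofReal_mul (hγ0 x), ENNReal.ofReal_pow (norm_nonneg _), ofReal_norm]
  have hmem : MemLp (fun x => (γ x : ℂ) * fs x) 2 μ :=
    (Lp.memLp fs).of_le_mul (c := M)
      ((Complex.continuous_ofReal.comp_aestronglyMeasurable hγ).mul (Lp.aestronglyMeasurable fs))
      (Eventually.of_forall fun x => by
        rw [norm_mul, Complex.norm_real]
        gcongr
        exact hM' x)
  let t : Lp ℂ 2 μ := hmem.toLp
  have ht : ∀ u : Lp ℂ 2 μ, ⟪t, u⟫_ℂ = ∫ x, (γ x : ℂ) * (starRingEnd ℂ (fs x) * u x) ∂μ := fun u => by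
    rw [L2.inner_def]
    refine integral_congr_ae ?_
    filter_upwards [hmem.coeFn_toLp] with x hx
    simp only [t, hx, RCLike.inner_apply, map_mul, Complex.conj_ofReal]
    ring
  have hti : ∀ u : Lp ℂ 2 μ, Integrable (fun x => (γ x : ℂ) * (starRingEnd ℂ (fs x) * u x)) μ :=
    fun u => by
      refine (L2.integrable_inner (𝕜 := ℂ) t u).congr ?_
      filter_upwards [hmem.coeFn_toLp] with x hx
      simp only [t, hx, RCLike.inner_apply, map_mul, Complex.conj_ofReal]
      ring
  have hre : ∀ u : Lp ℂ 2 μ, Complex.re ⟪t, u⟫_ℂ =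
      ∫ x, γ x * (starRingEnd ℂ (fs x) * u x).re ∂μ := fun u => by
    rw [ht]
    have := integral_re (hti u)
    simp only [RCLike.re_to_complex, Complex.re_ofReal_mul] at this
    exact this.symm
  set A := ∫ x, γ x * ‖fs x‖ ^ 2 ∂μ with hA
  have hAre : Complex.re ⟪t, fs⟫_ℂ = A := by
    rw [hre]
    refine integral_congr_ae (Eventually.of_forall fun x => ?_)
    simp only [Complex.conj_mul']
    norm_cast
  have hle : ∀ m, 2 * Complex.re ⟪t, f m⟫_ℂ - A ≤ ∫ x, γ x * ‖f m x‖ ^ 2 ∂μ := fun m => by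
    have h1 : Integrable (fun x => γ x * (starRingEnd ℂ (fs x) * f m x).re) μ := by
      have := (hti (f m)).re
      simpa only [RCLike.re_to_complex, Complex.re_ofReal_mul] using this
    rw [hre, hA, ← integral_const_mul, ← integral_sub (h1.const_mul _)
      (integrable_weight_mul_sq hγ hM' fs)]
    refine integral_mono ((h1.const_mul _).sub (integrable_weight_mul_sq hγ hM' fs))
      (integrable_weight_mul_sq hγ hM' (f m)) fun x => ?_
    have h2 : (starRingEnd ℂ (fs x) * f m x).re ≤ ‖fs x‖ * ‖f m x‖ := by
      refine (Complex.re_le_norm _).trans (le_of_eq ?_)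
      simp
    have h3 : 2 * (starRingEnd ℂ (fs x) * f m x).re - ‖fs x‖ ^ 2 ≤ ‖f m x‖ ^ 2 := by
      nlinarith [sq_nonneg (‖fs x‖ - ‖f m x‖)]
    calc _ = γ x * (2 * (starRingEnd ℂ (fs x) * f m x).re - ‖fs x‖ ^ 2) := by ring
      _ ≤ _ := mul_le_mul_of_nonneg_left h3 (hγ0 x)
  have hlim : Tendsto (fun m => ENNReal.ofReal (2 * Complex.re ⟪t, f m⟫_ℂ - A)) atTop
      (𝓝 (ENNReal.ofReal A)) := by
    have h1 := (((Complex.continuous_re.tendsto _).comp (h t)).const_mul 2).sub_const A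
    rw [hAre, two_mul, add_sub_cancel_right] at h1
    exact (ENNReal.continuous_ofReal.tendsto _).comp h1
  simp only [hof]
  rw [← hlim.liminf_eq]
  exact liminf_le_liminf (Eventually.of_forall fun m => ENNReal.ofReal_le_ofReal (hle m))

/-- Weighted `L²` integrals are weakly lower semicontinuous. -/
theorem lintegral_le_liminf {α : Type*} [MeasurableSpace α] {μ : Measure α}
    {f : ℕ → Lp ℂ 2 μ} {fs : Lp ℂ 2 μ}
    (h : ∀ t, Tendsto (fun m => ⟪t, f m⟫_ℂ) atTop (𝓝 ⟪t, fs⟫_ℂ)) {g : α → ℝ≥0∞}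
    (hg : AEMeasurable g μ) :
    ∫⁻ x, g x * ‖fs x‖ₑ ^ 2 ∂μ ≤ liminf (fun m => ∫⁻ x, g x * ‖f m x‖ₑ ^ 2 ∂μ) atTop := by
  -- Bounded truncations of the weight reduce to the preceding case, and monotone convergence
  -- restores the weight.
  have hsup : ∀ x, g x * ‖fs x‖ₑ ^ 2 = ⨆ N : ℕ, min (g x) N * ‖fs x‖ₑ ^ 2 := fun x => by
    rw [← ENNReal.iSup_mul]
    congr 1
    have := ENNReal.iSup_natCast
    rw [← inf_iSup_eq, this, inf_top_eq]
  simp only [hsup]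
  have hm : ∀ N : ℕ, AEMeasurable (fun x => min (g x) N * ‖fs x‖ₑ ^ 2) μ := fun N =>
    (hg.min aemeasurable_const).mul ((Lp.aestronglyMeasurable fs).enorm.pow_const 2)
  rw [lintegral_iSup' hm
    (Eventually.of_forall fun x N M hNM => by
      dsimp only
      gcongr)]
  refine iSup_le fun N => ?_
  have hfin : ∀ x, min (g x) N ≠ ⊤ := fun x =>
    ne_top_of_le_ne_top (ENNReal.natCast_ne_top N) (min_le_right _ _)
  have h1 := lintegral_le_liminf_of_bounded h (γ := fun x => (min (g x) N).toReal) (M := N)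
    (hg.min aemeasurable_const).ennreal_toReal.aestronglyMeasurable
    (fun x => ENNReal.toReal_nonneg) (fun x => by
      refine ENNReal.toReal_le_of_le_ofReal (by positivity) ?_
      rw [ENNReal.ofReal_natCast]
      exact min_le_right _ _)
  simp only [ENNReal.ofReal_toReal (hfin _)] at h1
  refine h1.trans (liminf_le_liminf (Eventually.of_forall fun m => ?_))
  gcongr
  exact min_le_left _ _

end

section

/-! ### Coercivity of the energy form -/

/-- A surjective linear map sends Lebesgue measure to a multiple, possibly infinite, of Lebesgue
measure. This makes `w(x_i - x_j)` measurable although `w` is measurable only up to null sets. -/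
theorem quasiMeasurePreserving_sub_eval {d n : ℕ} {i j : Fin n} (hij : i ≠ j) :
    Measure.QuasiMeasurePreserving (fun z : Conf d n => z i - z j) := by
  let L : Conf d n →ₗ[ℝ] Pos d := LinearMap.proj (R := ℝ) (φ := fun _ : Fin n => Pos d) i -
    LinearMap.proj (R := ℝ) (φ := fun _ : Fin n => Pos d) j
  have hL : Function.Surjective L := fun x => ⟨Pi.single i x, by simp [L, hij.symm]⟩
  obtain ⟨c, -, hc⟩ := L.exists_map_addHaar_eq_smul_addHaar volume volume hL
  refine ⟨(measurable_pi_apply i).sub (measurable_pi_apply j), ?_⟩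
  have h : Measure.map (fun z : Conf d n => z i - z j) volume = c • volume := hc
  rw [h]
  exact Measure.smul_absolutelyContinuous

theorem lintegral_enorm_sq_ne_top {α : Type*} [MeasurableSpace α] {μ : Measure α} (f : Lp ℂ 2 μ) :
    ∫⁻ x, ‖f x‖ₑ ^ 2 ∂μ ≠ ⊤ := by
  have h := (memLp_two_iff_integrable_sq_norm (Lp.aestronglyMeasurable f)).1 (Lp.memLp f)
  have h2 := h.2.ne
  simpa [enorm_pow] using h2

theorem ofReal_mul_norm_sq {E : Type*} [SeminormedAddCommGroup E] (a : ℝ) (x : E) :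
    ENNReal.ofReal (a * ‖x‖ ^ 2) = ENNReal.ofReal a * ‖x‖ₑ ^ 2 := by
  rw [ENNReal.ofReal_mul' (by positivity), ENNReal.ofReal_pow (norm_nonneg _), ofReal_norm]

theorem integral_mul_norm_sq {α : Type*} [MeasurableSpace α] {μ : Measure α} {f : Lp ℂ 2 μ}
    {γ : α → ℝ} (h : Integrable (fun x => γ x * ‖f x‖ ^ 2) μ) :
    ∫ x, γ x * ‖f x‖ ^ 2 ∂μ = (∫⁻ x, ENNReal.ofReal (γ x) * ‖f x‖ₑ ^ 2 ∂μ).toReal -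
      (∫⁻ x, ENNReal.ofReal (-γ x) * ‖f x‖ₑ ^ 2 ∂μ).toReal := by
  rw [integral_eq_lintegral_pos_part_sub_lintegral_neg_part h]
  simp only [← neg_mul, ofReal_mul_norm_sq]

theorem lintegral_ofReal_mul_ne_top {α : Type*} [MeasurableSpace α] {μ : Measure α} {f : Lp ℂ 2 μ}
    {γ : α → ℝ} (h : Integrable (fun x => γ x * ‖f x‖ ^ 2) μ) :
    ∫⁻ x, ENNReal.ofReal (γ x) * ‖f x‖ₑ ^ 2 ∂μ ≠ ⊤ := by
  simp only [← ofReal_mul_norm_sq]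
  exact (h.lintegral_lt_top).ne

/-- The kinetic energy of an `n`-particle wave function. -/
def sectorKinetic {d n : ℕ} (ψ : L2 d n) : ℝ≥0∞ :=
  ∑ i, ∑ k, ∫⁻ x, ‖weakGradient ψ i k x‖ₑ ^ 2

theorem sectorKinetic_ne_top {d n : ℕ} (ψ : L2 d n) : sectorKinetic ψ ≠ ⊤ :=
  ENNReal.sum_ne_top.2 fun _ _ => ENNReal.sum_ne_top.2 fun _ _ => lintegral_enorm_sq_ne_top _

theorem toReal_sectorKinetic {d n : ℕ} (ψ : L2 d n) :
    (sectorKinetic ψ).toReal = ∑ i, ∑ k, ∫ x, ‖weakGradient ψ i k x‖ ^ 2 := by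
  rw [sectorKinetic, ENNReal.toReal_sum fun _ _ => ENNReal.sum_ne_top.2 fun _ _ =>
    lintegral_enorm_sq_ne_top _]
  refine Finset.sum_congr rfl fun i _ => ?_
  rw [ENNReal.toReal_sum fun _ _ => lintegral_enorm_sq_ne_top _]
  refine Finset.sum_congr rfl fun k _ => ?_
  have hm : AEStronglyMeasurable (fun x => ‖weakGradient ψ i k x‖ ^ 2) volume :=
    (Lp.aestronglyMeasurable (weakGradient ψ i k)).norm.pow 2
  rw [integral_eq_lintegral_of_nonneg_ae (Eventually.of_forall fun x => by positivity) hm]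
  congr 1
  refine lintegral_congr fun x => ?_
  rw [ENNReal.ofReal_pow (norm_nonneg _), ofReal_norm]

theorem MemH1.isWeakGradient {d n : ℕ} {ψ : L2 d n} (h : MemH1 ψ) :
    IsWeakGradient ψ (weakGradient ψ) := by
  rw [weakGradient, dif_pos h]
  exact h.choose_spec

/-- The expectation of the one-body potential `∑ g(x_i)`. -/
def sectorOneBody {d n : ℕ} (g : Pos d → ℝ) (ψ : L2 d n) : ℝ≥0∞ :=
  ∑ i, ∫⁻ x, ENNReal.ofReal (g (x i)) * ‖ψ x‖ₑ ^ 2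

/-- The expectation of the particle number. -/
def sectorNumber {d n : ℕ} (ψ : L2 d n) : ℝ≥0∞ := ∑ _i : Fin n, ∫⁻ x, ‖ψ x‖ₑ ^ 2

theorem sectorNumber_ne_top {d n : ℕ} (ψ : L2 d n) : sectorNumber ψ ≠ ⊤ :=
  ENNReal.sum_ne_top.2 fun _ _ => lintegral_enorm_sq_ne_top _

namespace Potentials

variable {d : ℕ} (P : Potentials d)

/-- The interaction energy, shifted by `r₀` times the particle number. -/
def sectorInteraction (r₀ : ℝ) {n : ℕ} (ψ : L2 d n) : ℝ≥0∞ :=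
  ∫⁻ x, ENNReal.ofReal (P.interaction x + n * r₀) * ‖ψ x‖ₑ ^ 2

variable {P}

theorem Admissible.aestronglyMeasurable_v (hP : P.Admissible) :
    AEStronglyMeasurable P.v volume := by
  have h := hP.v_pos.aestronglyMeasurable.sub
    (aemeasurable_of_memLpAddLinfty hP.v_neg).aestronglyMeasurable
  refine h.congr (Eventually.of_forall fun x => ?_)
  simp only [Pi.sub_apply]
  rcases le_total (P.v x) 0 with hx | hx
  · rw [max_eq_right hx, max_eq_left (by linarith)]; ring
  · rw [max_eq_left hx, max_eq_right (by linarith)]; ring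

theorem Admissible.aemeasurable_V (hP : P.Admissible) : AEMeasurable P.V :=
  (hP.aestronglyMeasurable_v.add hP.vc_loc.aestronglyMeasurable).aemeasurable

theorem Admissible.aemeasurable_interaction (hP : P.Admissible) (n : ℕ) :
    AEMeasurable fun x : Conf d n => P.interaction x := by
  unfold interaction
  refine Finset.aemeasurable_fun_sum _ fun i _ => Finset.aemeasurable_fun_sum _ fun j hj => ?_
  exact (aemeasurable_of_memLpAddLinfty hP.w_mem).comp_quasiMeasurePreserving
    (quasiMeasurePreserving_sub_eval (Finset.mem_Ioi.1 hj).ne)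

theorem interaction_eq_zero {n : ℕ} (hn : n < 2) (x : Conf d n) : P.interaction x = 0 := by
  refine Finset.sum_eq_zero fun i _ => Finset.sum_eq_zero fun j hj => ?_
  have := Finset.mem_Ioi.1 hj
  omega

theorem InFormDomain.integrable_V {n : ℕ} {ψ : L2 d n} (h : P.InFormDomain ψ) (j : Fin n) :
    Integrable (fun x : Conf d n => P.V (x j) * ‖ψ x‖ ^ 2) volume := by
  simp only [V, add_mul]
  exact (h.2.1 j).add (h.2.2.1 j)

theorem InFormDomain.integrable_interaction {n : ℕ} {ψ : L2 d n} (h : P.InFormDomain ψ) (r₀ : ℝ) :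
    Integrable (fun x : Conf d n => (P.interaction x + n * r₀) * ‖ψ x‖ ^ 2) volume := by
  simp only [add_mul, interaction, Finset.sum_mul]
  refine (integrable_finsetSum _ fun i _ => integrable_finsetSum _ fun j hj =>
    h.2.2.2 i j (Finset.mem_Ioi.1 hj)).add (Integrable.const_mul ?_ _)
  exact (memLp_two_iff_integrable_sq_norm (Lp.aestronglyMeasurable ψ)).1 (Lp.memLp ψ)

theorem InFormDomain.integral_total {n : ℕ} {ψ : L2 d n} (h : P.InFormDomain ψ) (r₀ : ℝ) :
    ∫ x, P.total r₀ x * ‖ψ x‖ ^ 2 = (∑ j, ∫ x, P.V (x j) * ‖ψ x‖ ^ 2) +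
      ∫ x, (P.interaction x + n * r₀) * ‖ψ x‖ ^ 2 := by
  rw [← integral_finsetSum _ fun j _ => h.integrable_V j,
    ← integral_add (integrable_finsetSum _ fun j _ => h.integrable_V j)
      (h.integrable_interaction r₀)]
  refine integral_congr_ae (Eventually.of_forall fun x => ?_)
  simp only [total, ← Finset.sum_mul, Finset.sum_add_distrib, Finset.sum_const, Finset.card_univ,
    Fintype.card_fin, nsmul_eq_mul]
  ring

theorem InFormDomain.sectorOneBody_ne_top {n : ℕ} {ψ : L2 d n} (h : P.InFormDomain ψ) :
    sectorOneBody P.V ψ ≠ ⊤ :=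
  ENNReal.sum_ne_top.2 fun j _ => lintegral_ofReal_mul_ne_top (γ := fun x : Conf d n => P.V (x j))
    (h.integrable_V j)

theorem InFormDomain.sectorOneBody_neg_ne_top {n : ℕ} {ψ : L2 d n} (h : P.InFormDomain ψ) :
    sectorOneBody (fun x => -P.V x) ψ ≠ ⊤ :=
  ENNReal.sum_ne_top.2 fun j _ => lintegral_ofReal_mul_ne_top (γ := fun x : Conf d n => -P.V (x j))
    (by simpa using (h.integrable_V j).neg)

theorem InFormDomain.sectorInteraction_ne_top {n : ℕ} {ψ : L2 d n} (h : P.InFormDomain ψ)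
    (r₀ : ℝ) : P.sectorInteraction r₀ ψ ≠ ⊤ :=
  lintegral_ofReal_mul_ne_top (h.integrable_interaction r₀)

theorem InFormDomain.toReal_oneBody {n : ℕ} {ψ : L2 d n} (h : P.InFormDomain ψ) :
    ∑ j, ∫ x, P.V (x j) * ‖ψ x‖ ^ 2 =
      (sectorOneBody P.V ψ).toReal - (sectorOneBody (fun x => -P.V x) ψ).toReal := by
  rw [sectorOneBody, sectorOneBody, ENNReal.toReal_sum fun j _ => lintegral_ofReal_mul_ne_top
    (γ := fun x : Conf d n => P.V (x j)) (h.integrable_V j), ENNReal.toReal_sum fun j _ =>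
    lintegral_ofReal_mul_ne_top (γ := fun x : Conf d n => -P.V (x j)) (by simpa using (h.integrable_V j).neg),
    ← Finset.sum_sub_distrib]
  exact Finset.sum_congr rfl fun j _ => integral_mul_norm_sq (h.integrable_V j)

theorem InFormDomain.toReal_interaction {n : ℕ} {ψ : L2 d n} (h : P.InFormDomain ψ) {r₀ : ℝ}
    (h0 : ∀ᵐ x : Conf d n, 0 ≤ P.interaction x + n * r₀) :
    ∫ x, (P.interaction x + n * r₀) * ‖ψ x‖ ^ 2 = (P.sectorInteraction r₀ ψ).toReal := by
  rw [integral_mul_norm_sq (h.integrable_interaction r₀)]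
  have h1 : ∫⁻ x, ENNReal.ofReal (-(P.interaction x + n * r₀)) * ‖ψ x‖ₑ ^ 2 = 0 := by
    rw [← lintegral_zero (μ := (volume : Measure (Conf d n)))]
    refine lintegral_congr_ae ?_
    filter_upwards [h0] with x hx
    rw [ENNReal.ofReal_of_nonpos (by linarith), zero_mul]
  rw [h1, ENNReal.toReal_zero, sub_zero]
  rfl

/-- The bounds on the parts of the energy, and their relation to the energy form. -/
structure Coercive (P : Potentials d) (r₀ C : ℝ) : Prop where
  balance : ∀ {n : ℕ} {ψ : L2 d n}, P.InFormDomain ψ →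
    sectorKinetic ψ + sectorOneBody P.V ψ + P.sectorInteraction r₀ ψ =
      P.sectorForm r₀ ψ + sectorOneBody (fun x => -P.V x) ψ
  kinetic_le : ∀ {n : ℕ} {ψ : L2 d n}, P.InFormDomain ψ →
    sectorKinetic ψ ≤ ENNReal.ofReal C * P.sectorForm r₀ ψ
  oneBody_le : ∀ {n : ℕ} {ψ : L2 d n}, P.InFormDomain ψ →
    sectorOneBody P.V ψ ≤ ENNReal.ofReal C * P.sectorForm r₀ ψ
  interaction_le : ∀ {n : ℕ} {ψ : L2 d n}, P.InFormDomain ψ →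
    P.sectorInteraction r₀ ψ ≤ ENNReal.ofReal C * P.sectorForm r₀ ψ
  number_le : ∀ {n : ℕ} {ψ : L2 d n}, P.InFormDomain ψ →
    sectorNumber ψ ≤ ENNReal.ofReal C * P.sectorForm r₀ ψ

theorem Admissible.exists_coercive (hd : 1 ≤ d) (hP : P.Admissible) :
    ∃ R C : ℝ, ∀ r₀, R ≤ r₀ → P.Coercive r₀ C := by
  obtain ⟨C₁, hC₁⟩ := exists_form_bound_of_isWeakGradient hd hP.v_neg (ε := 1 / 2) (by norm_num)
  obtain ⟨C₀, hC₀, hst⟩ := hP.w_stable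
  -- `C₀` cancels the stability bound, leaving an interaction of at least `2 * C₁ + 2` per particle.
  -- Half of it pays for the `C₁` per particle from the negative part of `V` and still leaves the
  -- number itself. So the form dominates half the kinetic energy, the positive part of `V`, half
  -- the interaction, and the number.
  refine ⟨C₀ + 2 * C₁ + 2, 2 + C₁, fun r₀ hr => ?_⟩
  have hC₁0 : (0 : ℝ) ≤ C₁ := C₁.2
  have hW : ∀ n : ℕ, ∀ᵐ x : Conf d n, (2 * C₁ + 2) * n ≤ P.interaction x + n * r₀ := by
    intro n
    have hn0 : (0 : ℝ) ≤ n := Nat.cast_nonneg n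
    by_cases hn : 2 ≤ n
    · filter_upwards [hst n hn] with x hx
      nlinarith
    · refine Eventually.of_forall fun x => ?_
      rw [interaction_eq_zero (by omega)]
      nlinarith
  have hW0 : ∀ n : ℕ, ∀ᵐ x : Conf d n, 0 ≤ P.interaction x + n * r₀ := fun n => by
    filter_upwards [hW n] with x hx
    exact le_trans (by positivity) hx
  have hneg : ∀ {n : ℕ} {ψ : L2 d n}, P.InFormDomain ψ →
      (sectorOneBody (fun x => -P.V x) ψ).toReal ≤
        1 / 2 * (sectorKinetic ψ).toReal + C₁ * (sectorNumber ψ).toReal := by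
    intro n ψ h
    have h1 : sectorOneBody (fun x => -P.V x) ψ ≤
        ((1 / 2 : ℝ≥0) : ℝ≥0∞) * sectorKinetic ψ + C₁ * sectorNumber ψ := by
      rw [sectorKinetic, sectorNumber, Finset.mul_sum, Finset.mul_sum, ← Finset.sum_add_distrib]
      refine Finset.sum_le_sum fun i _ => le_trans (lintegral_mono fun x => ?_)
        (hC₁ n i ψ _ h.1.isWeakGradient)
      gcongr
      rw [← ofReal_norm]
      refine ENNReal.ofReal_le_ofReal ((?_ : _ ≤ _).trans (le_abs_self _))
      refine le_max_of_le_left ?_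
      have := hP.vc_nonneg (x i)
      simp only [V]
      linarith
    have h2 := ENNReal.toReal_mono (ENNReal.add_ne_top.2
      ⟨ENNReal.mul_ne_top ENNReal.coe_ne_top (sectorKinetic_ne_top ψ),
        ENNReal.mul_ne_top ENNReal.coe_ne_top (sectorNumber_ne_top ψ)⟩) h1
    rw [ENNReal.toReal_add (ENNReal.mul_ne_top ENNReal.coe_ne_top (sectorKinetic_ne_top ψ))
        (ENNReal.mul_ne_top ENNReal.coe_ne_top (sectorNumber_ne_top ψ)), ENNReal.toReal_mul,
        ENNReal.toReal_mul] at h2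
    simpa using h2
  have hint : ∀ {n : ℕ} {ψ : L2 d n}, P.InFormDomain ψ →
      (2 * C₁ + 2) * (sectorNumber ψ).toReal ≤ (P.sectorInteraction r₀ ψ).toReal := by
    intro n ψ h
    have h1 : ENNReal.ofReal (2 * C₁ + 2) * sectorNumber ψ ≤ P.sectorInteraction r₀ ψ := by
      rw [sectorNumber, Finset.sum_const, Finset.card_univ, Fintype.card_fin, nsmul_eq_mul,
        ← mul_assoc, ← ENNReal.ofReal_natCast, ← ENNReal.ofReal_mul (by positivity),
        ← lintegral_const_mul' _ _ ENNReal.ofReal_ne_top]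
      refine lintegral_mono_ae ?_
      filter_upwards [hW n] with x hx
      gcongr
    have h2 := ENNReal.toReal_mono (h.sectorInteraction_ne_top r₀) h1
    rwa [ENNReal.toReal_mul, ENNReal.toReal_ofReal (by positivity)] at h2
  have hform : ∀ {n : ℕ} {ψ : L2 d n}, P.InFormDomain ψ → P.sectorForm r₀ ψ = ENNReal.ofReal
      ((sectorKinetic ψ).toReal + ((sectorOneBody P.V ψ).toReal -
        (sectorOneBody (fun x => -P.V x) ψ).toReal + (P.sectorInteraction r₀ ψ).toReal)) := by
    intro n ψ h
    rw [sectorForm, if_pos h, h.integral_total, h.toReal_oneBody, h.toReal_interaction (hW0 n),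
      toReal_sectorKinetic]
  have hbound : ∀ {n : ℕ} {ψ : L2 d n}, P.InFormDomain ψ → ∀ {a : ℝ≥0∞}, a ≠ ⊤ →
      (a.toReal ≤ (2 + C₁) * ((sectorKinetic ψ).toReal + ((sectorOneBody P.V ψ).toReal -
        (sectorOneBody (fun x => -P.V x) ψ).toReal + (P.sectorInteraction r₀ ψ).toReal))) →
      a ≤ ENNReal.ofReal (2 + C₁) * P.sectorForm r₀ ψ := by
    intro n ψ h a ha hle
    rw [hform h, ← ENNReal.ofReal_mul (by positivity)]
    exact (ENNReal.le_ofReal_iff_toReal_le ha (ENNReal.toReal_nonneg.trans hle)).2 hle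
  refine ⟨?_, ?_, ?_, ?_, ?_⟩ <;> intro n ψ h
  all_goals
    have e1 := hneg h
    have e2 := hint h
    have k0 : 0 ≤ (sectorKinetic ψ).toReal := ENNReal.toReal_nonneg
    have p0 : 0 ≤ (sectorOneBody P.V ψ).toReal := ENNReal.toReal_nonneg
    have m0 : 0 ≤ (sectorOneBody (fun x => -P.V x) ψ).toReal := ENNReal.toReal_nonneg
    have i0 : 0 ≤ (P.sectorInteraction r₀ ψ).toReal := ENNReal.toReal_nonneg
    have n0 : 0 ≤ (sectorNumber ψ).toReal := ENNReal.toReal_nonneg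
  · rw [hform h, ← ENNReal.toReal_eq_toReal_iff' (by
      simp [sectorKinetic_ne_top, h.sectorOneBody_ne_top, h.sectorInteraction_ne_top]) (by
      simp [h.sectorOneBody_neg_ne_top]),
      ENNReal.toReal_add (by simp [sectorKinetic_ne_top, h.sectorOneBody_ne_top])
        (h.sectorInteraction_ne_top r₀),
      ENNReal.toReal_add (sectorKinetic_ne_top ψ) h.sectorOneBody_ne_top,
      ENNReal.toReal_add ENNReal.ofReal_ne_top h.sectorOneBody_neg_ne_top,
      ENNReal.toReal_ofReal]
    · ring
    · nlinarith [mul_nonneg hC₁0 n0]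
  · refine hbound h (sectorKinetic_ne_top ψ) ?_
    nlinarith [mul_nonneg hC₁0 n0, mul_nonneg hC₁0 k0, mul_nonneg hC₁0 p0, mul_nonneg hC₁0 i0]
  · refine hbound h h.sectorOneBody_ne_top ?_
    nlinarith [mul_nonneg hC₁0 n0, mul_nonneg hC₁0 k0, mul_nonneg hC₁0 p0, mul_nonneg hC₁0 i0]
  · refine hbound h (h.sectorInteraction_ne_top r₀) ?_
    nlinarith [mul_nonneg hC₁0 n0, mul_nonneg hC₁0 k0, mul_nonneg hC₁0 p0, mul_nonneg hC₁0 i0]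
  · refine hbound h (sectorNumber_ne_top ψ) ?_
    nlinarith [mul_nonneg hC₁0 n0, mul_nonneg hC₁0 k0, mul_nonneg hC₁0 p0, mul_nonneg hC₁0 i0]

end Potentials

end

section

/-! ### Extended-valued local densities of states -/

variable {s : Statistics} {d : ℕ}

/-- The particle density, with values in `[0, ∞]`. -/
def densityE (ρ : FockOp s d) (x : Pos d) : ℝ≥0∞ :=
  ∑' j, marginal (fun n _ z => ‖component (column ρ j) n z‖ₑ ^ 2) x

/-- The kinetic energy density, with values in `[0, ∞]`. -/
def kineticE (ρ : FockOp s d) (x : Pos d) : ℝ≥0∞ :=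
  ∑' j, marginal
    (fun n i z => ∑ k : Fin d, ‖weakGradient (component (column ρ j) n) i k z‖ₑ ^ 2) x

/-- The interaction energy density, with values in `[0, ∞]`. -/
def Potentials.interactionE (P : Potentials d) (r₀ : ℝ) (ρ : FockOp s d) (x : Pos d) : ℝ≥0∞ :=
  ∑' j, marginal (fun n _ z => ENNReal.ofReal ((P.interaction z + n * r₀) / n) *
    ‖component (column ρ j) n z‖ₑ ^ 2) x

theorem lintegral_mul_tsum_marginal {J : Type*} [Countable J]
    {F : J → (n : ℕ) → Fin n → Conf d n → ℝ≥0∞} (hF : ∀ j n i, AEMeasurable (F j n i))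
    {g : Pos d → ℝ≥0∞} (hg : AEMeasurable g) :
    ∫⁻ x, g x * ∑' j, marginal (F j) x =
      ∑' j, ∑' n : ℕ, ∑ i : Fin n, ∫⁻ z, g (z i) * F j n i z := by
  simp only [← ENNReal.tsum_mul_left]
  have hm : ∀ j, AEMeasurable fun x => g x * marginal (F j) x := fun j =>
    hg.mul (aemeasurable_marginal (hF j))
  rw [lintegral_tsum hm]
  exact tsum_congr fun j => lintegral_mul_marginal (hF j) hg

theorem aemeasurable_L2_sq {n : ℕ} (ψ : L2 d n) : AEMeasurable fun z => ‖ψ z‖ₑ ^ 2 :=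
  (Lp.aestronglyMeasurable ψ).enorm.pow_const 2

theorem aemeasurable_kinetic_integrand {n : ℕ} (ψ : L2 d n) (i : Fin n) :
    AEMeasurable fun z => ∑ k : Fin d, ‖weakGradient ψ i k z‖ₑ ^ 2 :=
  Finset.aemeasurable_fun_sum _ fun _ _ => aemeasurable_L2_sq _

theorem Potentials.Admissible.aemeasurable_interaction_weight {P : Potentials d}
    (hP : P.Admissible) (r₀ : ℝ) (n : ℕ) : AEMeasurable fun z : Conf d n =>
      ENNReal.ofReal ((P.interaction z + n * r₀) / n) :=
  (((hP.aemeasurable_interaction n).add_const _).div_const _).ennreal_ofReal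

theorem aemeasurable_densityE (ρ : FockOp s d) : AEMeasurable (densityE ρ) :=
  AEMeasurable.tsum fun _ => aemeasurable_marginal fun _ _ => aemeasurable_L2_sq _

theorem aemeasurable_kineticE (ρ : FockOp s d) : AEMeasurable (kineticE ρ) :=
  AEMeasurable.tsum fun _ => aemeasurable_marginal fun _ _ => aemeasurable_kinetic_integrand _ _

theorem Potentials.Admissible.aemeasurable_interactionE {P : Potentials d} (hP : P.Admissible)
    (r₀ : ℝ) (ρ : FockOp s d) : AEMeasurable (P.interactionE r₀ ρ) :=
  AEMeasurable.tsum fun _ => aemeasurable_marginal fun _ _ =>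
    (hP.aemeasurable_interaction_weight r₀ _).mul (aemeasurable_L2_sq _)

theorem lintegral_mul_densityE (ρ : FockOp s d) {g : Pos d → ℝ≥0∞} (hg : AEMeasurable g) :
    ∫⁻ x, g x * densityE ρ x = ∑' j, ∑' n : ℕ, ∑ i : Fin n,
      ∫⁻ z, g (z i) * ‖component (column ρ j) n z‖ₑ ^ 2 :=
  lintegral_mul_tsum_marginal (fun _ _ _ => aemeasurable_L2_sq _) hg

theorem lintegral_mul_kineticE (ρ : FockOp s d) {g : Pos d → ℝ≥0∞} (hg : AEMeasurable g) :
    ∫⁻ x, g x * kineticE ρ x = ∑' j, ∑' n : ℕ, ∑ i : Fin n, ∑ k : Fin d,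
      ∫⁻ z, g (z i) * ‖weakGradient (component (column ρ j) n) i k z‖ₑ ^ 2 := by
  rw [show (fun x => g x * kineticE ρ x) = fun x => g x * ∑' j, marginal
    (fun n i z => ∑ k : Fin d, ‖weakGradient (component (column ρ j) n) i k z‖ₑ ^ 2) x from rfl,
    lintegral_mul_tsum_marginal (fun _ _ _ => aemeasurable_kinetic_integrand _ _) hg]
  simp only [Finset.mul_sum]
  refine tsum_congr fun j => tsum_congr fun n => Finset.sum_congr rfl fun i _ => ?_
  exact lintegral_finsetSum' _ fun k _ =>
    (aemeasurable_comp_eval i hg).mul (aemeasurable_L2_sq _)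

theorem Potentials.Admissible.lintegral_mul_interactionE {P : Potentials d} (hP : P.Admissible)
    (r₀ : ℝ) (ρ : FockOp s d) {g : Pos d → ℝ≥0∞} (hg : AEMeasurable g) :
    ∫⁻ x, g x * P.interactionE r₀ ρ x = ∑' j, ∑' n : ℕ, ∑ i : Fin n,
      ∫⁻ z, (g (z i) * ENNReal.ofReal ((P.interaction z + n * r₀) / n)) *
        ‖component (column ρ j) n z‖ₑ ^ 2 := by
  simp only [mul_assoc]
  exact lintegral_mul_tsum_marginal (fun _ _ _ =>
    (hP.aemeasurable_interaction_weight r₀ _).mul (aemeasurable_L2_sq _)) hg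

theorem lintegral_densityE (ρ : FockOp s d) :
    ∫⁻ x, densityE ρ x = ∑' j, ∑' n, sectorNumber (component (column ρ j) n) := by
  simpa [sectorNumber] using lintegral_mul_densityE ρ (g := fun _ => 1) aemeasurable_const

theorem lintegral_kineticE (ρ : FockOp s d) :
    ∫⁻ x, kineticE ρ x = ∑' j, ∑' n, sectorKinetic (component (column ρ j) n) := by
  simpa [sectorKinetic] using lintegral_mul_kineticE ρ (g := fun _ => 1) aemeasurable_const

theorem lintegral_ofReal_mul_densityE (ρ : FockOp s d) {g : Pos d → ℝ} (hg : AEMeasurable g) :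
    ∫⁻ x, ENNReal.ofReal (g x) * densityE ρ x =
      ∑' j, ∑' n, sectorOneBody g (component (column ρ j) n) :=
  lintegral_mul_densityE ρ hg.ennreal_ofReal

theorem Potentials.Admissible.lintegral_interactionE {P : Potentials d} (hP : P.Admissible)
    (r₀ : ℝ) (ρ : FockOp s d) :
    ∫⁻ x, P.interactionE r₀ ρ x =
      ∑' j, ∑' n, P.sectorInteraction r₀ (component (column ρ j) n) := by
  have h := hP.lintegral_mul_interactionE r₀ ρ (g := fun _ => 1) aemeasurable_const
  simp only [one_mul] at h
  rw [h]
  refine tsum_congr fun j => tsum_congr fun n => ?_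
  -- Each of the `n` particles carries `1 / n` of the interaction; for `n = 0` both sides vanish.
  obtain rfl | hn := Nat.eq_zero_or_pos n
  · simp [sectorInteraction, interaction_eq_zero (P := P) (n := 0) (by omega)]
  have hn' : (0 : ℝ) < n := by exact_mod_cast hn
  rw [sectorInteraction, Finset.sum_const, Finset.card_univ, Fintype.card_fin, nsmul_eq_mul,
    ← ENNReal.ofReal_natCast, ← lintegral_const_mul' _ _ ENNReal.ofReal_ne_top]
  refine lintegral_congr fun z => ?_
  rw [← mul_assoc, ← ENNReal.ofReal_mul hn'.le, mul_div_cancel₀ _ hn'.ne']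

theorem tsum_tsum_le_mul {J : Type*} {a b : J → ℕ → ℝ≥0∞} {C : ℝ≥0∞}
    (h : ∀ j n, a j n ≤ C * b j n) : ∑' j, ∑' n, a j n ≤ C * ∑' j, ∑' n, b j n := by
  simp only [← ENNReal.tsum_mul_left]
  exact ENNReal.tsum_le_tsum fun j => ENNReal.tsum_le_tsum fun n => h j n

theorem tsum_tsum_add {J : Type*} (a b : J → ℕ → ℝ≥0∞) :
    ∑' j, ∑' n, (a j n + b j n) = (∑' j, ∑' n, a j n) + ∑' j, ∑' n, b j n := by
  simp only [ENNReal.tsum_add]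

namespace Potentials

variable {P : Potentials d} {r₀ C : ℝ} {ρ : FockOp s d}

/-- A single component outside the form domain would make the global energy infinite. -/
theorem inFormDomain_of_mem_energySpace (hρ : ρ ∈ P.energySpace r₀ s) (j : BasisIndex (Fock s d))
    (n : ℕ) : P.InFormDomain (component (column ρ j) n) := by
  by_contra h
  have h1 : P.sectorForm r₀ (component (column ρ j) n) = ⊤ := if_neg h
  have h2 : P.globalEnergy r₀ ρ = ⊤ := by
    refine top_le_iff.1 ?_
    rw [← h1]
    exact (ENNReal.le_tsum (f := fun n => P.sectorForm r₀ (component (column ρ j) n)) n).trans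
      (ENNReal.le_tsum (f := fun j => P.fockForm r₀ (column ρ j)) j)
  exact hρ.2.ne h2

theorem tsum_tsum_component_lt_top (hρ : ρ ∈ P.energySpace r₀ s)
    {a : (n : ℕ) → L2 d n → ℝ≥0∞} (ha : ∀ {n : ℕ} {ψ : L2 d n}, P.InFormDomain ψ →
      a n ψ ≤ ENNReal.ofReal C * P.sectorForm r₀ ψ) :
    ∑' j, ∑' n, a n (component (column ρ j) n) < ⊤ :=
  (tsum_tsum_le_mul fun j n => ha (inFormDomain_of_mem_energySpace hρ j n)).trans_lt
    (ENNReal.mul_lt_top ENNReal.ofReal_lt_top hρ.2)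

theorem Coercive.lintegral_densityE_lt_top (h : P.Coercive r₀ C) (hρ : ρ ∈ P.energySpace r₀ s) :
    ∫⁻ x, densityE ρ x < ⊤ :=
  lintegral_densityE ρ ▸ tsum_tsum_component_lt_top hρ (a := fun _ => sectorNumber) h.number_le

theorem Coercive.lintegral_kineticE_lt_top (h : P.Coercive r₀ C) (hρ : ρ ∈ P.energySpace r₀ s) :
    ∫⁻ x, kineticE ρ x < ⊤ :=
  lintegral_kineticE ρ ▸ tsum_tsum_component_lt_top hρ (a := fun _ => sectorKinetic) h.kinetic_le

theorem Coercive.lintegral_interactionE_lt_top (h : P.Coercive r₀ C) (hP : P.Admissible)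
    (hρ : ρ ∈ P.energySpace r₀ s) : ∫⁻ x, P.interactionE r₀ ρ x < ⊤ :=
  hP.lintegral_interactionE r₀ ρ ▸ tsum_tsum_component_lt_top hρ (a := fun _ => P.sectorInteraction r₀)
    h.interaction_le

theorem Coercive.lintegral_V_lt_top (h : P.Coercive r₀ C) (hP : P.Admissible)
    (hρ : ρ ∈ P.energySpace r₀ s) : ∫⁻ x, ENNReal.ofReal (P.V x) * densityE ρ x < ⊤ :=
  lintegral_ofReal_mul_densityE ρ hP.aemeasurable_V ▸
    tsum_tsum_component_lt_top hρ (a := fun _ => sectorOneBody P.V) h.oneBody_le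

/-- The negative part of `V` stands on the right, so that the identity holds in `[0, ∞]` without
subtraction. -/
theorem Coercive.lintegral_balance (h : P.Coercive r₀ C) (hP : P.Admissible)
    (hρ : ρ ∈ P.energySpace r₀ s) :
    (∫⁻ x, kineticE ρ x) + (∫⁻ x, ENNReal.ofReal (P.V x) * densityE ρ x) +
      (∫⁻ x, P.interactionE r₀ ρ x) =
      P.globalEnergy r₀ ρ + ∫⁻ x, ENNReal.ofReal (-P.V x) * densityE ρ x := by
  rw [lintegral_kineticE, hP.lintegral_interactionE,
    lintegral_ofReal_mul_densityE ρ hP.aemeasurable_V,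
    lintegral_ofReal_mul_densityE ρ (g := fun x => -P.V x) hP.aemeasurable_V.neg, ← tsum_tsum_add, ← tsum_tsum_add,
    globalEnergy, formTrace]
  simp only [fockForm]
  rw [← tsum_tsum_add]
  exact tsum_congr fun j => tsum_congr fun n =>
    h.balance (inFormDomain_of_mem_energySpace hρ j n)

end Potentials

/-! ### Lower semicontinuity of the local densities -/

theorem tsum_tsum_sum_le_liminf {J : Type*} {a : ℕ → J → (n : ℕ) → Fin n → ℝ≥0∞}
    {b : J → (n : ℕ) → Fin n → ℝ≥0∞}
    (h : ∀ j n i, b j n i ≤ liminf (fun m => a m j n i) atTop) :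
    ∑' j, ∑' n, ∑ i, b j n i ≤ liminf (fun m => ∑' j, ∑' n, ∑ i, a m j n i) atTop := by
  refine le_trans (ENNReal.tsum_le_tsum fun j => ?_) (tsum_liminf_le _)
  refine le_trans (ENNReal.tsum_le_tsum fun n => ?_) (tsum_liminf_le _)
  exact le_trans (Finset.sum_le_sum fun i _ => h j n i) (sum_liminf_le _)

theorem enorm_sq_eq_lintegral {α : Type*} [MeasurableSpace α] {μ : Measure α} (f : Lp ℂ 2 μ) :
    ‖f‖ₑ ^ 2 = ∫⁻ x, ‖f x‖ₑ ^ 2 ∂μ := by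
  rw [Lp.enorm_def, eLpNorm_eq_lintegral_rpow_enorm_toReal two_ne_zero ENNReal.ofNat_ne_top,
    ← ENNReal.rpow_natCast, ← ENNReal.rpow_mul]
  simp

section Limit

variable {ρ : ℕ → FockOp s d} {ρs : FockOp s d}

theorem densityE_lsc (hcol : ∀ j, Tendsto (fun m => column (ρ m) j) atTop (𝓝 (column ρs j)))
    {g : Pos d → ℝ≥0∞} (hg : AEMeasurable g) :
    ∫⁻ x, g x * densityE ρs x ≤ liminf (fun m => ∫⁻ x, g x * densityE (ρ m) x) atTop := by
  simp only [lintegral_mul_densityE _ hg]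
  exact tsum_tsum_sum_le_liminf fun j n i => lintegral_le_liminf
    (fun t => tendsto_const_nhds.inner (tendsto_component (hcol j) n)) (aemeasurable_comp_eval i hg)

theorem interactionE_lsc {P : Potentials d} (hP : P.Admissible) (r₀ : ℝ)
    (hcol : ∀ j, Tendsto (fun m => column (ρ m) j) atTop (𝓝 (column ρs j)))
    {g : Pos d → ℝ≥0∞} (hg : AEMeasurable g) :
    ∫⁻ x, g x * P.interactionE r₀ ρs x ≤
      liminf (fun m => ∫⁻ x, g x * P.interactionE r₀ (ρ m) x) atTop := by
  simp only [hP.lintegral_mul_interactionE r₀ _ hg]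
  exact tsum_tsum_sum_le_liminf fun j n i => lintegral_le_liminf
    (fun t => tendsto_const_nhds.inner (tendsto_component (hcol j) n))
    ((aemeasurable_comp_eval i hg).mul (hP.aemeasurable_interaction_weight r₀ n))

theorem norm_weakGradient_sq_le {ρ : FockOp s d} {B : ℝ≥0∞} (hB : B ≠ ⊤)
    (hρ : ∫⁻ x, kineticE ρ x ≤ B) (j : BasisIndex (Fock s d)) (n : ℕ) (i : Fin n) (k : Fin d) :
    ‖weakGradient (component (column ρ j) n) i k‖ ≤ √B.toReal := by
  have h1 : ‖weakGradient (component (column ρ j) n) i k‖ₑ ^ 2 ≤ B := by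
    refine le_trans ?_ hρ
    rw [lintegral_kineticE, enorm_sq_eq_lintegral]
    calc _ ≤ sectorKinetic (component (column ρ j) n) :=
          (Finset.single_le_sum (f := fun k =>
            ∫⁻ x, ‖weakGradient (component (column ρ j) n) i k x‖ₑ ^ 2)
            (fun _ _ => zero_le) (Finset.mem_univ k)).trans
          (Finset.single_le_sum (f := fun i => ∑ k,
            ∫⁻ x, ‖weakGradient (component (column ρ j) n) i k x‖ₑ ^ 2)
            (fun _ _ => zero_le) (Finset.mem_univ i))
      _ ≤ _ := (ENNReal.le_tsum (f := fun n => sectorKinetic (component (column ρ j) n)) n).trans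
          (ENNReal.le_tsum (f := fun j => ∑' n, sectorKinetic (component (column ρ j) n)) j)
  have h2 := ENNReal.toReal_mono hB h1
  rw [ENNReal.toReal_pow, toReal_enorm] at h2
  exact Real.le_sqrt_of_sq_le h2

theorem tendsto_inner_weakGradient_component
    (hcol : ∀ j, Tendsto (fun m => column (ρ m) j) atTop (𝓝 (column ρs j)))
    (hH : ∀ m j n, MemH1 (component (column (ρ m) j) n)) (hHs : ∀ j n, MemH1 (component (column ρs j) n))
    {B : ℝ≥0∞} (hB : B ≠ ⊤) (hρ : ∀ m, ∫⁻ x, kineticE (ρ m) x ≤ B) (j : BasisIndex (Fock s d)) (n : ℕ)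
    (i : Fin n) (k : Fin d) (t : L2 d n) :
    Tendsto (fun m => ⟪t, weakGradient (component (column (ρ m) j) n) i k⟫_ℂ) atTop
      (𝓝 ⟪t, weakGradient (component (column ρs j) n) i k⟫_ℂ) :=
  tendsto_inner_weakGradient (tendsto_component (hcol j) n) (fun m => (hH m j n).isWeakGradient)
    (hHs j n).isWeakGradient i k (fun m => norm_weakGradient_sq_le hB (hρ m) j n i k) t

/-- The gradients converge only weakly, their norms being bounded through `B`; lower semicontinuity
asks no more. -/
theorem kineticE_lsc (hcol : ∀ j, Tendsto (fun m => column (ρ m) j) atTop (𝓝 (column ρs j)))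
    (hH : ∀ m j n, MemH1 (component (column (ρ m) j) n)) (hHs : ∀ j n, MemH1 (component (column ρs j) n))
    {B : ℝ≥0∞} (hB : B ≠ ⊤) (hρ : ∀ m, ∫⁻ x, kineticE (ρ m) x ≤ B)
    {g : Pos d → ℝ≥0∞} (hg : AEMeasurable g) :
    ∫⁻ x, g x * kineticE ρs x ≤ liminf (fun m => ∫⁻ x, g x * kineticE (ρ m) x) atTop := by
  simp only [lintegral_mul_kineticE _ hg]
  exact tsum_tsum_sum_le_liminf fun j n i => le_trans (Finset.sum_le_sum fun k _ =>
    lintegral_le_liminf (tendsto_inner_weakGradient_component hcol hH hHs hB hρ j n i k)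
      (aemeasurable_comp_eval i hg)) (sum_liminf_le _)

end Limit

end

section

/-! ### The local current -/

section Restrict

variable {α : Type*} [MeasurableSpace α] {μ : Measure α}

/-- The form `⟨f, 1_S g⟩`. -/
def innerOn (S : Set α) (f g : Lp ℂ 2 μ) : ℂ :=
  ⟪LpToLpRestrictCLM α ℂ ℂ μ 2 S f, LpToLpRestrictCLM α ℂ ℂ μ 2 S g⟫_ℂ

theorem norm_innerOn_le (S : Set α) (f g : Lp ℂ 2 μ) : ‖innerOn S f g‖ ≤ ‖f‖ * ‖g‖ :=
  (norm_inner_le_norm _ _).trans (mul_le_mul (norm_Lp_toLp_restrict_le S f)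
    (norm_Lp_toLp_restrict_le S g) (norm_nonneg _) (norm_nonneg _))

theorem im_innerOn (S : Set α) (f g : Lp ℂ 2 μ) :
    (innerOn S f g).im = ∫ x in S, (starRingEnd ℂ (f x) * g x).im ∂μ := by
  have h : innerOn S f g = ∫ x in S, starRingEnd ℂ (f x) * g x ∂μ := by
    rw [innerOn, L2.inner_def]
    refine integral_congr_ae ?_
    filter_upwards [LpToLpRestrictCLM_coeFn (p := 2) (μ := μ) ℂ S f,
      LpToLpRestrictCLM_coeFn (p := 2) (μ := μ) ℂ S g] with x hf hg
    rw [hf, hg, RCLike.inner_apply, mul_comm]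
  have hi : Integrable (fun x => starRingEnd ℂ (f x) * g x) (μ.restrict S) := by
    refine Integrable.integrableOn ?_
    refine (L2.integrable_inner (𝕜 := ℂ) f g).congr (Eventually.of_forall fun x => ?_)
    simp only [RCLike.inner_apply, mul_comm]
  rw [h]
  exact (integral_im hi).symm

/-- Strong convergence in one factor and bounded weak convergence in the other suffice for the
pairing. -/
theorem tendsto_innerOn {f g : ℕ → Lp ℂ 2 μ} {fs gs : Lp ℂ 2 μ} (S : Set α)
    (hf : Tendsto f atTop (𝓝 fs)) {C : ℝ} (hC : ∀ m, ‖g m‖ ≤ C)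
    (hg : ∀ t, Tendsto (fun m => ⟪t, g m⟫_ℂ) atTop (𝓝 ⟪t, gs⟫_ℂ)) :
    Tendsto (fun m => innerOn S (f m) (g m)) atTop (𝓝 (innerOn S fs gs)) := by
  have h1 : Tendsto (fun m => innerOn S fs (g m)) atTop (𝓝 (innerOn S fs gs)) := by
    have := hg ((LpToLpRestrictCLM α ℂ ℂ μ 2 S).adjoint (LpToLpRestrictCLM α ℂ ℂ μ 2 S fs))
    simp only [ContinuousLinearMap.adjoint_inner_left] at this
    exact this
  have h2 : Tendsto (fun m => innerOn S (f m - fs) (g m)) atTop (𝓝 0) := by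
    rw [tendsto_iff_norm_sub_tendsto_zero] at hf
    refine squeeze_zero_norm (fun m => (norm_innerOn_le _ _ _).trans
      (mul_le_mul_of_nonneg_left (hC m) (norm_nonneg _))) ?_
    simpa using hf.mul_const C
  have h3 := h2.add h1
  rw [zero_add] at h3
  refine h3.congr fun m => ?_
  simp only [innerOn, map_sub, inner_sub_left, sub_add_cancel]

end Restrict

theorem integrable_im_conj_mul {α : Type*} [MeasurableSpace α] {μ : Measure α} (f g : Lp ℂ 2 μ) :
    Integrable (fun x => (starRingEnd ℂ (f x) * g x).im) μ := by
  have h : Integrable (fun x => starRingEnd ℂ (f x) * g x) μ := by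
    refine (L2.integrable_inner (𝕜 := ℂ) f g).congr (Eventually.of_forall fun x => ?_)
    simp only [RCLike.inner_apply, mul_comm]
  exact h.im

theorem lintegral_enorm_im_conj_mul_le {α : Type*} [MeasurableSpace α] {μ : Measure α}
    (f g : Lp ℂ 2 μ) : ∫⁻ x, ‖(starRingEnd ℂ (f x) * g x).im‖ₑ ∂μ ≤
      (∫⁻ x, ‖f x‖ₑ ^ 2 ∂μ) + ∫⁻ x, ‖g x‖ₑ ^ 2 ∂μ := by
  rw [← lintegral_add_left' ((Lp.aestronglyMeasurable f).enorm.pow_const 2)]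
  refine lintegral_mono fun x => ?_
  simp only [← ofReal_norm, ← ENNReal.ofReal_pow (norm_nonneg _)]
  rw [← ENNReal.ofReal_add (by positivity) (by positivity)]
  refine ENNReal.ofReal_le_ofReal ?_
  have h1 : ‖(starRingEnd ℂ (f x) * g x).im‖ ≤ ‖f x‖ * ‖g x‖ :=
    (Complex.abs_im_le_norm _).trans (by simp)
  nlinarith [sq_nonneg (‖f x‖ - ‖g x‖), norm_nonneg (f x), norm_nonneg (g x)]

section Fiber

variable {d n : ℕ}

theorem integrable_insertNth (i : Fin (n + 1)) {f : Conf d (n + 1) → ℝ} (hf : Integrable f) :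
    Integrable (fun p : Pos d × Conf d n => f (i.insertNth p.1 p.2)) (volume.prod volume) :=
  (volume_preserving_piFinSuccAbove (fun _ : Fin (n + 1) => Pos d) i).symm.integrable_comp_of_integrable
    hf

theorem lintegral_enorm_integral_insertNth_le (i : Fin (n + 1)) {f : Conf d (n + 1) → ℝ}
    (hf : Integrable f) :
    ∫⁻ x : Pos d, ‖∫ y : Conf d n, f (i.insertNth x y)‖ₑ ≤ ∫⁻ z, ‖f z‖ₑ := by
  rw [← lintegral_insertNth i hf.aestronglyMeasurable.enorm]
  exact lintegral_mono fun x => enorm_integral_le_lintegral_enorm _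

theorem setIntegral_insertNth (i : Fin (n + 1)) {f : Conf d (n + 1) → ℝ} (hf : Integrable f)
    (A : Set (Pos d)) :
    ∫ x in A, ∫ y : Conf d n, f (i.insertNth x y) = ∫ z in {z | z i ∈ A}, f z := by
  have h := (volume_preserving_piFinSuccAbove (fun _ : Fin (n + 1) => Pos d) i).symm
  rw [← h.setIntegral_preimage_emb (MeasurableEquiv.measurableEmbedding _)]
  have hS : (MeasurableEquiv.piFinSuccAbove (fun _ => Pos d) i).symm ⁻¹' {z | z i ∈ A} =
      A ×ˢ (Set.univ : Set (Conf d n)) := by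
    ext p
    simp
  rw [hS, Measure.volume_eq_prod, setIntegral_prod (fun p : Pos d × Conf d n =>
    f ((MeasurableEquiv.piFinSuccAbove (fun _ => Pos d) i).symm p))
    (integrable_insertNth i hf).integrableOn]
  simp only [Measure.restrict_univ]
  rfl

end Fiber

/-- Flattens the sum over vectors, sectors and particles into one series, so that dominated
convergence can be applied once. -/
theorem tsum_prod_sigma_fin_succ {J : Type*} (a : J → (n : ℕ) → Fin n → ℝ≥0∞) :
    ∑' ι : J × (Σ n : ℕ, Fin (n + 1)), a ι.1 (ι.2.1 + 1) ι.2.2 = ∑' j, ∑' n, ∑ i, a j n i := by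
  rw [ENNReal.tsum_prod (f := fun j (σ : Σ n : ℕ, Fin (n + 1)) => a j (σ.1 + 1) σ.2)]
  refine tsum_congr fun j => ?_
  rw [ENNReal.tsum_sigma (fun (n : ℕ) (i : Fin (n + 1)) => a j (n + 1) i), tsum_eq_zero_add' (f := fun n => ∑ i, a j n i) ENNReal.summable]
  simp [tsum_fintype]

variable {s : Statistics} {d : ℕ}

/-- The index set of the sum that defines the local current. -/
abbrev CurrentIndex (s : Statistics) (d : ℕ) : Type :=
  BasisIndex (Fock s d) × (Σ n : ℕ, Fin (n + 1))

/-- The wave function that belongs to an index. -/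
def indexWave (ρ : FockOp s d) (ι : CurrentIndex s d) : L2 d (ι.2.1 + 1) :=
  component (column ρ ι.1) (ι.2.1 + 1)

/-- The derivative of the wave function that belongs to an index. -/
def indexGrad (ρ : FockOp s d) (k : Fin d) (ι : CurrentIndex s d) : L2 d (ι.2.1 + 1) :=
  weakGradient (indexWave ρ ι) ι.2.2 k

/-- The contribution of one index to the local current. -/
def currentTerm (ρ : FockOp s d) (k : Fin d) (ι : CurrentIndex s d) (x : Pos d) : ℝ :=
  ∫ y : Conf d ι.2.1, (starRingEnd ℂ (indexWave ρ ι (ι.2.2.insertNth x y)) *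
    indexGrad ρ k ι (ι.2.2.insertNth x y)).im

theorem tsum_enorm_indexWave_sq (ρ : FockOp s d) :
    ∑' ι, ‖indexWave ρ ι‖ₑ ^ 2 = ∫⁻ x, densityE ρ x := by
  rw [lintegral_densityE]
  simp only [enorm_sq_eq_lintegral]
  exact tsum_prod_sigma_fin_succ fun j n (_ : Fin n) => ∫⁻ z, ‖component (column ρ j) n z‖ₑ ^ 2

theorem tsum_enorm_indexGrad_sq_le (ρ : FockOp s d) (k : Fin d) :
    ∑' ι, ‖indexGrad ρ k ι‖ₑ ^ 2 ≤ ∫⁻ x, kineticE ρ x := by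
  rw [lintegral_kineticE]
  simp only [enorm_sq_eq_lintegral]
  refine (tsum_prod_sigma_fin_succ fun j n (i : Fin n) =>
    ∫⁻ z, ‖weakGradient (component (column ρ j) n) i k z‖ₑ ^ 2).trans_le ?_
  exact ENNReal.tsum_le_tsum fun j => ENNReal.tsum_le_tsum fun n => Finset.sum_le_sum fun i _ =>
    Finset.single_le_sum (f := fun k => ∫⁻ x, ‖weakGradient (component (column ρ j) n) i k x‖ₑ ^ 2)
      (fun _ _ => zero_le) (Finset.mem_univ k)

theorem aestronglyMeasurable_currentTerm (ρ : FockOp s d) (k : Fin d) (ι : CurrentIndex s d) :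
    AEStronglyMeasurable (currentTerm ρ k ι) volume :=
  (integrable_insertNth ι.2.2 (integrable_im_conj_mul (indexWave ρ ι)
    (indexGrad ρ k ι))).aestronglyMeasurable.integral_prod_right'

/-- Since `|ψ| |∇ψ| ≤ |ψ|² + |∇ψ|²`, finite particle number and kinetic energy make the current
series absolutely convergent in `L¹`. -/
theorem tsum_lintegral_enorm_currentTerm_le (ρ : FockOp s d) (k : Fin d) :
    ∑' ι, ∫⁻ x, ‖currentTerm ρ k ι x‖ₑ ≤ (∫⁻ x, densityE ρ x) + ∫⁻ x, kineticE ρ x := by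
  calc _ ≤ ∑' ι, (‖indexWave ρ ι‖ₑ ^ 2 + ‖indexGrad ρ k ι‖ₑ ^ 2) := by
        refine ENNReal.tsum_le_tsum fun ι => ?_
        rw [enorm_sq_eq_lintegral, enorm_sq_eq_lintegral]
        exact (lintegral_enorm_integral_insertNth_le ι.2.2 (integrable_im_conj_mul _ _)).trans
          (lintegral_enorm_im_conj_mul_le _ _)
    _ ≤ _ := by
        rw [ENNReal.tsum_add, tsum_enorm_indexWave_sq]
        exact add_le_add_right (tsum_enorm_indexGrad_sq_le ρ k) _

section Finite

variable {ρ : FockOp s d}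

theorem tsum_lintegral_enorm_currentTerm_ne_top (hn : ∫⁻ x, densityE ρ x ≠ ⊤)
    (hk : ∫⁻ x, kineticE ρ x ≠ ⊤) (k : Fin d) :
    ∑' ι, ∫⁻ x, ‖currentTerm ρ k ι x‖ₑ ≠ ⊤ :=
  ne_top_of_le_ne_top (ENNReal.add_ne_top.2 ⟨hn, hk⟩) (tsum_lintegral_enorm_currentTerm_le ρ k)

theorem ae_summable_currentTerm (hn : ∫⁻ x, densityE ρ x ≠ ⊤) (hk : ∫⁻ x, kineticE ρ x ≠ ⊤)
    (k : Fin d) : ∀ᵐ x, Summable fun ι => ‖currentTerm ρ k ι x‖ := by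
  have h := tsum_lintegral_enorm_currentTerm_ne_top hn hk k
  have hm : ∀ ι, AEMeasurable fun x => ‖currentTerm ρ k ι x‖ₑ := fun ι =>
    (aestronglyMeasurable_currentTerm ρ k ι).enorm
  rw [← lintegral_tsum hm] at h
  filter_upwards [ae_lt_top' (AEMeasurable.tsum hm) h] with x hx
  simpa using ENNReal.summable_toReal hx.ne

/-- A real `tsum` is zero when its terms are not summable; absolute summability at almost every
point is what justifies merging the iterated sums. -/
theorem current_apply_ae_eq (hn : ∫⁻ x, densityE ρ x ≠ ⊤) (hk : ∫⁻ x, kineticE ρ x ≠ ⊤)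
    (k : Fin d) : (fun x => current ρ x k) =ᵐ[volume] fun x => ∑' ι, currentTerm ρ k ι x := by
  filter_upwards [ae_summable_currentTerm hn hk k] with x hx
  have hx' : Summable fun ι => currentTerm ρ k ι x := hx.of_norm
  rw [hx'.tsum_prod]
  refine tsum_congr fun j => ?_
  have hj : Summable fun σ : Σ n : ℕ, Fin (n + 1) => currentTerm ρ k (j, σ) x :=
    hx'.prod_factor j
  rw [hj.tsum_sigma]
  simp only [tsum_fintype]
  rfl

theorem integrable_current_apply (hn : ∫⁻ x, densityE ρ x ≠ ⊤) (hk : ∫⁻ x, kineticE ρ x ≠ ⊤)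
    (k : Fin d) : Integrable (fun x => current ρ x k) := by
  refine Integrable.congr ?_ (current_apply_ae_eq hn hk k).symm
  have hm := aestronglyMeasurable_currentTerm ρ k
  have h := tsum_lintegral_enorm_currentTerm_ne_top hn hk k
  rw [← lintegral_tsum fun ι => (hm ι).enorm] at h
  refine ⟨(AEMeasurable.tsum fun ι => (hm ι).aemeasurable).aestronglyMeasurable,
    lt_of_le_of_lt (lintegral_mono fun x => ?_) h.lt_top⟩
  exact enorm_tsum_le_tsum_enorm

theorem setIntegral_current_apply (hn : ∫⁻ x, densityE ρ x ≠ ⊤) (hk : ∫⁻ x, kineticE ρ x ≠ ⊤)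
    (k : Fin d) (A : Set (Pos d)) :
    ∫ x in A, current ρ x k =
      ∑' ι, (innerOn {z | z ι.2.2 ∈ A} (indexWave ρ ι) (indexGrad ρ k ι)).im := by
  rw [integral_congr_ae (ae_restrict_of_ae (current_apply_ae_eq hn hk k)), integral_tsum
    (fun ι => (aestronglyMeasurable_currentTerm ρ k ι).restrict)
    (ne_top_of_le_ne_top (tsum_lintegral_enorm_currentTerm_ne_top hn hk k)
      (ENNReal.tsum_le_tsum fun ι => setLIntegral_le_lintegral A _))]
  refine tsum_congr fun ι => ?_
  rw [im_innerOn]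
  exact setIntegral_insertNth ι.2.2 (integrable_im_conj_mul (indexWave ρ ι) (indexGrad ρ k ι)) A

end Finite

theorem summable_norm_sq_of_tsum_enorm_sq {ι : Type*} {E : ι → Type*}
    [∀ i, SeminormedAddCommGroup (E i)] {f : ∀ i, E i} (h : ∑' i, ‖f i‖ₑ ^ 2 ≠ ⊤) :
    Summable fun i => ‖f i‖ ^ 2 := by
  simpa using ENNReal.summable_toReal h

theorem tsum_norm_sq_eq_toReal {ι : Type*} {E : ι → Type*} [∀ i, SeminormedAddCommGroup (E i)]
    (f : ∀ i, E i) : ∑' i, ‖f i‖ ^ 2 = (∑' i, ‖f i‖ₑ ^ 2).toReal := by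
  rw [ENNReal.tsum_toReal_eq fun i => ENNReal.pow_ne_top enorm_ne_top]
  simp

/-- If the columns converge, the particle numbers converge, and the kinetic energies are bounded,
then the currents converge in the sense of set integrals. -/
theorem tendsto_setIntegral_current {ρ : ℕ → FockOp s d} {ρs : FockOp s d}
    (hcol : ∀ j, Tendsto (fun m => column (ρ m) j) atTop (𝓝 (column ρs j)))
    (hH : ∀ m j n, MemH1 (component (column (ρ m) j) n))
    (hHs : ∀ j n, MemH1 (component (column ρs j) n))
    {B : ℝ≥0∞} (hB : B ≠ ⊤) (hρ : ∀ m, ∫⁻ x, kineticE (ρ m) x ≤ B) (hρs : ∫⁻ x, kineticE ρs x ≤ B)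
    (hN : ∫⁻ x, densityE ρs x ≠ ⊤) (hn : ∀ m, ∫⁻ x, densityE (ρ m) x = ∫⁻ x, densityE ρs x)
    (k : Fin d) (A : Set (Pos d)) :
    Tendsto (fun m => ∫ x in A, current (ρ m) x k) atTop (𝓝 (∫ x in A, current ρs x k)) := by
  rw [setIntegral_current_apply hN (ne_top_of_le_ne_top hB hρs) k A]
  simp only [fun m => setIntegral_current_apply ((hn m).trans_ne hN)
    (ne_top_of_le_ne_top hB (hρ m)) k A]
  have hw : ∀ τ : FockOp s d, ∫⁻ x, densityE τ x = ∫⁻ x, densityE ρs x →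
      (Summable fun ι => ‖indexWave τ ι‖ ^ 2) ∧
        ∑' ι, ‖indexWave τ ι‖ ^ 2 = (∫⁻ x, densityE ρs x).toReal := fun τ hτ => by
    have h := (tsum_enorm_indexWave_sq τ).trans hτ
    exact ⟨summable_norm_sq_of_tsum_enorm_sq (h.trans_ne hN), by rw [tsum_norm_sq_eq_toReal, h]⟩
  have hg : ∀ τ : FockOp s d, ∫⁻ x, kineticE τ x ≤ B →
      (Summable fun ι => ‖indexGrad τ k ι‖ ^ 2) ∧
        ∑' ι, ‖indexGrad τ k ι‖ ^ 2 ≤ B.toReal := fun τ hτ => by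
    have h := (tsum_enorm_indexGrad_sq_le τ k).trans hτ
    refine ⟨summable_norm_sq_of_tsum_enorm_sq (ne_top_of_le_ne_top hB h), ?_⟩
    rw [tsum_norm_sq_eq_toReal]
    exact ENNReal.toReal_mono hB h
  -- Young's inequality: the large factor `1 / (4 * δ)` goes with the wave functions, whose squared
  -- norms have convergent sums, and the small `δ` with the gradients, whose sums are merely
  -- bounded.
  have hb : ∀ δ > (0 : ℝ), ∀ (τ : FockOp s d) (ι : CurrentIndex s d),
      |(innerOn {z | z ι.2.2 ∈ A} (indexWave τ ι) (indexGrad τ k ι)).im| ≤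
        1 / (4 * δ) * ‖indexWave τ ι‖ ^ 2 + δ * ‖indexGrad τ k ι‖ ^ 2 := fun δ hδ τ ι => by
    refine (Complex.abs_im_le_norm _).trans ((norm_innerOn_le _ _ _).trans ?_)
    have h := sq_nonneg (‖indexWave τ ι‖ - 2 * δ * ‖indexGrad τ k ι‖)
    rw [div_mul_eq_mul_div, one_mul, div_add' _ _ _ (by positivity), le_div_iff₀ (by positivity)]
    nlinarith
  refine tendsto_tsum_of_abs_le_mul_add (c := fun m ι => ‖indexWave (ρ m) ι‖ ^ 2)
    (c' := fun ι => ‖indexWave ρs ι‖ ^ 2) (y := fun m ι => ‖indexGrad (ρ m) k ι‖ ^ 2)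
    (y' := fun ι => ‖indexGrad ρs k ι‖ ^ 2) (K := fun δ => 1 / (4 * δ)) (C := B.toReal)
    (fun ι => ?_) (fun ι => ?_) (fun m => (hw _ (hn m)).1) (hw _ rfl).1 ?_
    (fun m => (hg _ (hρ m)).1) (hg _ hρs).1 (fun _ _ => by positivity) (fun _ => by positivity)
    (fun m => (hg _ (hρ m)).2) (hg _ hρs).2 (fun δ hδ m ι => hb δ hδ _ ι) (fun δ hδ ι => hb δ hδ _ ι)
  · exact (Complex.continuous_im.tendsto _).comp (tendsto_innerOn _
      (tendsto_component (hcol ι.1) _)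
      (fun m => norm_weakGradient_sq_le hB (hρ m) ι.1 (ι.2.1 + 1) ι.2.2 k)
      (tendsto_inner_weakGradient_component hcol hH hHs hB hρ ι.1 (ι.2.1 + 1) ι.2.2 k))
  · exact (tendsto_component (hcol ι.1) _).norm.pow 2
  · simp only [fun m => (hw _ (hn m)).2, (hw _ rfl).2]
    exact tendsto_const_nhds

end

section

/-! ### Stability of the local constraints -/

theorem ae_le_of_lintegral_indicator_mul_le {α : Type*} [MeasurableSpace α] {μ : Measure α}
    [SigmaFinite μ] {f g : α → ℝ≥0∞} (hf : AEMeasurable f μ)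
    (h : ∀ A : Set α, MeasurableSet A →
      ∫⁻ x, A.indicator 1 x * f x ∂μ ≤ ∫⁻ x, A.indicator 1 x * g x ∂μ) : f ≤ᵐ[μ] g := by
  refine ae_le_of_forall_setLIntegral_le_of_sigmaFinite₀ hf fun A hA _ => ?_
  have key : ∀ u : α → ℝ≥0∞, ∫⁻ x, A.indicator 1 x * u x ∂μ = ∫⁻ x in A, u x ∂μ := fun u => by
    rw [← lintegral_indicator hA]
    refine lintegral_congr fun x => ?_
    by_cases hx : x ∈ A <;> simp [hx]
  simpa only [key] using h A hA

variable {s : Statistics} {d : ℕ} {P : Potentials d} {r₀ C : ℝ} {n₀ : Pos d → ℝ}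
  {u₀ : Pos d → Pos d} {e₀ : Pos d → ℝ}

namespace Potentials

/-- `toReal` sends `∞` to zero, so almost everywhere finiteness is needed to recover the extended
density from the real one. -/
theorem Coercive.densityE_ae_eq (h : P.Coercive r₀ C) {ρ : FockOp s d}
    (hρ : ρ ∈ P.feasible r₀ s n₀ u₀ e₀) : densityE ρ =ᵐ[volume] fun x => ENNReal.ofReal (n₀ x) := by
  filter_upwards [hρ.2.1, ae_lt_top' (aemeasurable_densityE ρ)
    (h.lintegral_densityE_lt_top hρ.1).ne] with x hx hx'
  rw [← hx]
  exact (ENNReal.ofReal_toReal hx'.ne).symm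

/-- Moving `V n` to the right isolates a nonnegative quantity that depends only on the constraints.
-/
theorem Coercive.kineticE_add_interactionE_ae_eq (h : P.Coercive r₀ C) (hP : P.Admissible)
    {ρ : FockOp s d} (hρ : ρ ∈ P.feasible r₀ s n₀ u₀ e₀) :
    (fun x => kineticE ρ x + P.interactionE r₀ ρ x) =ᵐ[volume]
      fun x => ENNReal.ofReal (e₀ x - P.V x * n₀ x) := by
  filter_upwards [hρ.2.1, hρ.2.2.2, ae_lt_top' (aemeasurable_kineticE ρ)
    (h.lintegral_kineticE_lt_top hρ.1).ne, ae_lt_top' (hP.aemeasurable_interactionE r₀ ρ)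
    (h.lintegral_interactionE_lt_top hP hρ.1).ne] with x hn he hk hi
  have he' : (kineticE ρ x).toReal + P.V x * density ρ x + (P.interactionE r₀ ρ x).toReal = e₀ x :=
    he
  rw [← he', ← hn, show ∀ a b c : ℝ, a + b + c - b = a + c by intros; ring,
    ENNReal.ofReal_add ENNReal.toReal_nonneg ENNReal.toReal_nonneg,
    ENNReal.ofReal_toReal hk.ne, ENNReal.ofReal_toReal hi.ne]

theorem nonneg_of_mem_feasible
    {ρ : FockOp s d} (hρ : ρ ∈ P.feasible r₀ s n₀ u₀ e₀) :
    ∀ᵐ x, 0 ≤ e₀ x - P.V x * n₀ x := by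
  filter_upwards [hρ.2.1, hρ.2.2.2] with x hn he
  have he' : (kineticE ρ x).toReal + P.V x * density ρ x + (P.interactionE r₀ ρ x).toReal = e₀ x :=
    he
  rw [← he', ← hn, show ∀ a b c : ℝ, a + b + c - b = a + c by intros; ring]
  exact add_nonneg ENNReal.toReal_nonneg ENNReal.toReal_nonneg

end Potentials

theorem eLpNorm_one_eq_lintegral_ofReal {α : Type*} [MeasurableSpace α] {μ : Measure α} {f : α → ℝ}
    (hf : ∀ᵐ x ∂μ, 0 ≤ f x) : eLpNorm f 1 μ = ∫⁻ x, ENNReal.ofReal (f x) ∂μ := by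
  rw [eLpNorm_one_eq_lintegral_enorm]
  refine lintegral_congr_ae ?_
  filter_upwards [hf] with x hx
  exact Real.enorm_of_nonneg hx

theorem eLpNorm_density {ρ : FockOp s d} (h : ∫⁻ x, densityE ρ x ≠ ⊤) :
    eLpNorm (density ρ) 1 volume = ∫⁻ x, densityE ρ x := by
  rw [eLpNorm_one_eq_lintegral_ofReal (f := density ρ) (Eventually.of_forall fun _ => ENNReal.toReal_nonneg)]
  refine lintegral_congr_ae ?_
  filter_upwards [ae_lt_top' (aemeasurable_densityE ρ) h] with x hx
  exact ENNReal.ofReal_toReal hx.ne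

theorem integrable_apply {u : Pos d → Pos d} (hu : Integrable u) (k : Fin d) :
    Integrable fun x => u x k :=
  (EuclideanSpace.proj (𝕜 := ℝ) k).integrable_comp hu

/-- The local constraints are stable under weak-* convergence without loss of particles or
energy. -/
theorem Potentials.Coercive.mem_feasible (h : P.Coercive r₀ C) (hP : P.Admissible)
    (hm : P.IsMoment r₀ s n₀ u₀ e₀) {ρ : ℕ → FockOp s d} {ρs : FockOp s d}
    (hρ : ∀ m, ρ m ∈ P.feasible r₀ s n₀ u₀ e₀) (hs : IsState ρs) (hw : WeakStarTendsto ρ ρs)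
    (hN : eLpNorm (density ρs) 1 volume = eLpNorm n₀ 1 volume)
    (hE : P.globalEnergy r₀ ρs = eLpNorm e₀ 1 volume) : ρs ∈ P.feasible r₀ s n₀ u₀ e₀ := by
  obtain ⟨hn₀, hn₀', hu₀, he₀, he₀', -⟩ := hm
  have hes : ρs ∈ P.energySpace r₀ s :=
    ⟨hs, hE ▸ (memLp_one_iff_integrable.2 he₀).eLpNorm_lt_top⟩
  have hcol := hw.column (fun m => (hρ m).1.1) hs
  have hH : ∀ m j n, MemH1 (component (column (ρ m) j) n) := fun m j n =>
    (inFormDomain_of_mem_energySpace (hρ m).1 j n).1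
  have hHs : ∀ j n, MemH1 (component (column ρs j) n) := fun j n =>
    (inFormDomain_of_mem_energySpace hes j n).1
  have hNs := (h.lintegral_densityE_lt_top hes).ne
  have hind : ∀ A : Set (Pos d), MeasurableSet A →
      AEMeasurable (A.indicator (1 : Pos d → ℝ≥0∞)) := fun A hA =>
    (measurable_one.indicator hA).aemeasurable
  -- the particle density
  have hd : densityE ρs =ᵐ[volume] fun x => ENNReal.ofReal (n₀ x) := by
    have hle : densityE ρs ≤ᵐ[volume] fun x => ENNReal.ofReal (n₀ x) := by
      refine ae_le_of_lintegral_indicator_mul_le (aemeasurable_densityE ρs) fun A hA => ?_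
      refine (densityE_lsc hcol (hind A hA)).trans (le_of_eq ?_)
      have h1 : ∀ m, ∫⁻ x, A.indicator 1 x * densityE (ρ m) x =
          ∫⁻ x, A.indicator 1 x * ENNReal.ofReal (n₀ x) := fun m => by
        refine lintegral_congr_ae ?_
        filter_upwards [h.densityE_ae_eq (hρ m)] with x hx
        rw [hx]
      simp only [h1]
      exact liminf_const _
    -- No particles are lost, so the one-sided bound has equal finite integrals and is an equality.
    refine ae_eq_of_ae_le_of_lintegral_le hle hNs hn₀.aemeasurable.ennreal_ofReal (le_of_eq ?_)
    rw [← eLpNorm_one_eq_lintegral_ofReal hn₀', ← hN, eLpNorm_density hNs]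
  have hdensity : density ρs =ᵐ[volume] n₀ := by
    filter_upwards [hd, hn₀'] with x hx hx'
    change (densityE ρs x).toReal = n₀ x
    rw [hx, ENNReal.toReal_ofReal hx']
  -- the energy density
  set f₀ : Pos d → ℝ≥0∞ := fun x => ENNReal.ofReal (e₀ x - P.V x * n₀ x) with hf₀
  have hf₀m : AEMeasurable f₀ :=
    (he₀.aemeasurable.sub (hP.aemeasurable_V.mul hn₀.aemeasurable)).ennreal_ofReal
  have hsum : ∀ m, (∫⁻ x, kineticE (ρ m) x) + (∫⁻ x, P.interactionE r₀ (ρ m) x) = ∫⁻ x, f₀ x :=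
    fun m => by
      rw [← lintegral_add_left' (aemeasurable_kineticE (ρ m))]
      exact lintegral_congr_ae (h.kineticE_add_interactionE_ae_eq hP (hρ m))
  have hB : ∫⁻ x, f₀ x ≠ ⊤ := by
    rw [← hsum 0]
    exact ENNReal.add_ne_top.2 ⟨(h.lintegral_kineticE_lt_top (hρ 0).1).ne,
      (h.lintegral_interactionE_lt_top hP (hρ 0).1).ne⟩
  have hkB : ∀ m, ∫⁻ x, kineticE (ρ m) x ≤ ∫⁻ x, f₀ x := fun m => hsum m ▸ le_self_add
  have hle : (fun x => kineticE ρs x + P.interactionE r₀ ρs x) ≤ᵐ[volume] f₀ := by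
    refine ae_le_of_lintegral_indicator_mul_le
      ((aemeasurable_kineticE ρs).add (hP.aemeasurable_interactionE r₀ ρs)) fun A hA => ?_
    have h1 : ∀ τ : FockOp s d, ∫⁻ x, A.indicator 1 x * (kineticE τ x + P.interactionE r₀ τ x) =
        (∫⁻ x, A.indicator 1 x * kineticE τ x) +
          ∫⁻ x, A.indicator 1 x * P.interactionE r₀ τ x := fun τ => by
      have hm : AEMeasurable fun x => A.indicator 1 x * kineticE τ x :=
        (hind A hA).mul (aemeasurable_kineticE τ)
      rw [← lintegral_add_left' hm]
      simp only [mul_add]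
    have h2 : ∀ m, (∫⁻ x, A.indicator 1 x * kineticE (ρ m) x) +
        (∫⁻ x, A.indicator 1 x * P.interactionE r₀ (ρ m) x) = ∫⁻ x, A.indicator 1 x * f₀ x :=
      fun m => by
        rw [← h1]
        refine lintegral_congr_ae ?_
        filter_upwards [h.kineticE_add_interactionE_ae_eq hP (hρ m)] with x hx
        rw [hx]
    rw [h1]
    -- The two parts need not converge separately; superadditivity of `liminf` recovers their fixed
    -- sum.
    refine (add_le_add (kineticE_lsc hcol hH hHs hB hkB (hind A hA))
      (interactionE_lsc hP r₀ hcol (hind A hA))).trans ?_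
    refine (liminf_add_liminf_le _ _).trans (le_of_eq ?_)
    simp only [h2]
    exact liminf_const _
  have hint : (∫⁻ x, kineticE ρs x + P.interactionE r₀ ρs x) = ∫⁻ x, f₀ x := by
    have hV := h.lintegral_V_lt_top hP hes
    have hVm : AEMeasurable fun x => ENNReal.ofReal (P.V x) * densityE ρs x :=
      hP.aemeasurable_V.ennreal_ofReal.mul (aemeasurable_densityE ρs)
    have hVm' : AEMeasurable fun x => ENNReal.ofReal (-P.V x) * densityE ρs x :=
      hP.aemeasurable_V.neg.ennreal_ofReal.mul (aemeasurable_densityE ρs)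
    -- Adding the finite integral of `V₊ n` to both sides allows the energy balance to be used in
    -- `[0, ∞]`. What remains is the pointwise identity `(e₀ - V n₀) + V₊ n₀ = e₀ + V₋ n₀`.
    rw [← ENNReal.add_left_inj hV.ne, lintegral_add_left' (aemeasurable_kineticE ρs),
      add_right_comm, h.lintegral_balance hP hes, hE, eLpNorm_one_eq_lintegral_ofReal he₀',
      ← lintegral_add_right' _ hVm', ← lintegral_add_right' _ hVm]
    refine lintegral_congr_ae ?_
    filter_upwards [hd, hn₀', he₀', nonneg_of_mem_feasible (hρ 0)] with x hx hn he hf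
    rw [hx, hf₀, ← ENNReal.ofReal_mul' hn, ← ENNReal.ofReal_mul' hn]
    dsimp only
    rcases le_total 0 (P.V x) with hVx | hVx
    · rw [ENNReal.ofReal_of_nonpos (p := -P.V x * n₀ x) (by nlinarith), add_zero,
        ← ENNReal.ofReal_add hf (by positivity), sub_add_cancel]
    · rw [ENNReal.ofReal_of_nonpos (p := P.V x * n₀ x) (by nlinarith), add_zero,
        ← ENNReal.ofReal_add he (by nlinarith)]
      congr 1
      ring
  have hk : ∫⁻ x, kineticE ρs x ≤ ∫⁻ x, f₀ x :=
    hint ▸ lintegral_mono fun x => le_self_add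
  have heq := ae_eq_of_ae_le_of_lintegral_le hle (hint.trans_ne hB) hf₀m hint.ge
  have henergy : P.energyDensity r₀ ρs =ᵐ[volume] e₀ := by
    filter_upwards [heq, hdensity, nonneg_of_mem_feasible (hρ 0),
      ae_lt_top' (aemeasurable_kineticE ρs) (ne_top_of_le_ne_top hB hk),
      ae_lt_top' (hP.aemeasurable_interactionE r₀ ρs)
        (h.lintegral_interactionE_lt_top hP hes).ne] with x hx hn hf hkx hix
    have h1 := congrArg ENNReal.toReal hx
    rw [ENNReal.toReal_add hkx.ne hix.ne, hf₀, ENNReal.toReal_ofReal hf] at h1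
    change (kineticE ρs x).toReal + P.V x * density ρs x + (P.interactionE r₀ ρs x).toReal = e₀ x
    rw [hn]
    linarith
  -- the current
  have hnum : ∀ m, ∫⁻ x, densityE (ρ m) x = ∫⁻ x, densityE ρs x := fun m =>
    lintegral_congr_ae ((h.densityE_ae_eq (hρ m)).trans hd.symm)
  have hcur : ∀ k : Fin d, (fun x => current ρs x k) =ᵐ[volume] fun x => u₀ x k := fun k => by
    refine Integrable.ae_eq_of_forall_setIntegral_eq _ _
      (integrable_current_apply hNs (ne_top_of_le_ne_top hB hk) k) (integrable_apply hu₀ k)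
      fun A _ _ => ?_
    -- The set integrals of the currents along the sequence are constantly those of `u₀`, and they
    -- also tend to those of the limit state.
    refine tendsto_nhds_unique
      (tendsto_setIntegral_current hcol hH hHs hB hkB hk hNs hnum k A) ?_
    have h1 : ∀ m, ∫ x in A, current (ρ m) x k = ∫ x in A, u₀ x k := fun m => by
      refine integral_congr_ae (ae_restrict_of_ae ?_)
      filter_upwards [(hρ m).2.2.1] with x hx
      rw [hx]
    simp only [h1]
    exact tendsto_const_nhds
  refine ⟨hes, hdensity, ?_, henergy⟩
  filter_upwards [ae_all_iff.2 hcur] with x hx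
  ext k
  exact hx k

end

end

end ManyBody

theorem proposition4p4 (d : ℕ) (hd : 1 ≤ d)
    (P : ManyBody.Potentials d) (hP : P.Admissible) :
    ∃ R : ℝ, ∀ r₀ : ℝ, R ≤ r₀ →
      ∀ (s : ManyBody.Statistics) (n₀ : ManyBody.Pos d → ℝ) (u₀ : ManyBody.Pos d → ManyBody.Pos d)
        (e₀ : ManyBody.Pos d → ℝ), P.IsMoment r₀ s n₀ u₀ e₀ →
      ∀ (ρ : ℕ → ManyBody.FockOp s d) (ρs : ManyBody.FockOp s d),
        (∀ m, ρ m ∈ P.feasible r₀ s n₀ u₀ e₀) →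
        Tendsto (fun m => ManyBody.entropy (ρ m)) atTop
          (𝓝 (⨅ σ ∈ P.feasible r₀ s n₀ u₀ e₀, ManyBody.entropy σ)) →
        ManyBody.IsState ρs →
        ManyBody.WeakStarTendsto ρ ρs →
        eLpNorm (ManyBody.density ρs) 1 volume = eLpNorm n₀ 1 volume →
        P.globalEnergy r₀ ρs = eLpNorm e₀ 1 volume →
        ρs ∈ P.feasible r₀ s n₀ u₀ e₀ := by
  obtain ⟨R, C, h⟩ := hP.exists_coercive hd
  refine ⟨R, fun r₀ hr s n₀ u₀ e₀ hm ρ ρs hρ _ hs hw hN hE => ?_⟩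
  exact (h r₀ hr).mem_feasible hP hm hρ hs hw hN hE
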